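/- Let $p\ge 1$, let $K$ be a finite (geometric) simplicial complex, and let $f:|K|\to\mathbb{R}$ be a PL function, i.e. $f$ interpolates its values at the vertices linearly on each simplex; assume that $f$ takes distinct values on distinct vertices. Homology is taken with coefficients in $\mathbb{Z}/2$: singular homology for subspaces of $|K|$, simplicial homology for subcomplexes of $K$. An open interval $I\subseteq\mathbb{R}$ is *regular* if there are a topological space $Y$ and a homeomorphism $\Phi:Y\times I\to f^{-1}(I)$ such that $f\circ\Phi$ is the projection onto $I$ and $\Phi$ extends to a continuous map $Y\times\bar I\to f^{-1}(\bar I)$, where $\bar I$ is the closure of $I$ in $\mathbb{R}$. A real number is a *critical value* of $f$ if it lies in no regular open interval. For a critical value $c$ let $c^-$ and $c^+$ be the preceding and the following critical value ($-\infty$, respectively $\infty$, if there is none). Then $c$ is a *$p$-th critical value* if at least one of the inclusion-induced maps $$H_p\big(f^{-1}(c^-,c)\big)\to H_p\big(f^{-1}(c^-,c^+)\big)\leftarrow H_p\big(f^{-1}(c,c^+)\big)$$ is not an isomorphism. Suppose that $K$ is *compatible with the $p$-th levelsets of $f$*: on each closed simplex of $K$, the values of $f$ include at most one $p$-th critical value.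 Then there are finitely many $p$-th critical values. List them, together with $\pm\infty$, as $\alpha_0=-\infty<\alpha_1<\dots<\alpha_m<\alpha_{m+1}=\infty$, and for $0\le i<j\le m+1$ let $X_{(i,j)}=f^{-1}(\alpha_i,\alpha_j)\subseteq|K|$ and let $K_{(i,j)}$ be the subcomplex of $K$ formed by the simplices all of whose vertices have values in $(\alpha_i,\alpha_j)$. Then: 1. For all $0\le i<j\le m+1$, the space $X_{(i,j)}$ deformation retracts onto $|K_{(i,j)}|$, by a deformation that keeps every point of $|K_{(i,j)}|$ fixed at all times. 2. The discrete and the continuous $p$-th levelset zigzag modules, with all maps induced by inclusion, $$H_p(K_{(0,1)})\to H_p(K_{(0,2)})\leftarrow H_p(K_{(1,2)})\to\cdots\to H_p(K_{(m-1,m+1)})\leftarrow H_p(K_{(m,m+1)}),$$ $$H_p(X_{(0,1)})\to H_p(X_{(0,2)})\leftarrow H_p(X_{(1,2)})\to\cdots\to H_p(X_{(m-1,m+1)})\leftarrow H_p(X_{(m,m+1)}),$$ are isomorphic as zigzag modules. -/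

import Mathlib

open CategoryTheory

noncomputable section

namespace LevelsetZigzag

/-! ### PL functions on a simplicial complex and preimages of intervals -/

section PL

variable {E : Type} [NormedAddCommGroup E] [NormedSpace ℝ E]

/-- `f` restricted to `|K|` is the PL function obtained by linear interpolation of its values on
the vertices. Only the values of `f` on `K.space` are ever used. -/
def IsPL (K : Geometry.SimplicialComplex ℝ E) (f : E → ℝ) : Prop :=
  ∀ s ∈ K.faces, ∀ w : E → ℝ, (∀ v ∈ s, 0 ≤ w v) → ∑ v ∈ s, w v = 1 →
    f (∑ v ∈ s, w v • v) = ∑ v ∈ s, w v * f v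

/-- A PL function is generic if it takes distinct values on the vertices. -/
def IsGeneric (K : Geometry.SimplicialComplex ℝ E) (f : E → ℝ) : Prop :=
  Set.InjOn f K.vertices

/-- `f⁻¹(I)`, where `f` is regarded as a function on `|K|`. -/
def levelPreimage (K : Geometry.SimplicialComplex ℝ E) (f : E → ℝ) (I : Set ℝ) : Set E :=
  {x | x ∈ K.space ∧ f x ∈ I}

/-- The open interval `(a, b)` of real numbers, with end points in `[-∞, ∞]`. -/
def openInterval (a b : EReal) : Set ℝ :=
  {t | a < (t : EReal) ∧ (t : EReal) < b}

theorem openInterval_mono {a b c d : EReal} (hca : c ≤ a) (hbd : b ≤ d) :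
    openInterval a b ⊆ openInterval c d :=
  fun _ h => ⟨hca.trans_lt h.1, h.2.trans_le hbd⟩

/-- The open preimage `f⁻¹(a, b)`. -/
def openPreimage (K : Geometry.SimplicialComplex ℝ E) (f : E → ℝ) (a b : EReal) : Set E :=
  levelPreimage K f (openInterval a b)

theorem openPreimage_mono (K : Geometry.SimplicialComplex ℝ E) (f : E → ℝ) {a b c d : EReal}
    (hca : c ≤ a) (hbd : b ≤ d) : openPreimage K f a b ⊆ openPreimage K f c d :=
  fun _ h => ⟨h.1, openInterval_mono hca hbd h.2⟩

/-- The subcomplex of the simplices all of whose vertices have values in `(a, b)`. -/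
def openSubcomplex (K : Geometry.SimplicialComplex ℝ E) (f : E → ℝ) (a b : EReal) :
    Geometry.SimplicialComplex ℝ E where
  faces := {s | s ∈ K.faces ∧ ∀ v ∈ s, f v ∈ openInterval a b}
  isRelLowerSet_faces := fun _ hs =>
    ⟨K.nonempty_of_mem_faces hs.1, fun _ hts ht =>
      ⟨K.down_closed hs.1 hts ht, fun v hv => hs.2 v (hts hv)⟩⟩
  indep := fun hs => K.indep hs.1
  inter_subset_convexHull := fun hs ht => K.inter_subset_convexHull hs.1 ht.1

theorem openSubcomplex_mono (K : Geometry.SimplicialComplex ℝ E) (f : E → ℝ) {a b c d : EReal}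
    (hca : c ≤ a) (hbd : b ≤ d) :
    (openSubcomplex K f a b).faces ⊆ (openSubcomplex K f c d).faces :=
  fun _ h => ⟨h.1, fun v hv => openInterval_mono hca hbd (h.2 v hv)⟩

/-- `X` deformation retracts onto its subspace `A`: there is a homotopy from the identity of `X`
to a retraction onto `A` that keeps every point of `A` fixed throughout. -/
def DeformationRetractsTo (X A : Set E) : Prop :=
  A ⊆ X ∧ ∃ H : C(unitInterval × X, X),
    (∀ x, H (0, x) = x) ∧ (∀ x, (H (1, x) : E) ∈ A) ∧
      ∀ t, ∀ x : X, (x : E) ∈ A → H (t, x) = x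

end PL

/-! ### Homology with coefficients in `ℤ/2` -/

section Homology

variable {E : Type}

/-- The boundary operator on formal sums of finite vertex sets: a simplex with at least two
vertices goes to the sum of its facets, a vertex goes to `0`. -/
def boundary (E : Type) : (Finset E →₀ ZMod 2) →ₗ[ZMod 2] (Finset E →₀ ZMod 2) :=
  open Classical in
  Finsupp.linearCombination (ZMod 2) fun s : Finset E =>
    if s.card ≤ 1 then 0 else ∑ v ∈ s, Finsupp.single (s.erase v) (1 : ZMod 2)

/-- `p`-chains: formal sums of `p`-simplices. -/
def chains (p : ℕ) (F : Set (Finset E)) : Submodule (ZMod 2) (Finset E →₀ ZMod 2) :=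
  Finsupp.supported (ZMod 2) (ZMod 2) {s | s ∈ F ∧ s.card = p + 1}

theorem chains_mono (p : ℕ) {F G : Set (Finset E)} (h : F ⊆ G) : chains p F ≤ chains p G :=
  Finsupp.supported_mono fun _ hs => ⟨h hs.1, hs.2⟩

/-- `p`-cycles. -/
def cycles (p : ℕ) (F : Set (Finset E)) : Submodule (ZMod 2) (Finset E →₀ ZMod 2) :=
  chains p F ⊓ LinearMap.ker (boundary E)

theorem cycles_mono (p : ℕ) {F G : Set (Finset E)} (h : F ⊆ G) : cycles p F ≤ cycles p G :=
  inf_le_inf_right _ (chains_mono p h)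

/-- `p`-boundaries. -/
def boundaries (p : ℕ) (F : Set (Finset E)) : Submodule (ZMod 2) (Finset E →₀ ZMod 2) :=
  (chains (p + 1) F).map (boundary E)

theorem boundaries_mono (p : ℕ) {F G : Set (Finset E)} (h : F ⊆ G) :
    boundaries p F ≤ boundaries p G :=
  Submodule.map_mono (chains_mono (p + 1) h)

/-- The `p`-boundaries as a subspace of the `p`-cycles. -/
def boundariesInCycles (p : ℕ) (F : Set (Finset E)) : Submodule (ZMod 2) (cycles p F) :=
  (boundaries p F).comap (cycles p F).subtype

/-- The `p`-th simplicial homology, cycles modulo boundaries, of the simplicial complex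
with set of simplices `F`. -/
def simplicialHomology (p : ℕ) (F : Set (Finset E)) : ModuleCat.{0} (ZMod 2) :=
  ModuleCat.of (ZMod 2) (cycles p F ⧸ boundariesInCycles p F)

/-- The map induced on simplicial homology by the inclusion of a subcomplex. -/
def simplicialHomologyMap (p : ℕ) {F G : Set (Finset E)} (h : F ⊆ G) :
    simplicialHomology p F ⟶ simplicialHomology p G :=
  ModuleCat.ofHom <| Submodule.mapQ (boundariesInCycles p F) (boundariesInCycles p G)
    (Submodule.inclusion (cycles_mono p h)) fun _ hx => boundaries_mono p h hx

variable [TopologicalSpace E]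

/-- The `p`-th singular homology of a subspace. -/
def singularHomology (p : ℕ) (S : Set E) : ModuleCat.{0} (ZMod 2) :=
  ((AlgebraicTopology.singularHomologyFunctor (ModuleCat.{0} (ZMod 2)) p).obj
    (ModuleCat.of (ZMod 2) (ZMod 2))).obj (TopCat.of S)

/-- The map induced on singular homology by the inclusion of a subspace. -/
def singularHomologyMap (p : ℕ) {S T : Set E} (h : S ⊆ T) :
    singularHomology p S ⟶ singularHomology p T :=
  ((AlgebraicTopology.singularHomologyFunctor (ModuleCat.{0} (ZMod 2)) p).obj
    (ModuleCat.of (ZMod 2) (ZMod 2))).map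
      (TopCat.ofHom ⟨Set.inclusion h, continuous_inclusion h⟩)

end Homology

/-! ### Critical values -/

section Critical

variable {E : Type} [NormedAddCommGroup E] [NormedSpace ℝ E]

/-- The interval `I` is regular for `f`: there are a space `Y` and a homeomorphism
`Φ : Y × I ≃ f⁻¹(I)` over `I` that extends to a continuous map
`Φ' : Y × closure I → f⁻¹(closure I)`. -/
def IsRegularInterval (K : Geometry.SimplicialComplex ℝ E) (f : E → ℝ) (I : Set ℝ) : Prop :=
  ∃ (Y : Type) (_ : TopologicalSpace Y) (Φ : (Y × I) ≃ₜ levelPreimage K f I)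
    (Φ' : C(Y × closure I, levelPreimage K f (closure I))),
    (∀ (y : Y) (t : I), f (Φ (y, t)) = t) ∧
      ∀ (y : Y) (t : I), (Φ' (y, ⟨t, subset_closure t.2⟩) : E) = Φ (y, t)

/-- The (finite) critical values of `f`: the numbers that lie in no regular open interval. -/
def criticalValues (K : Geometry.SimplicialComplex ℝ E) (f : E → ℝ) : Set ℝ :=
  {c | ¬ ∃ a b : EReal, c ∈ openInterval a b ∧ IsRegularInterval K f (openInterval a b)}

/-- The critical value preceding `c`, which is `-∞` if there is none. -/
def prevCritical (K : Geometry.SimplicialComplex ℝ E) (f : E → ℝ) (c : ℝ) : EReal :=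
  sSup ((fun t : ℝ => (t : EReal)) '' {t | t ∈ criticalValues K f ∧ t < c})

/-- The critical value following `c`, which is `∞` if there is none. -/
def nextCritical (K : Geometry.SimplicialComplex ℝ E) (f : E → ℝ) (c : ℝ) : EReal :=
  sInf ((fun t : ℝ => (t : EReal)) '' {t | t ∈ criticalValues K f ∧ c < t})

theorem prevCritical_le (K : Geometry.SimplicialComplex ℝ E) (f : E → ℝ) (c : ℝ) :
    prevCritical K f c ≤ c := by
  refine sSup_le ?_
  rintro _ ⟨t, ht, rfl⟩
  exact EReal.coe_le_coe_iff.2 ht.2.le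

theorem le_nextCritical (K : Geometry.SimplicialComplex ℝ E) (f : E → ℝ) (c : ℝ) :
    (c : EReal) ≤ nextCritical K f c := by
  refine le_sInf ?_
  rintro _ ⟨t, ht, rfl⟩
  exact EReal.coe_le_coe_iff.2 ht.2.le

/-- The (finite) `p`-th homologically critical values of `f`: the critical values `c`, lying
between the adjacent critical values `c⁻` and `c⁺`, for which one of the maps
`H_p(f⁻¹(c⁻, c)) → H_p(f⁻¹(c⁻, c⁺)) ← H_p(f⁻¹(c, c⁺))` is not an isomorphism. -/
def homologicallyCriticalValues (p : ℕ) (K : Geometry.SimplicialComplex ℝ E) (f : E → ℝ) :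
    Set ℝ :=
  {c | c ∈ criticalValues K f ∧
    ¬ (IsIso (singularHomologyMap p
          (openPreimage_mono K f (le_refl (prevCritical K f c)) (le_nextCritical K f c))) ∧
       IsIso (singularHomologyMap p
          (openPreimage_mono K f (prevCritical_le K f c) (le_refl (nextCritical K f c)))))}

/-- `K` is compatible with the `p`-th levelsets of `f`: the values of `f` on each closed simplex
include at most one `p`-th homologically critical value. -/
def IsCompatible (p : ℕ) (K : Geometry.SimplicialComplex ℝ E) (f : E → ℝ) : Prop :=
  ∀ s ∈ K.faces,
    (f '' convexHull ℝ (s : Set E) ∩ homologicallyCriticalValues p K f).Subsingleton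

/-- `α 0 < ⋯ < α (m + 1)` is the list of all `p`-th homologically critical values of `f`,
including `-∞` and `∞` (so that `α 0 = -∞` and `α (m + 1) = ∞`). -/
def IsHomologicallyCriticalList (p : ℕ) (K : Geometry.SimplicialComplex ℝ E) (f : E → ℝ) {m : ℕ}
    (α : Fin (m + 2) ↪o EReal) : Prop :=
  Set.range α =
    insert ⊥ (insert ⊤ ((fun t : ℝ => (t : EReal)) '' homologicallyCriticalValues p K f))

end Critical

/-! ### Zigzag modules -/

/-- A zigzag module `V 0 → W 0 ← V 1 → W 1 ← ⋯ → W (m - 1) ← V m` of vector spaces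
over `ℤ/2`. -/
structure ZigzagModule (m : ℕ) where
  V : Fin (m + 1) → ModuleCat.{0} (ZMod 2)
  W : Fin m → ModuleCat.{0} (ZMod 2)
  forward : ∀ i : Fin m, V i.castSucc ⟶ W i
  backward : ∀ i : Fin m, V i.succ ⟶ W i

/-- An isomorphism of zigzag modules: isomorphisms between corresponding spaces that commute
with all the maps. -/
structure ZigzagModule.Iso {m : ℕ} (M N : ZigzagModule m) where
  isoV : ∀ i, M.V i ≅ N.V i
  isoW : ∀ i, M.W i ≅ N.W i
  forward_comm : ∀ i : Fin m,
    M.forward i ≫ (isoW i).hom = (isoV i.castSucc).hom ≫ N.forward i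
  backward_comm : ∀ i : Fin m,
    M.backward i ≫ (isoW i).hom = (isoV i.succ).hom ≫ N.backward i

section Modules

variable {E : Type} [NormedAddCommGroup E] [NormedSpace ℝ E]

/-- The `p`-th homology of the continuous levelset filtration
`f⁻¹(α 0, α 1) ↪ f⁻¹(α 0, α 2) ↩ f⁻¹(α 1, α 2) ↪ ⋯ ↩ f⁻¹(α m, α (m + 1))`. -/
def continuousModule (p : ℕ) (K : Geometry.SimplicialComplex ℝ E) (f : E → ℝ) {m : ℕ}
    (α : Fin (m + 2) ↪o EReal) : ZigzagModule m where
  V i := singularHomology p (openPreimage K f (α i.castSucc) (α i.succ))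
  W i := singularHomology p (openPreimage K f (α i.castSucc.castSucc) (α i.succ.succ))
  forward i := singularHomologyMap p (openPreimage_mono K f le_rfl
    (α.monotone (Fin.castSucc_lt_succ (i := i.succ)).le))
  backward i := singularHomologyMap p (openPreimage_mono K f
    (α.monotone (Fin.castSucc_le_castSucc_iff.2 (Fin.castSucc_lt_succ (i := i)).le)) le_rfl)

/-- The `p`-th homology of the discrete levelset filtration, formed by the subcomplexes of the
simplices all of whose vertices have values in the intervals
`(α 0, α 1), (α 0, α 2), (α 1, α 2), …, (α m, α (m + 1))`. -/
def discreteModule (p : ℕ) (K : Geometry.SimplicialComplex ℝ E) (f : E → ℝ) {m : ℕ}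
    (α : Fin (m + 2) ↪o EReal) : ZigzagModule m where
  V i := simplicialHomology p (openSubcomplex K f (α i.castSucc) (α i.succ)).faces
  W i := simplicialHomology p
    (openSubcomplex K f (α i.castSucc.castSucc) (α i.succ.succ)).faces
  forward i := simplicialHomologyMap p (openSubcomplex_mono K f le_rfl
    (α.monotone (Fin.castSucc_lt_succ (i := i.succ)).le))
  backward i := simplicialHomologyMap p (openSubcomplex_mono K f
    (α.monotone (Fin.castSucc_le_castSucc_iff.2 (Fin.castSucc_lt_succ (i := i)).le)) le_rfl)

end Modules

end LevelsetZigzag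

end

/-!
# Levelset zigzag modules of PL functions

**Deformation retractions.** Let `α i < α j` be two terms of the list of `p`-th critical values.
By compatibility, a simplex of `K` cannot have both a vertex with value at most `α i` and a vertex
with value at least `α j`: the segment between them would attain both critical values. Hence a
simplex containing a point `x` with value in `(α i, α j)` has all its vertices on one side of one
of the two ends, and some vertex of the carrier of `x` has a value in the interval. Dropping the
barycentric coordinates of `x` at the other vertices and scaling gives a retraction onto
`|K_(i,j)|`, and the straight line homotopy to it does not leave the interval, since `f` is affine
on each simplex (`IsPL.deformationRetractsTo`, `IsCompatible.deformationRetractsTo`).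

**The zigzag isomorphism.** The retraction reduces the claim to the natural isomorphism of
simplicial and singular homology for a finite complex. It is built on explicit chains modulo `2`.
Mathlib's singular homology is identified with cycles modulo boundaries of formal sums of
continuous maps (`singularClass_surjective`, `singularClass_eq_zero_iff`). Operators on singular
chains come from chains of the standard simplex or of the prism over it, and these are chains of
lists of points, which form an acyclic complex, the contraction being given by cones; barycentric
subdivision, prisms and all chain homotopies arise from one recursion (`coneRec`). A singular
simplex of `|K|` that is small with respect to the barycentric coordinates is moved by a straight
line homotopy, within `|K|`, to the affine simplex on the vertices at which the coordinates of its
corners are large (`exists_singularBoundary_eq_add_realize`). After sufficiently fine subdivision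
this applies to all simplices of a chain, and so every singular cycle is homologous to a
simplicial one (`exists_simplicial_cycle`) and a simplicial cycle that bounds a singular chain
bounds a simplicial one (`mem_boundaries_of_singularBoundary_eq`). The comparison maps commute
with inclusions (`homologyComparisonIso_naturality`).

**Finiteness.** On an interval without vertex values, each point of `|K|` lies on the segment from
its projection to the lower vertices to its projection to the upper vertices. Sliding along these
segments shows that the interval is regular (`IsPL.exists_slide`, `IsPL.isRegularInterval`), so
each critical value is the value of one of the finitely many vertices.
-/

noncomputable section

namespace LevelsetZigzag

/-! ### Homology classes of cycles -/

section Concrete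

open Limits

variable {R : Type} [Ring R] (C : ChainComplex (ModuleCat.{0} R) ℕ) (n : ℕ)

/-- The map sending a cycle of a chain complex of modules to its homology class. Only positive
degrees are treated, in which the cycles are the kernel of a differential to a definite lower
degree. -/
def homologyClass : LinearMap.ker (C.d (n + 1) n).hom →ₗ[R] C.homology (n + 1) :=
  (C.liftCycles (A := ModuleCat.of R (LinearMap.ker (C.d (n + 1) n).hom))
    (ModuleCat.ofHom (LinearMap.ker (C.d (n + 1) n).hom).subtype) n (by simp)
    (by ext x; exact x.2) ≫ C.homologyπ (n + 1)).hom

lemma homologyClass_surjective : Function.Surjective (homologyClass C n) := by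
  intro y
  obtain ⟨c, rfl⟩ := (ModuleCat.epi_iff_surjective (C.homologyπ (n + 1))).1 inferInstance y
  have hc : (C.d (n + 1) n).hom ((C.iCycles (n + 1)).hom c) = 0 := by
    have := C.iCycles_d (n + 1) n
    exact congr($(this).hom c)
  refine ⟨⟨(C.iCycles (n + 1)).hom c, hc⟩, ?_⟩
  have : (C.liftCycles (A := ModuleCat.of R (LinearMap.ker (C.d (n + 1) n).hom))
    (ModuleCat.ofHom (LinearMap.ker (C.d (n + 1) n).hom).subtype) n (by simp)
    (by ext x; exact x.2)).hom ⟨(C.iCycles (n + 1)).hom c, hc⟩ = c := by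
    apply (ModuleCat.mono_iff_injective (C.iCycles (n + 1))).1 inferInstance
    have h := C.liftCycles_i (A := ModuleCat.of R (LinearMap.ker (C.d (n + 1) n).hom))
      (ModuleCat.ofHom (LinearMap.ker (C.d (n + 1) n).hom).subtype) n (by simp)
      (by ext x; exact x.2)
    exact congr($(h).hom ⟨(C.iCycles (n + 1)).hom c, hc⟩)
  exact congrArg (C.homologyπ (n + 1)).hom this

lemma homologyClass_eq_zero_iff (z : LinearMap.ker (C.d (n + 1) n).hom) :
    homologyClass C n z = 0 ↔ ∃ c, (C.d (n + 2) (n + 1)).hom c = z := by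
  have hex : (ShortComplex.mk _ _ (C.toCycles_comp_homologyπ (n + 2) (n + 1))).Exact :=
    ShortComplex.exact_of_g_is_cokernel _ (C.homologyIsCokernel (n + 2) (n + 1) (by simp))
  rw [ShortComplex.moduleCat_exact_iff] at hex
  have h := C.liftCycles_i (A := ModuleCat.of R (LinearMap.ker (C.d (n + 1) n).hom))
      (ModuleCat.ofHom (LinearMap.ker (C.d (n + 1) n).hom).subtype) n (by simp)
      (by ext x; exact x.2)
  have h' := congr($(h).hom z)
  constructor
  · intro hz
    obtain ⟨c, hc⟩ := hex _ hz
    refine ⟨c, ?_⟩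
    have h2 := congr($(C.toCycles_i (n + 2) (n + 1)).hom c)
    rw [← h2]
    refine Eq.trans ?_ h'
    exact congrArg (C.iCycles (n + 1)).hom hc
  · rintro ⟨c, hc⟩
    have h2 := congr($(C.toCycles_i (n + 2) (n + 1)).hom c)
    have h3 := congr($(C.toCycles_comp_homologyπ (n + 2) (n + 1)).hom c)
    refine Eq.trans (congrArg (C.homologyπ (n + 1)).hom ?_) h3
    apply (ModuleCat.mono_iff_injective (C.iCycles (n + 1))).1 inferInstance
    refine Eq.trans h' (Eq.trans hc.symm h2.symm)

lemma homologyMap_homologyClass {C D : ChainComplex (ModuleCat.{0} R) ℕ} (φ : C ⟶ D) (n : ℕ)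
    (z : LinearMap.ker (C.d (n + 1) n).hom) (w : LinearMap.ker (D.d (n + 1) n).hom)
    (hw : (φ.f (n + 1)).hom z = w) :
    (HomologicalComplex.homologyMap φ (n + 1)).hom (homologyClass C n z) = homologyClass D n w := by
  have h1 := congr($(HomologicalComplex.homologyπ_naturality φ (n + 1)).hom
    ((C.liftCycles (A := ModuleCat.of R (LinearMap.ker (C.d (n + 1) n).hom))
    (ModuleCat.ofHom (LinearMap.ker (C.d (n + 1) n).hom).subtype) n (by simp)
    (by ext x; exact x.2)).hom z))
  refine Eq.trans h1 ?_
  refine congrArg (D.homologyπ (n + 1)).hom ?_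
  apply (ModuleCat.mono_iff_injective (D.iCycles (n + 1))).1 inferInstance
  have h := C.liftCycles_i (A := ModuleCat.of R (LinearMap.ker (C.d (n + 1) n).hom))
      (ModuleCat.ofHom (LinearMap.ker (C.d (n + 1) n).hom).subtype) n (by simp)
      (by ext x; exact x.2)
  have h' := congr($(h).hom z)
  have k := D.liftCycles_i (A := ModuleCat.of R (LinearMap.ker (D.d (n + 1) n).hom))
      (ModuleCat.ofHom (LinearMap.ker (D.d (n + 1) n).hom).subtype) n (by simp)
      (by ext x; exact x.2)
  have k' := congr($(k).hom w)
  refine Eq.trans ?_ k'.symm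
  have m := congr($(HomologicalComplex.cyclesMap_i φ (n + 1)).hom
    ((C.liftCycles (A := ModuleCat.of R (LinearMap.ker (C.d (n + 1) n).hom))
    (ModuleCat.ofHom (LinearMap.ker (C.d (n + 1) n).hom).subtype) n (by simp)
    (by ext x; exact x.2)).hom z))
  refine Eq.trans m ?_
  exact Eq.trans (congrArg (φ.f (n + 1)).hom h') hw

end Concrete

/-! ### Singular chains modulo `2` -/

section SingularChains

variable {X Y : Type} [TopologicalSpace X] [TopologicalSpace Y]

/-- Singular `n`-chains of `X` with coefficients in `ℤ/2`. -/
abbrev SingularChain (n : ℕ) (X : Type) [TopologicalSpace X] :=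
  C(stdSimplex ℝ (Fin (n + 1)), X) →₀ ZMod 2

/-- The inclusion of the `i`-th face of the standard `(n + 1)`-simplex. -/
def faceMap {n : ℕ} (i : Fin (n + 2)) :
    C(stdSimplex ℝ (Fin (n + 1)), stdSimplex ℝ (Fin (n + 2))) :=
  ⟨stdSimplex.map i.succAbove, stdSimplex.continuous_map _⟩

/-- The boundary operator on singular chains modulo `2`. -/
def singularBoundary (n : ℕ) (X : Type) [TopologicalSpace X] :
    SingularChain (n + 1) X →ₗ[ZMod 2] SingularChain n X :=
  Finsupp.linearCombination (ZMod 2) fun σ => ∑ i, Finsupp.single (σ.comp (faceMap i)) 1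

/-- Singular chains all of whose simplices have image in `S`. -/
def singularChainsIn (n : ℕ) (S : Set X) : Submodule (ZMod 2) (SingularChain n X) :=
  Finsupp.supported (ZMod 2) (ZMod 2) {σ | ∀ x, σ x ∈ S}

/-- Mathlib's singular chain complex of `X` with coefficients in `ℤ/2`. -/
abbrev singularComplex (X : Type) [TopologicalSpace X] : ChainComplex (ModuleCat.{0} (ZMod 2)) ℕ :=
  (TopCat.toSSet.obj (TopCat.of X)).chainComplex (ModuleCat.of (ZMod 2) (ZMod 2))

/-- A continuous map from the standard simplex as a simplex of the singular simplicial set. -/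
def toSimplex (n : ℕ) (σ : C(stdSimplex ℝ (Fin (n + 1)), X)) :
    (TopCat.toSSet.obj (TopCat.of X)).obj (Opposite.op (SimplexCategory.mk n)) :=
  ((TopCat.of X).toSSetObjEquiv (Opposite.op (SimplexCategory.mk n))).symm σ

/-- The comparison of explicit singular chains with Mathlib's singular chain complex, whose chains
are a coproduct of copies of `ℤ/2`. -/
def chainComparison (n : ℕ) (X : Type) [TopologicalSpace X] :
    SingularChain n X →ₗ[ZMod 2] (singularComplex X).X n :=
  Finsupp.linearCombination (ZMod 2) fun σ =>
    (SSet.ιChainComplex (X := TopCat.toSSet.obj (TopCat.of X))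
      (R := ModuleCat.of (ZMod 2) (ZMod 2)) (x := toSimplex n σ)).hom (1 : ZMod 2)

lemma chainComparison_single (n : ℕ) (σ : C(stdSimplex ℝ (Fin (n + 1)), X)) :
    chainComparison n X (Finsupp.single σ 1) =
      (SSet.ιChainComplex (X := TopCat.toSSet.obj (TopCat.of X))
      (R := ModuleCat.of (ZMod 2) (ZMod 2)) (x := toSimplex n σ)).hom (1 : ZMod 2) :=
  (Finsupp.linearCombination_single _ _ _).trans (one_smul _ _)

lemma toSimplex_face (n : ℕ) (σ : C(stdSimplex ℝ (Fin (n + 2)), X)) (i : Fin (n + 2)) :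
    (TopCat.toSSet.obj (TopCat.of X)).δ i (toSimplex (n + 1) σ) =
      toSimplex n (σ.comp (faceMap i)) := by
  rfl

lemma toSimplex_map (n : ℕ) (f : C(X, Y)) (σ : C(stdSimplex ℝ (Fin (n + 1)), X)) :
    (TopCat.toSSet.map (TopCat.ofHom f)).app _ (toSimplex n σ) = toSimplex n (f.comp σ) := by
  rfl

lemma chainComparison_boundary (n : ℕ) (c : SingularChain (n + 1) X) :
    ((singularComplex X).d (n + 1) n).hom (chainComparison (n + 1) X c) =
      chainComparison n X (singularBoundary n X c) := by
  suffices h : ((singularComplex X).d (n + 1) n).hom ∘ₗ (chainComparison (n + 1) X) =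
      chainComparison n X ∘ₗ (singularBoundary n X) from congr($h c)
  ext σ
  have h := SSet.ιChainComplex_d (C := ModuleCat.{0} (ZMod 2)) (R := ModuleCat.of (ZMod 2) (ZMod 2))
    (x := toSimplex (n + 1) σ)
  have h1 := congr($(h).hom (1 : ZMod 2))
  simp only [LinearMap.comp_apply, Finsupp.lsingle_apply, chainComparison_single,
    singularBoundary, Finsupp.linearCombination_single, one_smul, map_sum]
  refine Eq.trans h1 ?_
  rw [ModuleCat.hom_sum, LinearMap.sum_apply]
  refine Finset.sum_congr rfl fun i _ => ?_
  -- modulo `2` the sign of the `i`-th face does not matter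
  have : ((-1 : ℤ) ^ (i : ℕ)) = 1 ∨ ((-1 : ℤ) ^ (i : ℕ)) = -1 := neg_one_pow_eq_or ℤ _
  rw [toSimplex_face]
  rcases this with h | h
  · rw [h, one_smul]
  · rw [h, neg_smul, one_smul, ModuleCat.hom_neg, LinearMap.neg_apply]
    exact ZModModule.neg_eq_self _

lemma chainComparison_bijective (n : ℕ) : Function.Bijective (chainComparison n X) := by
  let K := TopCat.toSSet.obj (TopCat.of X)
  let e := (TopCat.of X).toSSetObjEquiv (Opposite.op (SimplexCategory.mk n))
  let G : (singularComplex X).X n ⟶ ModuleCat.of (ZMod 2) (SingularChain n X) :=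
    Limits.Cofan.IsColimit.desc
      (SSet.isColimitChainComplexXCofan K (ModuleCat.of (ZMod 2) (ZMod 2)) n)
      (fun x : K.obj (Opposite.op (SimplexCategory.mk n)) =>
        ModuleCat.ofHom (Finsupp.lsingle (e x)))
  have hG : ∀ x : K.obj (Opposite.op (SimplexCategory.mk n)),
      SSet.ιChainComplex K x ≫ G = ModuleCat.ofHom (Finsupp.lsingle (e x)) := fun x =>
    Limits.Cofan.IsColimit.fac
      (SSet.isColimitChainComplexXCofan K (ModuleCat.of (ZMod 2) (ZMod 2)) n) _ x
  refine Function.bijective_iff_has_inverse.2 ⟨G.hom, fun c => ?_, fun c => ?_⟩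
  · suffices h : G.hom ∘ₗ (chainComparison n X) = LinearMap.id from congr($h c)
    ext1 σ
    ext1
    have := congr($(hG (toSimplex n σ)).hom (1 : ZMod 2))
    simp only [LinearMap.comp_apply, Finsupp.lsingle_apply, chainComparison_single,
      LinearMap.id_apply]
    refine Eq.trans this ?_
    simp only [ModuleCat.hom_ofHom, Finsupp.lsingle_apply]
    rw [show e (toSimplex n σ) = σ from Equiv.apply_symm_apply _ _]
  · suffices h : G ≫ ModuleCat.ofHom (chainComparison n X) = 𝟙 _ from congr($(h).hom c)
    refine SSet.chainComplex_hom_ext (X := K) (R := ModuleCat.of (ZMod 2) (ZMod 2)) fun x => ?_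
    rw [← Category.assoc, hG, Category.comp_id]
    ext
    simp only [ModuleCat.hom_comp, LinearMap.comp_apply, ModuleCat.hom_ofHom,
      Finsupp.lsingle_apply, chainComparison_single]
    rw [show toSimplex n (e x) = x from Equiv.symm_apply_apply _ _]

lemma chainComparison_map (n : ℕ) (f : C(X, Y)) (c : SingularChain n X) :
    ((SSet.chainComplexMap (TopCat.toSSet.map (TopCat.ofHom f))
      (ModuleCat.of (ZMod 2) (ZMod 2))).f n).hom (chainComparison n X c) =
      chainComparison n Y (Finsupp.lmapDomain (ZMod 2) (ZMod 2) (fun σ => f.comp σ) c) := by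
  suffices h : ((SSet.chainComplexMap (TopCat.toSSet.map (TopCat.ofHom f))
      (ModuleCat.of (ZMod 2) (ZMod 2))).f n).hom ∘ₗ (chainComparison n X) =
      chainComparison n Y ∘ₗ (Finsupp.lmapDomain (ZMod 2) (ZMod 2) (fun σ => f.comp σ)) from
    congr($h c)
  ext σ
  have h := SSet.ι_chainComplexMap_f (R := ModuleCat.of (ZMod 2) (ZMod 2))
    (f := TopCat.toSSet.map (TopCat.ofHom f)) (x := toSimplex n σ)
  have h1 := congr($(h).hom (1 : ZMod 2))
  simp only [LinearMap.comp_apply, Finsupp.lsingle_apply, chainComparison_single,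
    Finsupp.lmapDomain_apply, Finsupp.mapDomain_single]
  refine Eq.trans h1 ?_
  rw [toSimplex_map]

/-- The map induced on singular chains by a continuous map. -/
def singularChainMap (n : ℕ) (f : C(X, Y)) : SingularChain n X →ₗ[ZMod 2] SingularChain n Y :=
  Finsupp.lmapDomain (ZMod 2) (ZMod 2) (fun σ => f.comp σ)

lemma singularChainMap_single (n : ℕ) (f : C(X, Y)) (σ : C(stdSimplex ℝ (Fin (n + 1)), X))
    (r : ZMod 2) : singularChainMap n f (Finsupp.single σ r) = Finsupp.single (f.comp σ) r := by
  simp [singularChainMap]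

lemma singularChainMap_singularChainMap {Z : Type} [TopologicalSpace Z] (n : ℕ) (f : C(X, Y))
    (g : C(Y, Z)) (c : SingularChain n X) :
    singularChainMap n g (singularChainMap n f c) = singularChainMap n (g.comp f) c :=
  Finsupp.mapDomain_comp.symm

lemma singularBoundary_single (n : ℕ) (σ : C(stdSimplex ℝ (Fin (n + 2)), X)) :
    singularBoundary n X (Finsupp.single σ 1) =
      ∑ i, Finsupp.single (σ.comp (faceMap i)) 1 := by
  simp [singularBoundary]

lemma singularBoundary_map (n : ℕ) (f : C(X, Y)) (c : SingularChain (n + 1) X) :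
    singularBoundary n Y (singularChainMap (n + 1) f c) =
      singularChainMap n f (singularBoundary n X c) := by
  suffices h : singularBoundary n Y ∘ₗ singularChainMap (n + 1) f =
      singularChainMap n f ∘ₗ singularBoundary n X from congr($h c)
  ext1 σ
  ext1
  simp only [LinearMap.comp_apply, Finsupp.lsingle_apply, singularChainMap_single,
    singularBoundary_single, map_sum]
  rfl

/-- Singular cycles of degree `n + 1` with image in `S`. -/
def singularCyclesIn (n : ℕ) (S : Set X) : Submodule (ZMod 2) (SingularChain (n + 1) X) :=
  singularChainsIn (n + 1) S ⊓ LinearMap.ker (singularBoundary n X)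

/-- The inclusion of a subspace as a continuous map. -/
abbrev subspaceInclusion (S : Set X) : C(S, X) := ⟨Subtype.val, continuous_subtype_val⟩

lemma singularChainMap_subspaceInclusion_injective (n : ℕ) (S : Set X) :
    Function.Injective (singularChainMap n (subspaceInclusion S)) := by
  refine Finsupp.mapDomain_injective fun σ τ h => ?_
  ext x
  exact congr($h x)

lemma range_singularChainMap_subspaceInclusion (n : ℕ) (S : Set X) :
    LinearMap.range (singularChainMap n (subspaceInclusion S)) = singularChainsIn n S := by
  rw [singularChainMap, Finsupp.range_lmapDomain, singularChainsIn,
    Finsupp.supported_eq_span_single]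
  congr 1
  ext c
  constructor
  · rintro ⟨σ, rfl⟩
    exact ⟨_, fun x => (σ x).2, rfl⟩
  · rintro ⟨σ, hσ, rfl⟩
    exact ⟨⟨fun x => ⟨σ x, hσ x⟩, by fun_prop⟩, rfl⟩

/-- Singular chains of `X` lying in `S` are the singular chains of the space `S`. -/
def subspaceChainEquiv (n : ℕ) (S : Set X) : SingularChain n S ≃ₗ[ZMod 2] singularChainsIn n S :=
  (LinearEquiv.ofInjective _ (singularChainMap_subspaceInclusion_injective n S)).trans
    (LinearEquiv.ofEq _ _ (range_singularChainMap_subspaceInclusion n S))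

lemma singularChainMap_subspaceChainEquiv_symm (n : ℕ) (S : Set X) (c : singularChainsIn n S) :
    singularChainMap n (subspaceInclusion S) ((subspaceChainEquiv n S).symm c) = c := by
  conv_rhs => rw [← (subspaceChainEquiv n S).apply_symm_apply c]
  rfl

/-- The map sending a singular cycle in `S` to its class in the homology of `S`. -/
def singularClass (n : ℕ) (S : Set X) :
    singularCyclesIn n S →ₗ[ZMod 2] singularHomology (n + 1) S :=
  homologyClass (singularComplex S) n ∘ₗ LinearMap.codRestrict
    (LinearMap.ker ((singularComplex S).d (n + 1) n).hom)
    (chainComparison (n + 1) S ∘ₗ (subspaceChainEquiv (n + 1) S).symm.toLinearMap ∘ₗ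
      Submodule.inclusion inf_le_left) (by
        rintro ⟨z, hz, hz'⟩
        rw [LinearMap.mem_ker]
        refine (chainComparison_boundary n _).trans ?_
        rw [show (0 : (singularComplex S).X n) = chainComparison n S 0 from (map_zero _).symm]
        refine congrArg _ (singularChainMap_subspaceInclusion_injective n S ?_)
        rw [map_zero, ← singularBoundary_map]
        refine (congrArg _ (singularChainMap_subspaceChainEquiv_symm _ _ _)).trans hz')

lemma singularClass_surjective (n : ℕ) (S : Set X) : Function.Surjective (singularClass n S) := by
  intro y
  obtain ⟨⟨c, hc⟩, rfl⟩ := homologyClass_surjective (singularComplex S) n y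
  obtain ⟨b, rfl⟩ := (chainComparison_bijective (X := S) (n + 1)).2 c
  have hb : singularBoundary n S b = 0 := by
    apply (chainComparison_bijective (X := S) n).1
    rw [map_zero, ← chainComparison_boundary]
    exact hc
  refine ⟨⟨subspaceChainEquiv (n + 1) S b, (subspaceChainEquiv (n + 1) S b).2, ?_⟩, ?_⟩
  · change singularBoundary n X (singularChainMap (n + 1) (subspaceInclusion S) b) = 0
    rw [singularBoundary_map, hb, map_zero]
  · refine congrArg (homologyClass (singularComplex S) n) (Subtype.ext ?_)
    exact congrArg (chainComparison (n + 1) S) ((subspaceChainEquiv (n + 1) S).symm_apply_apply b)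

lemma singularClass_eq_zero_iff (n : ℕ) (S : Set X) (z : singularCyclesIn n S) :
    singularClass n S z = 0 ↔
      ∃ c ∈ singularChainsIn (n + 2) S, singularBoundary (n + 1) X c = z := by
  refine (homologyClass_eq_zero_iff (singularComplex S) n _).trans ?_
  constructor
  · rintro ⟨c, hc⟩
    obtain ⟨b, rfl⟩ := (chainComparison_bijective (X := S) (n + 2)).2 c
    refine ⟨subspaceChainEquiv (n + 2) S b, (subspaceChainEquiv (n + 2) S b).2, ?_⟩
    have h := (chainComparison_bijective (X := S) (n + 1)).1
      ((chainComparison_boundary (X := S) (n + 1) b).symm.trans hc)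
    change singularBoundary (n + 1) X (singularChainMap (n + 2) (subspaceInclusion S) b) = z
    rw [singularBoundary_map, h]
    exact singularChainMap_subspaceChainEquiv_symm (n + 1) S ⟨z, (Submodule.mem_inf.1 z.2).1⟩
  · rintro ⟨c, hc, hcz⟩
    refine ⟨chainComparison (n + 2) S ((subspaceChainEquiv (n + 2) S).symm ⟨c, hc⟩),
      (chainComparison_boundary (X := S) (n + 1) _).trans ?_⟩
    refine congrArg (chainComparison (n + 1) S)
      (singularChainMap_subspaceInclusion_injective (n + 1) S ?_)
    rw [← singularBoundary_map, singularChainMap_subspaceChainEquiv_symm]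
    exact hcz.trans
      (singularChainMap_subspaceChainEquiv_symm (n + 1) S ⟨z, (Submodule.mem_inf.1 z.2).1⟩).symm

lemma singularHomologyMap_singularClass (n : ℕ) {S T : Set X} (h : S ⊆ T)
    (z : singularCyclesIn n S) (w : singularCyclesIn n T)
    (hzw : (z : SingularChain (n + 1) X) = w) :
    (singularHomologyMap (n + 1) h).hom (singularClass n S z) = singularClass n T w := by
  refine homologyMap_homologyClass
    (SSet.chainComplexMap (TopCat.toSSet.map (TopCat.ofHom
      ⟨Set.inclusion h, continuous_inclusion h⟩)) (ModuleCat.of (ZMod 2) (ZMod 2))) n _ _ ?_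
  refine (chainComparison_map (n + 1) ⟨Set.inclusion h, continuous_inclusion h⟩ _).trans ?_
  refine congrArg (chainComparison (n + 1) T)
      (singularChainMap_subspaceInclusion_injective (n + 1) T ?_)
  have hw := singularChainMap_subspaceChainEquiv_symm (n + 1) T ⟨w, (Submodule.mem_inf.1 w.2).1⟩
  have hz := singularChainMap_subspaceChainEquiv_symm (n + 1) S ⟨z, (Submodule.mem_inf.1 z.2).1⟩
  refine Eq.trans ?_ (hz.trans (hzw.trans hw.symm))
  exact singularChainMap_singularChainMap (n + 1) ⟨Set.inclusion h, continuous_inclusion h⟩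
    (subspaceInclusion T) _

end SingularChains

/-! ### Chains of lists -/

section ListChains

variable {U V W : Type*}

/-- Formal sums, with coefficients in `ℤ/2`, of finite lists of points of `V`. The list
`[v₀, …, vₙ]` stands for the ordered, possibly degenerate, simplex with these vertices, and the
empty list for the generator in degree `-1` of the augmented complex. -/
abbrev ListChain (V : Type*) := List V →₀ ZMod 2

lemma ListChain.add_self {ι : Type*} (c : ι →₀ ZMod 2) : c + c = 0 := by
  ext l
  exact CharTwo.add_self_eq_zero _

lemma ListChain.eq_of_add_eq_zero {ι : Type*} {c d : ι →₀ ZMod 2} (h : c + d = 0) : c = d := by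
  rw [← add_zero c, ← ListChain.add_self d, ← add_assoc, h, zero_add]

/-- Joining with the point `v`. -/
def cone (v : V) : ListChain V →ₗ[ZMod 2] ListChain V :=
  Finsupp.lmapDomain (ZMod 2) (ZMod 2) (v :: ·)

@[simp]
lemma cone_single (v : V) (l : List V) (r : ZMod 2) :
    cone v (Finsupp.single l r) = Finsupp.single (v :: l) r := by
  simp [cone]

/-- The sum of the facets of an ordered simplex. -/
def listFaces : List V → ListChain V
  | [] => 0
  | v :: l => Finsupp.single l 1 + cone v (listFaces l)

/-- The augmented boundary operator modulo `2` on chains of lists. -/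
def listBoundary (V : Type*) : ListChain V →ₗ[ZMod 2] ListChain V :=
  Finsupp.linearCombination (ZMod 2) listFaces

@[simp]
lemma listBoundary_single (l : List V) :
    listBoundary V (Finsupp.single l 1) = listFaces l := by
  simp [listBoundary]

/-- Cones show that the augmented complex of lists is acyclic. -/
lemma listBoundary_cone (v : V) (c : ListChain V) :
    listBoundary V (cone v c) = c + cone v (listBoundary V c) := by
  suffices h : listBoundary V ∘ₗ cone v = LinearMap.id + cone v ∘ₗ listBoundary V from
    congr($h c)
  ext1 l
  ext1
  simp [listFaces]

lemma listBoundary_listBoundary (c : ListChain V) : listBoundary V (listBoundary V c) = 0 := by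
  suffices h : listBoundary V ∘ₗ listBoundary V = 0 from congr($h c)
  ext1 l
  ext1
  simp only [LinearMap.comp_apply, Finsupp.lsingle_apply, listBoundary_single,
    LinearMap.zero_apply]
  induction l with
  | nil => simp [listFaces]
  | cons v l ih =>
    rw [listFaces, map_add, listBoundary_single, listBoundary_cone, ih, map_zero, add_zero,
      ListChain.add_self]

/-- The chain map induced by a map of points. -/
def listMap (g : U → V) : ListChain U →ₗ[ZMod 2] ListChain V :=
  Finsupp.lmapDomain (ZMod 2) (ZMod 2) (List.map g)

@[simp]
lemma listMap_single (g : U → V) (l : List U) (r : ZMod 2) :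
    listMap g (Finsupp.single l r) = Finsupp.single (l.map g) r := by
  simp [listMap]

lemma listMap_cone (g : U → V) (u : U) (c : ListChain U) :
    listMap g (cone u c) = cone (g u) (listMap g c) := by
  suffices h : listMap g ∘ₗ cone u = cone (g u) ∘ₗ listMap g from congr($h c)
  ext1 l
  ext1
  simp

lemma listBoundary_listMap (g : U → V) (c : ListChain U) :
    listBoundary V (listMap g c) = listMap g (listBoundary U c) := by
  suffices h : listBoundary V ∘ₗ listMap g = listMap g ∘ₗ listBoundary U from congr($h c)
  ext1 l
  ext1
  simp only [LinearMap.comp_apply, Finsupp.lsingle_apply, listBoundary_single, listMap_single]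
  induction l with
  | nil => simp [listFaces]
  | cons v l ih => simp [listFaces, listMap_cone, ih]

/-- Chains of lists whose entries lie in `D`. -/
def listChainsIn (D : Set V) : Submodule (ZMod 2) (ListChain V) :=
  Finsupp.supported (ZMod 2) (ZMod 2) {l | ∀ v ∈ l, v ∈ D}

/-- Chains of lists of length `n`. -/
def listChainsOfLength (V : Type*) (n : ℕ) : Submodule (ZMod 2) (ListChain V) :=
  Finsupp.supported (ZMod 2) (ZMod 2) {l | l.length = n}

lemma single_mem_listChainsIn {D : Set V} {l : List V} (h : ∀ v ∈ l, v ∈ D) :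
    Finsupp.single l 1 ∈ listChainsIn D :=
  Finsupp.single_mem_supported _ _ h

lemma single_mem_listChainsOfLength {l : List V} {n : ℕ} (h : l.length = n) :
    Finsupp.single l 1 ∈ listChainsOfLength V n :=
  Finsupp.single_mem_supported _ _ h

/-- A linear map defined on formal sums sends those supported in `s` into a submodule as soon as
it does so for the generators in `s`. -/
lemma map_mem_of_supported {ι M : Type*} [AddCommGroup M] [Module (ZMod 2) M]
    (φ : (ι →₀ ZMod 2) →ₗ[ZMod 2] M) {s : Set ι} {P : Submodule (ZMod 2) M}
    (h : ∀ i ∈ s, φ (Finsupp.single i 1) ∈ P) {c : ι →₀ ZMod 2}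
    (hc : c ∈ Finsupp.supported (ZMod 2) (ZMod 2) s) : φ c ∈ P := by
  rw [Finsupp.supported_eq_span_single] at hc
  have : Submodule.span (ZMod 2) ((fun i => Finsupp.single i (1 : ZMod 2)) '' s) ≤ P.comap φ := by
    rw [Submodule.span_le]
    rintro _ ⟨i, hi, rfl⟩
    exact h i hi
  exact this hc

/-- Two linear maps that agree on the generators in `s` agree on the chains supported in `s`. -/
lemma map_eq_of_supported {ι M : Type*} [AddCommGroup M] [Module (ZMod 2) M]
    (φ ψ : (ι →₀ ZMod 2) →ₗ[ZMod 2] M) {s : Set ι}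
    (h : ∀ i ∈ s, φ (Finsupp.single i 1) = ψ (Finsupp.single i 1)) {c : ι →₀ ZMod 2}
    (hc : c ∈ Finsupp.supported (ZMod 2) (ZMod 2) s) : φ c = ψ c := by
  have := map_mem_of_supported (φ - ψ) (s := s) (P := ⊥) (fun i hi => by simp [h i hi]) hc
  simpa [sub_eq_zero] using this

lemma cone_mem_listChainsIn {D : Set V} {v : V} (hv : v ∈ D) {c : ListChain V}
    (hc : c ∈ listChainsIn D) : cone v c ∈ listChainsIn D :=
  map_mem_of_supported _ (fun l hl => by
    rw [cone_single]
    exact single_mem_listChainsIn (List.forall_mem_cons.2 ⟨hv, hl⟩)) hc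

lemma cone_mem_listChainsOfLength (v : V) {n : ℕ} {c : ListChain V}
    (hc : c ∈ listChainsOfLength V n) : cone v c ∈ listChainsOfLength V (n + 1) :=
  map_mem_of_supported _ (fun l hl => by
    rw [cone_single]
    exact single_mem_listChainsOfLength (congrArg (· + 1) hl)) hc

lemma listMap_mem_listChainsIn {g : U → V} {D : Set U} {D' : Set V} (hg : Set.MapsTo g D D')
    {c : ListChain U} (hc : c ∈ listChainsIn D) : listMap g c ∈ listChainsIn D' :=
  map_mem_of_supported _ (fun l hl => by
    rw [listMap_single]
    refine single_mem_listChainsIn ?_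
    simp only [List.mem_map, forall_exists_index, and_imp, forall_apply_eq_imp_iff₂]
    exact fun v hv => hg (hl v hv)) hc

lemma listMap_mem_listChainsOfLength (g : U → V) {n : ℕ}
    {c : ListChain U} (hc : c ∈ listChainsOfLength U n) : listMap g c ∈ listChainsOfLength V n :=
  map_mem_of_supported _ (fun l hl => by
    rw [listMap_single]
    exact single_mem_listChainsOfLength ((List.length_map _).trans hl)) hc

lemma listMap_listMap (g : U → V) (g' : V → W) (c : ListChain U) :
    listMap g' (listMap g c) = listMap (g' ∘ g) c := by
  rw [listMap, listMap, listMap, ← LinearMap.comp_apply, ← Finsupp.lmapDomain_comp]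
  simp

lemma listFaces_mem_listChainsIn {D : Set V} {l : List V} (hl : ∀ v ∈ l, v ∈ D) :
    listFaces l ∈ listChainsIn D := by
  induction l with
  | nil => exact Submodule.zero_mem _
  | cons v l ih =>
    rw [List.forall_mem_cons] at hl
    exact Submodule.add_mem _ (single_mem_listChainsIn hl.2) (cone_mem_listChainsIn hl.1 (ih hl.2))

lemma listFaces_mem_listChainsOfLength (v : V) (l : List V) :
    listFaces (v :: l) ∈ listChainsOfLength V l.length := by
  induction l generalizing v with
  | nil => simpa [listFaces] using single_mem_listChainsOfLength (V := V) (l := []) rfl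
  | cons w l ih =>
    exact Submodule.add_mem _ (single_mem_listChainsOfLength rfl)
      (cone_mem_listChainsOfLength _ (ih w))

lemma listFaces_ofFn {n : ℕ} (u : Fin (n + 1) → V) :
    listFaces (List.ofFn u) =
      ∑ i : Fin (n + 1), Finsupp.single (List.ofFn (u ∘ i.succAbove)) 1 := by
  induction n with
  | zero => simp [listFaces]
  | succ n ih =>
    rw [List.ofFn_succ, listFaces, ih, map_sum, Fin.sum_univ_succ (n := n + 1)]
    congr 1
    refine Finset.sum_congr rfl fun i _ => ?_
    rw [cone_single, List.ofFn_succ]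
    simp [Function.comp_def]

end ListChains

/-! ### Operators defined recursively by cones -/

section ConeRecursion

variable {ι ι' V V' : Type*} (d : (ι →₀ ZMod 2) →ₗ[ZMod 2] (ι →₀ ZMod 2)) (rank : ι → ℕ)

/-- The operator `d` strictly decreases the rank of generators. -/
def LowersRank : Prop :=
  ∀ i, d (Finsupp.single i 1) ∈ Finsupp.supported (ZMod 2) (ZMod 2) {j | rank j < rank i}

variable {d rank} (hd : LowersRank d rank) (a : ι → V)
  (θ : (ι →₀ ZMod 2) →ₗ[ZMod 2] ListChain V) (c₀ : ListChain V)

/-- The values on generators of `coneRec`. The sum is `coneRec` applied to `d i`, written out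
because the recursion is on the rank of the generators in the support of `d i`. -/
def coneRecAux (hd : LowersRank d rank) (a : ι → V)
    (θ : (ι →₀ ZMod 2) →ₗ[ZMod 2] ListChain V) (c₀ : ListChain V) (i : ι) : ListChain V :=
  if rank i = 0 then c₀ else
    cone (a i) (θ (Finsupp.single i 1) + ∑ j ∈ (d (Finsupp.single i 1)).support.attach,
      d (Finsupp.single i 1) j • coneRecAux hd a θ c₀ j)
termination_by rank i
decreasing_by exact hd i j.2

/-- The operator `h` with value `c₀` on generators of rank `0` and
`h i = cone (a i) (θ i + h (d i))` on generators of positive rank. Chain maps and chain homotopies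
into the acyclic complex of lists arise in this way. -/
def coneRec : (ι →₀ ZMod 2) →ₗ[ZMod 2] ListChain V :=
  Finsupp.linearCombination (ZMod 2) (coneRecAux hd a θ c₀)

lemma coneRec_of_rank_eq_zero {i : ι} (hi : rank i = 0) :
    coneRec hd a θ c₀ (Finsupp.single i 1) = c₀ := by
  simp [coneRec, coneRecAux, hi]

lemma coneRec_of_rank_ne_zero {i : ι} (hi : rank i ≠ 0) :
    coneRec hd a θ c₀ (Finsupp.single i 1) =
      cone (a i) (θ (Finsupp.single i 1) + coneRec hd a θ c₀ (d (Finsupp.single i 1))) := by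
  rw [coneRec, Finsupp.linearCombination_single, one_smul, coneRecAux, if_neg hi,
    Finsupp.linearCombination_apply, Finsupp.sum]
  rw [Finset.sum_attach _ (fun j => d (Finsupp.single i 1) j • coneRecAux hd a θ c₀ j)]

variable {a θ c₀}

/-- If `θ` commutes with the boundary operators, then `coneRec` is a chain homotopy from `θ` to
`0`. For `θ = 0` this says that `coneRec` is itself a chain map. -/
lemma listBoundary_coneRec (hdd : ∀ x, d (d x) = 0)
    (hθ : ∀ x, listBoundary V (θ x) = θ (d x))
    (h₀ : ∀ i, rank i = 0 → θ (Finsupp.single i 1) = listBoundary V c₀) (x : ι →₀ ZMod 2) :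
    listBoundary V (coneRec hd a θ c₀ x) + coneRec hd a θ c₀ (d x) = θ x := by
  suffices h : ∀ n, ∀ i, rank i < n → listBoundary V (coneRec hd a θ c₀ (Finsupp.single i 1)) +
      coneRec hd a θ c₀ (d (Finsupp.single i 1)) = θ (Finsupp.single i 1) by
    have : listBoundary V ∘ₗ coneRec hd a θ c₀ + coneRec hd a θ c₀ ∘ₗ d = θ := by
      ext1 i
      ext1
      exact h _ i (Nat.lt_succ_self _)
    exact congr($this x)
  intro n
  induction n with
  | zero => intro i hi; omega
  | succ n ih =>
    intro i hi
    by_cases hi0 : rank i = 0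
    · have : d (Finsupp.single i 1) = 0 := by
        have := hd i
        simpa [hi0] using this
      rw [coneRec_of_rank_eq_zero _ _ _ _ hi0, this, map_zero, add_zero, h₀ i hi0]
    · rw [coneRec_of_rank_ne_zero _ _ _ _ hi0, listBoundary_cone, map_add]
      have key := map_eq_of_supported
        (listBoundary V ∘ₗ coneRec hd a θ c₀ + coneRec hd a θ c₀ ∘ₗ d) θ
        (s := {j | rank j < rank i}) (fun j hj => ih j (lt_of_lt_of_le hj (by omega))) (hd i)
      simp only [LinearMap.add_apply, LinearMap.comp_apply, hdd, map_zero, add_zero] at key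
      rw [key, hθ, ListChain.add_self, map_zero, add_zero, add_assoc, ListChain.add_self, add_zero]

lemma coneRec_mem_listChainsIn {s : Set ι} {D : Set V}
    (hs : ∀ i ∈ s, d (Finsupp.single i 1) ∈ Finsupp.supported (ZMod 2) (ZMod 2) s)
    (ha : ∀ i ∈ s, rank i ≠ 0 → a i ∈ D)
    (hθ : ∀ i ∈ s, rank i ≠ 0 → θ (Finsupp.single i 1) ∈ listChainsIn D)
    (hc : c₀ ∈ listChainsIn D) {x : ι →₀ ZMod 2}
    (hx : x ∈ Finsupp.supported (ZMod 2) (ZMod 2) s) :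
    coneRec hd a θ c₀ x ∈ listChainsIn D := by
  refine map_mem_of_supported _ (s := s) ?_ hx
  suffices h : ∀ n, ∀ i ∈ s, rank i < n → coneRec hd a θ c₀ (Finsupp.single i 1) ∈ listChainsIn D
    from fun i hi => h _ i hi (Nat.lt_succ_self _)
  intro n
  induction n with
  | zero => intro i _ hi; omega
  | succ n ih =>
    intro i his hi
    by_cases hi0 : rank i = 0
    · rwa [coneRec_of_rank_eq_zero _ _ _ _ hi0]
    · rw [coneRec_of_rank_ne_zero _ _ _ _ hi0]
      refine cone_mem_listChainsIn (ha i his hi0) (Submodule.add_mem _ (hθ i his hi0) ?_)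
      refine map_mem_of_supported _ (s := s ∩ {j | rank j < rank i})
        (fun j hj => ih j hj.1 (lt_of_lt_of_le hj.2 (by omega))) ?_
      rw [Finsupp.supported_inter]
      exact ⟨hs i his, hd i⟩

lemma coneRec_mem_listChainsOfLength {k : ℕ}
    (hd' : ∀ i, d (Finsupp.single i 1) ∈
      Finsupp.supported (ZMod 2) (ZMod 2) {j | rank j + 1 = rank i})
    (hθ : ∀ i m, rank i ≠ 0 → m + 1 = rank i + k →
      θ (Finsupp.single i 1) ∈ listChainsOfLength V m)
    (hc : c₀ ∈ listChainsOfLength V k) {n : ℕ} {x : ι →₀ ZMod 2}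
    (hx : x ∈ Finsupp.supported (ZMod 2) (ZMod 2) {i | rank i = n}) :
    coneRec hd a θ c₀ x ∈ listChainsOfLength V (n + k) := by
  induction n generalizing x with
  | zero =>
    refine map_mem_of_supported _ (fun i hi => ?_) hx
    rw [coneRec_of_rank_eq_zero _ _ _ _ hi, zero_add]
    exact hc
  | succ n ih =>
    refine map_mem_of_supported _ (fun i hi => ?_) hx
    have hi' : rank i = n + 1 := hi
    have hi0 : rank i ≠ 0 := by omega
    rw [coneRec_of_rank_ne_zero _ _ _ _ hi0, Nat.add_right_comm]
    refine cone_mem_listChainsOfLength _ (Submodule.add_mem _ (hθ i _ hi0 (by omega)) (ih ?_))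
    refine Finsupp.supported_mono (fun j hj => ?_) (hd' i)
    have hj' : rank j + 1 = rank i := hj
    show rank j = n
    omega

/-- Naturality of the cone recursion. -/
lemma coneRec_natural {d' : (ι' →₀ ZMod 2) →ₗ[ZMod 2] (ι' →₀ ZMod 2)} {rank' : ι' → ℕ}
    (hd' : LowersRank d' rank') {a' : ι' → V'}
    {θ' : (ι' →₀ ZMod 2) →ₗ[ZMod 2] ListChain V'} {c₀' : ListChain V'}
    {r : ι → ι'} {g : V → V'} (hr : ∀ i, rank' (r i) = rank i)
    (hdr : ∀ x, d' (Finsupp.lmapDomain (ZMod 2) (ZMod 2) r x) =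
      Finsupp.lmapDomain (ZMod 2) (ZMod 2) r (d x))
    (ha : ∀ i, rank i ≠ 0 → a' (r i) = g (a i))
    (hθ : ∀ x, θ' (Finsupp.lmapDomain (ZMod 2) (ZMod 2) r x) = listMap g (θ x))
    (hc : c₀' = listMap g c₀) (x : ι →₀ ZMod 2) :
    coneRec hd' a' θ' c₀' (Finsupp.lmapDomain (ZMod 2) (ZMod 2) r x) =
      listMap g (coneRec hd a θ c₀ x) := by
  suffices h : ∀ n, ∀ i, rank i < n → coneRec hd' a' θ' c₀' (Finsupp.single (r i) 1) =
      listMap g (coneRec hd a θ c₀ (Finsupp.single i 1)) by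
    have : coneRec hd' a' θ' c₀' ∘ₗ Finsupp.lmapDomain (ZMod 2) (ZMod 2) r =
        listMap g ∘ₗ coneRec hd a θ c₀ := by
      ext1 i
      ext1
      simpa using h _ i (Nat.lt_succ_self _)
    exact congr($this x)
  intro n
  induction n with
  | zero => intro i hi; omega
  | succ n ih =>
    intro i hi
    by_cases hi0 : rank i = 0
    · rw [coneRec_of_rank_eq_zero _ _ _ _ hi0,
        coneRec_of_rank_eq_zero _ _ _ _ ((hr i).trans hi0), hc]
    · rw [coneRec_of_rank_ne_zero _ _ _ _ hi0,
        coneRec_of_rank_ne_zero _ _ _ _ (by rwa [hr i]), listMap_cone, ha i hi0, map_add]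
      have e : Finsupp.single (r i) (1 : ZMod 2) =
        Finsupp.lmapDomain (ZMod 2) (ZMod 2) r (Finsupp.single i 1) := by simp
      have key := map_eq_of_supported
        (coneRec hd' a' θ' c₀' ∘ₗ Finsupp.lmapDomain (ZMod 2) (ZMod 2) r)
        (listMap g ∘ₗ coneRec hd a θ c₀) (s := {j | rank j < rank i})
        (fun j hj => by simpa using ih j (lt_of_lt_of_le hj (by omega))) (hd i)
      simp only [LinearMap.comp_apply] at key
      rw [e, hθ, hdr, key, ← map_add, ← map_add]

end ConeRecursion

section ListOperators

variable {U V W : Type*}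

lemma listBoundary_mem_supported_length (l : List V) :
    listBoundary V (Finsupp.single l 1) ∈
      Finsupp.supported (ZMod 2) (ZMod 2) {l' | l'.length + 1 = l.length} := by
  rw [listBoundary_single]
  cases l with
  | nil => exact Submodule.zero_mem _
  | cons v l =>
    refine Finsupp.supported_mono (fun l' hl' => ?_) (listFaces_mem_listChainsOfLength v l)
    exact congrArg (· + 1) hl'

lemma lowersRank_listBoundary : LowersRank (listBoundary V) List.length := fun l =>
  Finsupp.supported_mono (fun _ h => Nat.lt_of_succ_le h.le) (listBoundary_mem_supported_length l)

lemma listBoundary_mem_listChainsOfLength {n : ℕ} {c : ListChain V}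
    (hc : c ∈ listChainsOfLength V (n + 1)) : listBoundary V c ∈ listChainsOfLength V n :=
  map_mem_of_supported _ (fun l hl => Finsupp.supported_mono
    (fun _ h => Nat.succ_injective (h.trans hl)) (listBoundary_mem_supported_length l)) hc

lemma listBoundary_mem_listChainsIn {D : Set V} {c : ListChain V}
    (hc : c ∈ listChainsIn D) : listBoundary V c ∈ listChainsIn D :=
  map_mem_of_supported _ (fun l hl => by
    rw [listBoundary_single]; exact listFaces_mem_listChainsIn hl) hc

/-- The chain homotopy to zero of an operator `θ` on lists, with apices `a`. Applied to `θ = id + A`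
it is a chain homotopy from the identity to `A`, since signs do not matter. -/
abbrev listHomotopy (a : List U → V) (θ : ListChain U →ₗ[ZMod 2] ListChain V) :
    ListChain U →ₗ[ZMod 2] ListChain V :=
  coneRec lowersRank_listBoundary a θ 0

lemma listHomotopy_nil (a : List U → V) (θ : ListChain U →ₗ[ZMod 2] ListChain V) :
    listHomotopy a θ (Finsupp.single [] 1) = 0 :=
  coneRec_of_rank_eq_zero _ _ _ _ rfl

lemma listBoundary_listHomotopy (a : List U → V) {θ : ListChain U →ₗ[ZMod 2] ListChain V}
    (hθ : ∀ x, listBoundary V (θ x) = θ (listBoundary U x)) (h₀ : θ (Finsupp.single [] 1) = 0)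
    (x : ListChain U) :
    listBoundary V (listHomotopy a θ x) + listHomotopy a θ (listBoundary U x) = θ x :=
  listBoundary_coneRec _ listBoundary_listBoundary hθ (fun i hi => by
    rw [List.length_eq_zero_iff.1 hi, h₀, map_zero]) x

lemma listHomotopy_mem_listChainsIn {a : List U → V} {θ : ListChain U →ₗ[ZMod 2] ListChain V}
    {D : Set U} {D' : Set V} (ha : ∀ l : List U, l ≠ [] → (∀ v ∈ l, v ∈ D) → a l ∈ D')
    (hθ : ∀ l : List U, (∀ v ∈ l, v ∈ D) → θ (Finsupp.single l 1) ∈ listChainsIn D')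
    {c : ListChain U} (hc : c ∈ listChainsIn D) : listHomotopy a θ c ∈ listChainsIn D' :=
  coneRec_mem_listChainsIn _
    (fun l hl => by rw [listBoundary_single]; exact listFaces_mem_listChainsIn hl)
    (fun l hl hl0 => ha l (fun h => hl0 (by simp [h])) hl) (fun l hl _ => hθ l hl)
    (Submodule.zero_mem _) hc

lemma listHomotopy_mem_listChainsOfLength {a : List U → V}
    {θ : ListChain U →ₗ[ZMod 2] ListChain V}
    (hθ : ∀ l : List U, θ (Finsupp.single l 1) ∈ listChainsOfLength V l.length)
    {n : ℕ} {c : ListChain U} (hc : c ∈ listChainsOfLength U n) :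
    listHomotopy a θ c ∈ listChainsOfLength V (n + 1) :=
  coneRec_mem_listChainsOfLength _ listBoundary_mem_supported_length
    (fun l m _ hm => by rw [Nat.succ_injective hm]; exact hθ l) (Submodule.zero_mem _) hc

lemma listHomotopy_natural {U' V' : Type*} {a : List U → V} {a' : List U' → V'}
    {θ : ListChain U →ₗ[ZMod 2] ListChain V} {θ' : ListChain U' →ₗ[ZMod 2] ListChain V'}
    {f : U → U'} {g : V → V'} (ha : ∀ l, l ≠ [] → a' (l.map f) = g (a l))
    (hθ : ∀ x, θ' (listMap f x) = listMap g (θ x)) (x : ListChain U) :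
    listHomotopy a' θ' (listMap f x) = listMap g (listHomotopy a θ x) :=
  coneRec_natural _ _ (fun l => List.length_map _) (listBoundary_listMap f)
    (fun l hl => ha l (fun h => hl (by simp [h]))) hθ (map_zero _).symm x

end ListOperators

/-! ### Barycentric subdivision of ordered simplices -/

section Subdivision

variable {V W : Type*} [AddCommGroup V] [Module ℝ V] [AddCommGroup W] [Module ℝ W]

/-- The barycenter of a nonempty list of points. -/
def barycenter (l : List V) : V := (l.length : ℝ)⁻¹ • l.sum

lemma barycenter_map (g : V →ₗ[ℝ] W) (l : List V) : barycenter (l.map g) = g (barycenter l) := by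
  simp [barycenter, map_list_sum]

lemma barycenter_mem {D : Set V} (hD : Convex ℝ D) {l : List V} (hl : l ≠ [])
    (h : ∀ v ∈ l, v ∈ D) : barycenter l ∈ D := by
  have hlen : (l.length : ℝ) ≠ 0 := by simpa using hl
  have : barycenter l = ∑ i : Fin l.length, (l.length : ℝ)⁻¹ • l.get i := by
    rw [barycenter, ← Finset.smul_sum]
    congr 1
    conv_lhs => rw [← List.ofFn_get l, List.sum_ofFn]
  rw [this]
  refine hD.sum_mem (fun i _ => by positivity) ?_ (fun i _ => h _ (List.get_mem _ _))
  simp [hlen]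

/-- Barycentric subdivision: a simplex is sent to the cone, with its barycenter as apex, over the
subdivision of its boundary. -/
def subdivision (V : Type*) [AddCommGroup V] [Module ℝ V] : ListChain V →ₗ[ZMod 2] ListChain V :=
  coneRec lowersRank_listBoundary barycenter 0 (Finsupp.single [] 1)

lemma listBoundary_subdivision (c : ListChain V) :
    listBoundary V (subdivision V c) = subdivision V (listBoundary V c) :=
  ListChain.eq_of_add_eq_zero <| listBoundary_coneRec lowersRank_listBoundary
    listBoundary_listBoundary (by simp) (by simp [listFaces]) c

lemma subdivision_nil : subdivision V (Finsupp.single [] 1) = Finsupp.single [] 1 :=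
  coneRec_of_rank_eq_zero _ _ _ _ rfl

lemma subdivision_natural (g : V →ₗ[ℝ] W) (c : ListChain V) :
    subdivision W (listMap g c) = listMap g (subdivision V c) :=
  coneRec_natural _ _ (fun l => List.length_map _) (listBoundary_listMap g)
    (fun l _ => barycenter_map g l) (by simp) (by simp) c

lemma subdivision_mem_listChainsIn {D : Set V} (hD : Convex ℝ D) {c : ListChain V}
    (hc : c ∈ listChainsIn D) : subdivision V c ∈ listChainsIn D :=
  coneRec_mem_listChainsIn _
    (fun l hl => by rw [listBoundary_single]; exact listFaces_mem_listChainsIn hl)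
    (fun l hl hl0 => barycenter_mem hD (fun h => hl0 (by simp [h])) hl)
    (fun _ _ _ => Submodule.zero_mem _) (single_mem_listChainsIn (by simp)) hc

lemma subdivision_mem_listChainsOfLength {n : ℕ} {c : ListChain V}
    (hc : c ∈ listChainsOfLength V n) : subdivision V c ∈ listChainsOfLength V n :=
  coneRec_mem_listChainsOfLength (k := 0) _ listBoundary_mem_supported_length
    (fun _ _ _ _ => Submodule.zero_mem _) (single_mem_listChainsOfLength rfl) hc

/-- Iterated barycentric subdivision. -/
def iterSubdivision (V : Type*) [AddCommGroup V] [Module ℝ V] (N : ℕ) :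
    ListChain V →ₗ[ZMod 2] ListChain V :=
  subdivision V ^ N

lemma iterSubdivision_succ (N : ℕ) (c : ListChain V) :
    iterSubdivision V (N + 1) c = subdivision V (iterSubdivision V N c) := by
  rw [iterSubdivision, pow_succ']
  rfl

lemma listBoundary_iterSubdivision (N : ℕ) (c : ListChain V) :
    listBoundary V (iterSubdivision V N c) = iterSubdivision V N (listBoundary V c) := by
  induction N with
  | zero => rfl
  | succ N ih => rw [iterSubdivision_succ, listBoundary_subdivision, ih, iterSubdivision_succ]

lemma iterSubdivision_nil (N : ℕ) :
    iterSubdivision V N (Finsupp.single [] 1) = Finsupp.single [] 1 := by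
  induction N with
  | zero => rfl
  | succ N ih => rw [iterSubdivision_succ, ih, subdivision_nil]

lemma iterSubdivision_natural (g : V →ₗ[ℝ] W) (N : ℕ) (c : ListChain V) :
    iterSubdivision W N (listMap g c) = listMap g (iterSubdivision V N c) := by
  induction N with
  | zero => rfl
  | succ N ih => rw [iterSubdivision_succ, ih, subdivision_natural, iterSubdivision_succ]

lemma iterSubdivision_mem_listChainsIn {D : Set V} (hD : Convex ℝ D) (N : ℕ) {c : ListChain V}
    (hc : c ∈ listChainsIn D) : iterSubdivision V N c ∈ listChainsIn D := by
  induction N with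
  | zero => exact hc
  | succ N ih => rw [iterSubdivision_succ]; exact subdivision_mem_listChainsIn hD ih

lemma iterSubdivision_mem_listChainsOfLength (N : ℕ) {n : ℕ} {c : ListChain V}
    (hc : c ∈ listChainsOfLength V n) : iterSubdivision V N c ∈ listChainsOfLength V n := by
  induction N with
  | zero => exact hc
  | succ N ih => rw [iterSubdivision_succ]; exact subdivision_mem_listChainsOfLength ih

/-- The natural chain homotopy from the identity to iterated barycentric subdivision. -/
def subdivisionHomotopy (V : Type*) [AddCommGroup V] [Module ℝ V] (N : ℕ) :
    ListChain V →ₗ[ZMod 2] ListChain V :=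
  listHomotopy barycenter (LinearMap.id + iterSubdivision V N)

lemma listBoundary_subdivisionHomotopy (N : ℕ) (c : ListChain V) :
    listBoundary V (subdivisionHomotopy V N c) + subdivisionHomotopy V N (listBoundary V c) =
      c + iterSubdivision V N c :=
  listBoundary_listHomotopy _ (by simp [listBoundary_iterSubdivision])
    (by simp [iterSubdivision_nil, ListChain.add_self]) c

lemma subdivisionHomotopy_natural (g : V →ₗ[ℝ] W) (N : ℕ) (c : ListChain V) :
    subdivisionHomotopy W N (listMap g c) = listMap g (subdivisionHomotopy V N c) :=
  listHomotopy_natural (fun l _ => barycenter_map g l) (by simp [iterSubdivision_natural]) c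

lemma subdivisionHomotopy_mem_listChainsIn {D : Set V} (hD : Convex ℝ D) (N : ℕ) {c : ListChain V}
    (hc : c ∈ listChainsIn D) : subdivisionHomotopy V N c ∈ listChainsIn D :=
  listHomotopy_mem_listChainsIn (fun _ hl => barycenter_mem hD hl)
    (fun _ hl => Submodule.add_mem _ (single_mem_listChainsIn hl)
      (iterSubdivision_mem_listChainsIn hD N (single_mem_listChainsIn hl))) hc

end Subdivision

section Mesh

variable {V : Type*} [NormedAddCommGroup V] [NormedSpace ℝ V]

/-- Chains of lists whose entries have pairwise distance at most `r`. -/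
def listChainsOfMesh (V : Type*) [NormedAddCommGroup V] (r : ℝ) :
    Submodule (ZMod 2) (ListChain V) :=
  Finsupp.supported (ZMod 2) (ZMod 2) {l | ∀ v ∈ l, ∀ w ∈ l, dist v w ≤ r}

/-- The vertex `v` itself contributes nothing to the average distance from the vertices to `v`,
which gives the factor `n / (n + 1)`. -/
lemma dist_barycenter_le {l : List V} {n : ℕ} (hn : l.length = n + 1) {r : ℝ} {v : V} (hv : v ∈ l)
    (h : ∀ u ∈ l, dist u v ≤ r) : dist v (barycenter l) ≤ n / (n + 1) * r := by
  classical
  have hn' : (0 : ℝ) < n + 1 := by positivity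
  have e : barycenter l - v = (n + 1 : ℝ)⁻¹ • (l.map (· - v)).sum := by
    have : (l.map (· - v)).sum = l.sum - (n + 1 : ℝ) • v := by
      have h1 : ∀ l : List V, (l.map (· - v)).sum = l.sum - (l.length : ℝ) • v := by
        intro l
        induction l with
        | nil => simp
        | cons a l ih => simp [ih, add_smul]; abel
      rw [h1, hn]
      push_cast
      rfl
    rw [this, smul_sub, smul_smul, inv_mul_cancel₀ hn'.ne', one_smul, barycenter, hn]
    push_cast
    rfl
  have hsum : ‖(l.map (· - v)).sum‖ ≤ n * r := by
    rw [← List.sum_map_erase _ hv, sub_self, zero_add]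
    have h2 : ∀ l' : List V, (∀ u ∈ l', dist u v ≤ r) →
        ‖(l'.map (· - v)).sum‖ ≤ l'.length * r := by
      intro l'
      induction l' with
      | nil => simp
      | cons a l' ih =>
        intro h'
        rw [List.forall_mem_cons] at h'
        rw [List.map_cons, List.sum_cons, List.length_cons]
        push_cast
        have := norm_add_le (a - v) (l'.map (· - v)).sum
        have h3 := ih h'.2
        have h4 := h'.1
        rw [dist_eq_norm] at h4
        linarith
    have := h2 (l.erase v) (fun u hu => h u (List.mem_of_mem_erase hu))
    rwa [List.length_erase_of_mem hv, hn, Nat.add_sub_cancel] at this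
  rw [dist_comm, dist_eq_norm, e, norm_smul, norm_inv, Real.norm_of_nonneg hn'.le,
    div_mul_eq_mul_div, div_eq_inv_mul]
  exact mul_le_mul_of_nonneg_left hsum (by positivity)

/-- Barycentric subdivision shrinks `n`-simplices by the factor `n / (n + 1)`. -/
lemma subdivision_mem_listChainsOfMesh {n : ℕ} {r : ℝ} (hr : 0 ≤ r) {c : ListChain V}
    (hc : c ∈ listChainsOfLength V (n + 1)) (hc' : c ∈ listChainsOfMesh V r) :
    subdivision V c ∈ listChainsOfMesh V (n / (n + 1) * r) := by
  induction n generalizing c with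
  | zero =>
    refine Finsupp.supported_mono ?_ (subdivision_mem_listChainsOfLength hc)
    intro l hl v hv w hw
    obtain ⟨a, rfl⟩ := List.length_eq_one_iff.1 hl
    rw [List.mem_singleton] at hv hw
    simp [hv, hw]
  | succ n ih =>
    have hmem : c ∈ Finsupp.supported (ZMod 2) (ZMod 2)
        ({l | l.length = n + 1 + 1} ∩ {l : List V | ∀ v ∈ l, ∀ w ∈ l, dist v w ≤ r}) := by
      rw [Finsupp.supported_inter]
      exact ⟨hc, hc'⟩
    refine map_mem_of_supported _ ?_ hmem
    rintro l ⟨hlen : l.length = n + 1 + 1, hl⟩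
    rw [subdivision, coneRec_of_rank_ne_zero _ _ _ _ (by omega), LinearMap.zero_apply, zero_add]
    change cone _ (subdivision V _) ∈ _
    have hl1 : Finsupp.single l 1 ∈ listChainsOfMesh V r := Finsupp.single_mem_supported _ _ hl
    have hb1 : listBoundary V (Finsupp.single l 1) ∈ listChainsOfLength V (n + 1) :=
      listBoundary_mem_listChainsOfLength (single_mem_listChainsOfLength hlen)
    have hb2 : listBoundary V (Finsupp.single l 1) ∈ listChainsIn {v | v ∈ l} :=
      listBoundary_mem_listChainsIn (single_mem_listChainsIn fun _ h => h)
    have hb3 : listBoundary V (Finsupp.single l 1) ∈ listChainsOfMesh V r :=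
      Finsupp.supported_mono (fun (l' : List V) (hl' : ∀ v ∈ l', v ∈ l) v hv w hw =>
        hl v (hl' v hv) w (hl' w hw)) hb2
    have hs1 := ih hb1 hb3
    have hb4 : listBoundary V (Finsupp.single l 1) ∈ listChainsIn (convexHull ℝ {v | v ∈ l}) :=
      Finsupp.supported_mono (fun (l' : List V) (hl' : ∀ v ∈ l', v ∈ l) v hv =>
        subset_convexHull ℝ {v | v ∈ l} (hl' v hv)) hb2
    have hs2 := subdivision_mem_listChainsIn (convex_convexHull ℝ {v | v ∈ l}) hb4
    have hs : subdivision V (listBoundary V (Finsupp.single l 1)) ∈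
        Finsupp.supported (ZMod 2) (ZMod 2)
        ({l | ∀ v ∈ l, ∀ w ∈ l, dist v w ≤ n / (n + 1) * r} ∩
          {l' : List V | ∀ v ∈ l', v ∈ convexHull ℝ {v | v ∈ l}}) := by
      rw [Finsupp.supported_inter]
      exact ⟨hs1, hs2⟩
    refine map_mem_of_supported _ ?_ hs
    rintro l' ⟨hl'1, hl'2⟩
    rw [cone_single]
    refine Finsupp.single_mem_supported _ _ ?_
    -- the distance to the barycenter is convex, so it is largest at a vertex
    have hball : ∀ v ∈ l', dist v (barycenter l) ≤ (n + 1 : ℕ) / ((n + 1 : ℕ) + 1) * r := by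
      intro v hv
      have hsub : convexHull ℝ {v | v ∈ l} ⊆
          Metric.closedBall (barycenter l) ((n + 1 : ℕ) / ((n + 1 : ℕ) + 1) * r) :=
        convexHull_min (fun w hw => dist_barycenter_le hlen hw (fun u hu => hl u hu w hw))
          (convex_closedBall _ _)
      exact hsub (hl'2 v hv)
    have hle : (n : ℝ) / (n + 1) * r ≤ (n + 1 : ℕ) / ((n + 1 : ℕ) + 1) * r := by
      refine mul_le_mul_of_nonneg_right ?_ hr
      rw [div_le_div_iff₀ (by positivity) (by positivity)]
      push_cast
      nlinarith
    intro v hv w hw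
    rw [List.mem_cons] at hv hw
    rcases hv with rfl | hv <;> rcases hw with rfl | hw
    · rw [dist_self]; positivity
    · rw [dist_comm]; exact hball w hw
    · exact hball v hv
    · exact (hl'1 v hv w hw).trans hle

lemma iterSubdivision_mem_listChainsOfMesh {n : ℕ} {r : ℝ} (hr : 0 ≤ r) {c : ListChain V}
    (hc : c ∈ listChainsOfLength V (n + 1)) (hc' : c ∈ listChainsOfMesh V r) (N : ℕ) :
    iterSubdivision V N c ∈ listChainsOfMesh V ((n / (n + 1)) ^ N * r) := by
  induction N with
  | zero => simpa [iterSubdivision] using hc'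
  | succ N ih =>
    rw [iterSubdivision_succ, pow_succ', mul_assoc]
    exact subdivision_mem_listChainsOfMesh (by positivity)
      (iterSubdivision_mem_listChainsOfLength N hc) ih

lemma eventually_iterSubdivision_mem_listChainsOfMesh {n : ℕ} {r : ℝ} (hr : 0 ≤ r)
    {c : ListChain V} (hc : c ∈ listChainsOfLength V (n + 1)) (hc' : c ∈ listChainsOfMesh V r)
    {ε : ℝ} (hε : 0 < ε) : ∀ᶠ N in Filter.atTop, iterSubdivision V N c ∈ listChainsOfMesh V ε := by
  have hlt : (n : ℝ) / (n + 1) < 1 := by rw [div_lt_one (by positivity)]; linarith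
  have h := (tendsto_pow_atTop_nhds_zero_of_lt_one (by positivity) hlt).mul_const r
  rw [zero_mul] at h
  filter_upwards [h.eventually (gt_mem_nhds hε)] with N hN
  exact Finsupp.supported_mono (fun l hl v hv w hw => (hl v hv w hw).trans hN.le)
    (iterSubdivision_mem_listChainsOfMesh hr hc hc' N)

end Mesh

/-! ### Singular chains from chains of lists -/

section Push

variable {W W' X : Type} [AddCommGroup W] [Module ℝ W] [AddCommGroup W'] [Module ℝ W']
  [TopologicalSpace X]

/-- The affine map from the standard simplex with the given vertices. -/
def affineSimplex {n : ℕ} (u : Fin (n + 1) → W) (x : stdSimplex ℝ (Fin (n + 1))) : W :=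
  ∑ i, x i • u i

lemma affineSimplex_mem {D : Set W} (hD : Convex ℝ D) {n : ℕ} {u : Fin (n + 1) → W}
    (hu : ∀ i, u i ∈ D) (x : stdSimplex ℝ (Fin (n + 1))) : affineSimplex u x ∈ D :=
  hD.sum_mem (fun i _ => x.2.1 i) x.2.2 (fun i _ => hu i)

lemma affineSimplex_faceMap {n : ℕ} (u : Fin (n + 2) → W) (i : Fin (n + 2))
    (x : stdSimplex ℝ (Fin (n + 1))) :
    affineSimplex u (faceMap i x) = affineSimplex (u ∘ i.succAbove) x := by
  have h : Fintype.linearCombination ℝ u ∘ₗ FunOnFinite.linearMap ℝ ℝ i.succAbove =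
      Fintype.linearCombination ℝ (u ∘ i.succAbove) := by
    refine LinearMap.pi_ext' fun j => LinearMap.ext_ring ?_
    simp [Fintype.linearCombination_apply, FunOnFinite.linearMap_piSingle, Pi.single_apply]
  have := congr($h (x : Fin (n + 1) → ℝ))
  simp only [LinearMap.comp_apply, Fintype.linearCombination_apply] at this
  exact this

lemma affineSimplex_linearMap {n : ℕ} (L : W →ₗ[ℝ] W') (u : Fin (n + 1) → W)
    (x : stdSimplex ℝ (Fin (n + 1))) : affineSimplex (L ∘ u) x = L (affineSimplex u x) := by
  simp [affineSimplex, map_sum]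

lemma continuous_affineSimplex [TopologicalSpace W] [ContinuousAdd W] [ContinuousSMul ℝ W]
    {n : ℕ} (u : Fin (n + 1) → W) : Continuous (affineSimplex u) := by
  unfold affineSimplex
  refine continuous_finsetSum _ fun i _ => ?_
  exact ((continuous_apply i).comp continuous_subtype_val).smul continuous_const

open Classical in
/-- A function on the standard simplex as a singular chain, which is `0` if the function is not
continuous. -/
def chainOfFun {n : ℕ} (φ : stdSimplex ℝ (Fin (n + 1)) → X) : SingularChain n X :=
  if h : Continuous φ then Finsupp.single ⟨φ, h⟩ 1 else 0

lemma chainOfFun_of_continuous {n : ℕ} {φ : stdSimplex ℝ (Fin (n + 1)) → X} (h : Continuous φ) :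
    chainOfFun φ = Finsupp.single ⟨φ, h⟩ 1 := dif_pos h

/-- The singular simplex `g ∘ [l₀, …, lₙ]`. The value is `0` if `l` does not have length `n + 1` or
the composite is not continuous. -/
def pushSimplex (n : ℕ) (g : W → X) (l : List W) : SingularChain n X :=
  if l.length = n + 1 then
    chainOfFun fun x => g (affineSimplex (fun i : Fin (n + 1) => l.getD i 0) x) else 0

/-- The linear extension of `pushSimplex`. -/
def push (n : ℕ) (g : W → X) : ListChain W →ₗ[ZMod 2] SingularChain n X :=
  Finsupp.linearCombination (ZMod 2) (pushSimplex n g)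

lemma push_single (n : ℕ) (g : W → X) (l : List W) :
    push n g (Finsupp.single l 1) = pushSimplex n g l := by
  simp [push]

lemma push_of_length_ne {n : ℕ} {g : W → X} {l : List W} (hl : l.length ≠ n + 1) :
    push n g (Finsupp.single l 1) = 0 := by
  simp [push, pushSimplex, hl]

lemma push_ofFn {n : ℕ} (g : W → X) (u : Fin (n + 1) → W) :
    push n g (Finsupp.single (List.ofFn u) 1) = chainOfFun fun x => g (affineSimplex u x) := by
  have e : (fun i : Fin (n + 1) => (List.ofFn u).getD i 0) = u := by
    ext i
    rw [List.getD_eq_getElem _ _ (by simpa using i.is_le), List.getElem_ofFn]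
  rw [push_single, pushSimplex, if_pos (by simp), e]

lemma exists_ofFn_eq {α : Type*} {l : List α} {n : ℕ} (hl : l.length = n) :
    ∃ u : Fin n → α, l = List.ofFn u := by
  subst hl
  exact ⟨l.get, (List.ofFn_get l).symm⟩

lemma mem_of_ofFn_mem {α : Type*} {D : Set α} {n : ℕ} {u : Fin n → α}
    (h : List.ofFn u ∈ {l : List α | ∀ v ∈ l, v ∈ D}) (i : Fin n) : u i ∈ D :=
  h _ (List.mem_ofFn.2 ⟨i, rfl⟩)

/-- `push g` only depends on the values of `g` on a convex set that contains the vertices. -/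
lemma push_congr {n : ℕ} {g g' : W → X} {D : Set W} (hD : Convex ℝ D) (hg : Set.EqOn g g' D)
    {c : ListChain W} (hc : c ∈ listChainsIn D) : push n g c = push n g' c := by
  refine map_eq_of_supported _ _ (fun l hl => ?_) hc
  by_cases hn : l.length = n + 1
  · obtain ⟨u, rfl⟩ := exists_ofFn_eq hn
    rw [push_ofFn, push_ofFn]
    congr 1
    exact funext fun x => hg (affineSimplex_mem hD (mem_of_ofFn_mem hl) x)
  · rw [push_of_length_ne hn, push_of_length_ne hn]

lemma push_listMap (n : ℕ) (g : W' → X) (L : W →ₗ[ℝ] W') (c : ListChain W) :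
    push n g (listMap L c) = push n (g ∘ L) c := by
  suffices h : push n g ∘ₗ listMap L = push n (g ∘ L) from congr($h c)
  ext1 l
  ext1
  simp only [LinearMap.comp_apply, Finsupp.lsingle_apply, listMap_single]
  by_cases hn : l.length = n + 1
  · obtain ⟨u, rfl⟩ := exists_ofFn_eq hn
    rw [List.map_ofFn, push_ofFn, push_ofFn]
    simp only [affineSimplex_linearMap, Function.comp_apply]
  · rw [push_of_length_ne hn, push_of_length_ne (by simpa using hn)]

/-- A space of singular chains contains `push n g c` as soon as it contains the continuous ones
among the simplices `g ∘ [l₀, …, lₙ]`, for all lists in a family that contains the support of `c`.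
-/
lemma push_mem {n : ℕ} {g : W → X} {P : Set (List W)}
    {T : Submodule (ZMod 2) (SingularChain n X)}
    (h : ∀ (u : Fin (n + 1) → W) (hu : Continuous fun x => g (affineSimplex u x)),
      List.ofFn u ∈ P → Finsupp.single ⟨_, hu⟩ 1 ∈ T) {c : ListChain W}
    (hc : c ∈ Finsupp.supported (ZMod 2) (ZMod 2) P) : push n g c ∈ T := by
  refine map_mem_of_supported _ (fun l hl => ?_) hc
  by_cases hn : l.length = n + 1
  · obtain ⟨u, rfl⟩ := exists_ofFn_eq hn
    rw [push_ofFn]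
    by_cases hu : Continuous fun x => g (affineSimplex u x)
    · rw [chainOfFun_of_continuous hu]
      exact h u hu hl
    · rw [chainOfFun, dif_neg hu]
      exact Submodule.zero_mem _
  · rw [push_of_length_ne hn]
    exact Submodule.zero_mem _

lemma push_mem_singularChainsIn {n : ℕ} {g : W → X} {D : Set W} (hD : Convex ℝ D) {S : Set X}
    (hg : Set.MapsTo g D S) {c : ListChain W} (hc : c ∈ listChainsIn D) :
    push n g c ∈ singularChainsIn n S :=
  push_mem (P := {l | ∀ v ∈ l, v ∈ D}) (fun _ _ hl => by
    refine Finsupp.single_mem_supported _ _ fun x => ?_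
    exact hg (affineSimplex_mem hD (mem_of_ofFn_mem hl) x)) hc

variable [TopologicalSpace W] [ContinuousAdd W] [ContinuousSMul ℝ W]

lemma continuous_comp_affineSimplex {n : ℕ} {g : W → X} {D : Set W} (hD : Convex ℝ D)
    (hg : ContinuousOn g D) {u : Fin (n + 1) → W} (hu : ∀ i, u i ∈ D) :
    Continuous fun x => g (affineSimplex u x) :=
  hg.comp_continuous (continuous_affineSimplex u) (affineSimplex_mem hD hu)

lemma singularBoundary_push {n : ℕ} {g : W → X} {D : Set W} (hD : Convex ℝ D)
    (hg : ContinuousOn g D) {c : ListChain W} (hc : c ∈ listChainsIn D) :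
    singularBoundary n X (push (n + 1) g c) = push n g (listBoundary W c) := by
  refine map_eq_of_supported (singularBoundary n X ∘ₗ push (n + 1) g)
    (push n g ∘ₗ listBoundary W) (fun l hl => ?_) hc
  simp only [LinearMap.comp_apply]
  by_cases hn : l.length = n + 2
  · obtain ⟨u, rfl⟩ := exists_ofFn_eq hn
    have hu : ∀ i, u i ∈ D := mem_of_ofFn_mem hl
    rw [push_ofFn, chainOfFun_of_continuous (continuous_comp_affineSimplex hD hg hu),
      singularBoundary_single,
      listBoundary_single, listFaces_ofFn, map_sum]
    refine Finset.sum_congr rfl fun i _ => ?_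
    rw [push_ofFn, chainOfFun_of_continuous
      (continuous_comp_affineSimplex hD hg (u := u ∘ i.succAbove) fun j => hu _)]
    congr 1
    ext x
    exact congrArg g (affineSimplex_faceMap u i x)
  · rw [push_of_length_ne hn, map_zero]
    refine (map_eq_of_supported (push n g) 0 (fun l' hl' => ?_)
      (listBoundary_mem_supported_length l)).symm
    rw [LinearMap.zero_apply, push_of_length_ne]
    intro h
    apply hn
    rw [← show l'.length + 1 = l.length from hl', h]

end Push

/-! ### Natural operators on singular chains -/

section Operators

variable {W W' X : Type} [AddCommGroup W] [Module ℝ W] [AddCommGroup W'] [Module ℝ W']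
  [TopologicalSpace X]

/-- The operator on singular chains that replaces each simplex `σ` by the image of one and the same
chain `w` under the map `G σ`. Subdivision, prism operators and induced maps are of this form, with
`w` a chain of the standard simplex or of the prism over it. -/
def familyOperator {n : ℕ} (m : ℕ) (G : C(stdSimplex ℝ (Fin (n + 1)), X) → W → X)
    (w : ListChain W) : SingularChain n X →ₗ[ZMod 2] SingularChain m X :=
  Finsupp.linearCombination (ZMod 2) fun σ => push m (G σ) w

lemma familyOperator_single {n : ℕ} (m : ℕ) (G : C(stdSimplex ℝ (Fin (n + 1)), X) → W → X)
    (w : ListChain W) (σ : C(stdSimplex ℝ (Fin (n + 1)), X)) :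
    familyOperator m G w (Finsupp.single σ 1) = push m (G σ) w := by
  simp [familyOperator]

lemma familyOperator_add {n : ℕ} (m : ℕ) (G : C(stdSimplex ℝ (Fin (n + 1)), X) → W → X)
    (w w' : ListChain W) (c : SingularChain n X) :
    familyOperator m G (w + w') c = familyOperator m G w c + familyOperator m G w' c := by
  suffices h : familyOperator m G (w + w') = familyOperator m G w + familyOperator m G w' from
    congr($h c)
  ext1 σ
  ext1
  simp only [LinearMap.comp_apply, LinearMap.add_apply, Finsupp.lsingle_apply,
    familyOperator_single, map_add]

lemma familyOperator_mem {n m : ℕ} {G : C(stdSimplex ℝ (Fin (n + 1)), X) → W → X}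
    {w : ListChain W} {T₀ : Set C(stdSimplex ℝ (Fin (n + 1)), X)} {D : Set W} (hD : Convex ℝ D)
    {S : Set X} (hG : ∀ σ ∈ T₀, Set.MapsTo (G σ) D S) (hw : w ∈ listChainsIn D)
    {c : SingularChain n X} (hc : c ∈ Finsupp.supported (ZMod 2) (ZMod 2) T₀) :
    familyOperator m G w c ∈ singularChainsIn m S :=
  map_mem_of_supported _ (fun σ hσ => by
    rw [familyOperator_single]
    exact push_mem_singularChainsIn hD (hG σ hσ) hw) hc

/-- Compatibility of a family operator with the boundary on its source. -/
lemma familyOperator_singularBoundary {n m : ℕ}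
    {G : C(stdSimplex ℝ (Fin (n + 1)), X) → W → X}
    {G' : C(stdSimplex ℝ (Fin (n + 2)), X) → W' → X} {w : ListChain W}
    {T₀ : Set C(stdSimplex ℝ (Fin (n + 2)), X)} {D : Set W} (hD : Convex ℝ D)
    (δ : Fin (n + 2) → W →ₗ[ℝ] W') (hG : ∀ σ ∈ T₀, ∀ i, ∀ x ∈ D,
      G (σ.comp (faceMap i)) x = G' σ (δ i x)) (hw : w ∈ listChainsIn D)
    {c : SingularChain (n + 1) X} (hc : c ∈ Finsupp.supported (ZMod 2) (ZMod 2) T₀) :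
    familyOperator m G w (singularBoundary n X c) =
      familyOperator m G' (∑ i, listMap (δ i) w) c := by
  refine map_eq_of_supported (familyOperator m G w ∘ₗ singularBoundary n X)
    (familyOperator m G' (∑ i, listMap (δ i) w)) (fun σ hσ => ?_) hc
  rw [LinearMap.comp_apply, singularBoundary_single, map_sum, familyOperator_single, map_sum]
  refine Finset.sum_congr rfl fun i _ => ?_
  rw [familyOperator_single, push_listMap]
  exact push_congr hD (fun x hx => hG σ hσ i x hx) hw

variable [TopologicalSpace W] [ContinuousAdd W] [ContinuousSMul ℝ W]

lemma singularBoundary_familyOperator {n m : ℕ} {G : C(stdSimplex ℝ (Fin (n + 1)), X) → W → X}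
    {w : ListChain W} {T₀ : Set C(stdSimplex ℝ (Fin (n + 1)), X)} {D : Set W} (hD : Convex ℝ D)
    (hG : ∀ σ ∈ T₀, ContinuousOn (G σ) D) (hw : w ∈ listChainsIn D)
    {c : SingularChain n X} (hc : c ∈ Finsupp.supported (ZMod 2) (ZMod 2) T₀) :
    singularBoundary m X (familyOperator (m + 1) G w c) =
      familyOperator m G (listBoundary W w) c := by
  refine map_eq_of_supported (singularBoundary m X ∘ₗ familyOperator (m + 1) G w)
    (familyOperator m G (listBoundary W w)) (fun σ hσ => ?_) hc
  rw [LinearMap.comp_apply, familyOperator_single, familyOperator_single,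
    singularBoundary_push hD (hG σ hσ) hw]

end Operators

/-! ### Universal chains on the standard simplex -/

section Universal

/-- The tautological ordered simplex, with the vertices of the standard simplex. -/
def stdList (n : ℕ) : ListChain (Fin (n + 1) → ℝ) :=
  Finsupp.single (List.ofFn fun i => Pi.single i 1) 1

/-- The linear extension of `faceMap`. -/
def faceLinearMap {n : ℕ} (i : Fin (n + 2)) : (Fin (n + 1) → ℝ) →ₗ[ℝ] (Fin (n + 2) → ℝ) :=
  FunOnFinite.linearMap ℝ ℝ i.succAbove

lemma faceLinearMap_mem {n : ℕ} (i : Fin (n + 2)) {x : Fin (n + 1) → ℝ}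
    (hx : x ∈ stdSimplex ℝ (Fin (n + 1))) : faceLinearMap i x ∈ stdSimplex ℝ (Fin (n + 2)) :=
  (stdSimplex.map i.succAbove ⟨x, hx⟩).2

lemma listBoundary_stdList (n : ℕ) :
    listBoundary _ (stdList (n + 1)) = ∑ i, listMap (faceLinearMap i) (stdList n) := by
  rw [stdList, listBoundary_single, listFaces_ofFn]
  refine Finset.sum_congr rfl fun i _ => ?_
  rw [stdList, listMap_single, List.map_ofFn]
  congr 2
  funext j
  simp [faceLinearMap, FunOnFinite.linearMap_piSingle]

lemma stdList_mem_listChainsIn (n : ℕ) : stdList n ∈ listChainsIn (stdSimplex ℝ (Fin (n + 1))) :=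
  single_mem_listChainsIn fun v hv => by
    obtain ⟨i, rfl⟩ := List.mem_ofFn.1 hv
    exact single_mem_stdSimplex ℝ i

lemma stdList_mem_listChainsOfLength (n : ℕ) :
    stdList n ∈ listChainsOfLength (Fin (n + 1) → ℝ) (n + 1) :=
  single_mem_listChainsOfLength (by simp)

lemma affineSimplex_single {n : ℕ} (x : stdSimplex ℝ (Fin (n + 1))) :
    affineSimplex (fun i => (Pi.single i 1 : Fin (n + 1) → ℝ)) x = x := by
  ext j
  simp [affineSimplex, Finset.sum_apply, Pi.single_apply]

variable {X : Type} [TopologicalSpace X]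

open Classical in
/-- A singular simplex extended, by a constant, to the ambient space of the standard simplex. -/
def extendSimplex {n : ℕ} (σ : C(stdSimplex ℝ (Fin (n + 1)), X)) (x : Fin (n + 1) → ℝ) : X :=
  if h : x ∈ stdSimplex ℝ (Fin (n + 1)) then σ ⟨x, h⟩ else σ (stdSimplex.vertex 0)

lemma extendSimplex_of_mem {n : ℕ} (σ : C(stdSimplex ℝ (Fin (n + 1)), X)) {x : Fin (n + 1) → ℝ}
    (hx : x ∈ stdSimplex ℝ (Fin (n + 1))) : extendSimplex σ x = σ ⟨x, hx⟩ := dif_pos hx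

lemma extendSimplex_coe {n : ℕ} (σ : C(stdSimplex ℝ (Fin (n + 1)), X))
    (x : stdSimplex ℝ (Fin (n + 1))) : extendSimplex σ x = σ x := dif_pos x.2

lemma continuousOn_extendSimplex {n : ℕ} (σ : C(stdSimplex ℝ (Fin (n + 1)), X)) :
    ContinuousOn (extendSimplex σ) (stdSimplex ℝ (Fin (n + 1))) := by
  rw [continuousOn_iff_continuous_domRestrict]
  exact σ.continuous.congr fun x => (extendSimplex_coe σ x).symm

lemma extendSimplex_faceMap {n : ℕ} (σ : C(stdSimplex ℝ (Fin (n + 2)), X)) (i : Fin (n + 2))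
    {x : Fin (n + 1) → ℝ} (hx : x ∈ stdSimplex ℝ (Fin (n + 1))) :
    extendSimplex (σ.comp (faceMap i)) x = extendSimplex σ (faceLinearMap i x) := by
  rw [extendSimplex_of_mem _ hx, extendSimplex_of_mem _ (faceLinearMap_mem i hx)]
  rfl

lemma push_extendSimplex {n : ℕ} (σ : C(stdSimplex ℝ (Fin (n + 1)), X)) :
    push n (extendSimplex σ) (stdList n) = Finsupp.single σ 1 := by
  have h : (fun x => extendSimplex σ (affineSimplex (fun i => (Pi.single i 1 : Fin (n + 1) → ℝ)) x))
      = σ := by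
    funext x
    rw [affineSimplex_single, extendSimplex_coe]
  rw [stdList, push_ofFn, h, chainOfFun_of_continuous σ.continuous]
  rfl

/-- Iterated barycentric subdivision of singular chains. -/
def singularSubdivision (n N : ℕ) : SingularChain n X →ₗ[ZMod 2] SingularChain n X :=
  familyOperator n extendSimplex (iterSubdivision _ N (stdList n))

lemma singularBoundary_singularSubdivision {n : ℕ} (N : ℕ) (c : SingularChain (n + 1) X) :
    singularBoundary n X (singularSubdivision (n + 1) N c) =
      singularSubdivision n N (singularBoundary n X c) := by
  have hc : c ∈ Finsupp.supported (ZMod 2) (ZMod 2) Set.univ := by simp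
  rw [singularSubdivision, singularBoundary_familyOperator (convex_stdSimplex ℝ _)
    (fun σ _ => continuousOn_extendSimplex σ)
    (iterSubdivision_mem_listChainsIn (convex_stdSimplex ℝ _) N (stdList_mem_listChainsIn _)) hc,
    singularSubdivision, familyOperator_singularBoundary (convex_stdSimplex ℝ _) faceLinearMap
    (fun σ _ i x hx => extendSimplex_faceMap σ i hx)
    (iterSubdivision_mem_listChainsIn (convex_stdSimplex ℝ _) N (stdList_mem_listChainsIn _)) hc,
    listBoundary_iterSubdivision, listBoundary_stdList, map_sum]
  simp only [iterSubdivision_natural]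

/-- A singular chain in `S` and its iterated subdivisions are homologous in `S`. -/
lemma exists_singularBoundary_eq_add_singularSubdivision {n : ℕ} (N : ℕ) {S : Set X}
    {c : SingularChain (n + 1) X} (hc : c ∈ singularChainsIn (n + 1) S)
    (hz : singularBoundary n X c = 0) :
    ∃ b ∈ singularChainsIn (n + 2) S,
      singularBoundary (n + 1) X b = c + singularSubdivision (n + 1) N c := by
  have hT := fun k => subdivisionHomotopy_mem_listChainsIn (convex_stdSimplex ℝ _) N
    (stdList_mem_listChainsIn k)
  refine ⟨familyOperator (n + 2) extendSimplex (subdivisionHomotopy _ N (stdList (n + 1))) c,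
    familyOperator_mem (convex_stdSimplex ℝ _) (fun σ hσ x hx => ?_) (hT _) hc, ?_⟩
  · rw [extendSimplex_of_mem σ hx]
    exact hσ _
  · have h1 := familyOperator_singularBoundary (m := n + 1) (convex_stdSimplex ℝ _) faceLinearMap
      (fun σ _ i x hx => extendSimplex_faceMap σ i hx) (hT n) hc
    rw [hz, map_zero] at h1
    rw [singularBoundary_familyOperator (convex_stdSimplex ℝ _)
      (fun σ _ => continuousOn_extendSimplex σ) (hT _) hc]
    simp only [← subdivisionHomotopy_natural] at h1
    rw [← map_sum, ← listBoundary_stdList] at h1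
    rw [← add_zero (familyOperator _ _ _ c), h1, ← familyOperator_add,
      listBoundary_subdivisionHomotopy, familyOperator_add]
    congr 1
    suffices h : familyOperator (n + 1) extendSimplex (stdList (n + 1)) =
      (LinearMap.id : SingularChain (n + 1) X →ₗ[ZMod 2] _) from congr($h c)
    ext1 σ
    ext1
    simp only [LinearMap.comp_apply, Finsupp.lsingle_apply, familyOperator_single,
      push_extendSimplex, LinearMap.id_apply]

end Universal

/-! ### The prism operator -/

section Prism

/-- The copy at height `s` of the tautological simplex in the prism over the standard simplex. -/
def prismEnd (n : ℕ) (s : ℝ) : ListChain ((Fin (n + 1) → ℝ) × ℝ) :=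
  listMap (fun x => (x, s)) (stdList n)

/-- The triangulation of the prism over an ordered simplex in `V`. -/
def prism (V : Type*) [AddCommGroup V] [Module ℝ V] : ListChain V →ₗ[ZMod 2] ListChain (V × ℝ) :=
  listHomotopy (fun l => (barycenter l, (0 : ℝ)))
    (listMap (fun x => (x, (0 : ℝ))) + listMap (fun x => (x, (1 : ℝ))))

section

variable {V W : Type*} [AddCommGroup V] [Module ℝ V] [AddCommGroup W] [Module ℝ W]

lemma listBoundary_prism (c : ListChain V) :
    listBoundary _ (prism V c) + prism V (listBoundary V c) =
      listMap (fun x => (x, (0 : ℝ))) c + listMap (fun x => (x, (1 : ℝ))) c :=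
  listBoundary_listHomotopy _ (by simp [listBoundary_listMap])
    (by simp [ListChain.add_self]) c

lemma prism_natural (g : V →ₗ[ℝ] W) (c : ListChain V) :
    prism W (listMap g c) = listMap (g.prodMap LinearMap.id) (prism V c) :=
  listHomotopy_natural (fun l _ => by simp [barycenter_map]) (by
    intro x
    simp only [LinearMap.add_apply, listMap_listMap, map_add]
    rfl) c

lemma prism_mem_listChainsIn {D : Set V} (hD : Convex ℝ D) {c : ListChain V}
    (hc : c ∈ listChainsIn D) : prism V c ∈ listChainsIn (D ×ˢ Set.Icc (0 : ℝ) 1) :=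
  listHomotopy_mem_listChainsIn
    (fun _ hl h => Set.mk_mem_prod (barycenter_mem hD hl h) (by simp))
    (fun _ hl => Submodule.add_mem _
      (listMap_mem_listChainsIn (D := D) (fun x hx => Set.mk_mem_prod hx (by simp))
        (single_mem_listChainsIn hl))
      (listMap_mem_listChainsIn (D := D) (fun x hx => Set.mk_mem_prod hx (by simp))
        (single_mem_listChainsIn hl)))
    hc

end

variable {X : Type} [TopologicalSpace X]

lemma continuous_prismEnd {n : ℕ} {g : (Fin (n + 1) → ℝ) × ℝ → X} {s : ℝ}
    (hs : s ∈ Set.Icc (0 : ℝ) 1)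
    (hg : ContinuousOn g (stdSimplex ℝ (Fin (n + 1)) ×ˢ Set.Icc (0 : ℝ) 1)) :
    Continuous fun x : stdSimplex ℝ (Fin (n + 1)) => g (x, s) :=
  hg.comp_continuous (by fun_prop) fun x => ⟨x.2, hs⟩

lemma push_prismEnd {n : ℕ} {g : (Fin (n + 1) → ℝ) × ℝ → X} {s : ℝ}
    (h : Continuous fun x : stdSimplex ℝ (Fin (n + 1)) => g (x, s)) :
    push n g (prismEnd n s) = Finsupp.single ⟨_, h⟩ 1 := by
  have e : (fun x => g (affineSimplex (fun i => ((Pi.single i 1 : Fin (n + 1) → ℝ), s)) x)) =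
      fun x : stdSimplex ℝ (Fin (n + 1)) => g (x, s) := by
    funext x
    congr 1
    refine Prod.ext ?_ ?_
    · refine Eq.trans ?_ (affineSimplex_single x)
      simp [affineSimplex, Prod.fst_sum]
    · simp [affineSimplex, Prod.snd_sum, ← Finset.sum_mul]
  rw [prismEnd, stdList, listMap_single, List.map_ofFn]
  refine (push_ofFn _ _).trans ?_
  rw [← chainOfFun_of_continuous h, ← e]
  rfl

/-- Let a homotopy `G σ` be given for each singular simplex `σ`, compatible with faces. Then the
ends of the homotopies of a cycle differ by a boundary. -/
lemma exists_singularBoundary_eq_prismEnd {n : ℕ} {S : Set X}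
    {G : ∀ {k : ℕ}, C(stdSimplex ℝ (Fin (k + 1)), X) → (Fin (k + 1) → ℝ) × ℝ → X}
    {T₀ : Set C(stdSimplex ℝ (Fin (n + 2)), X)}
    (hface : ∀ σ ∈ T₀, ∀ i, ∀ x ∈ stdSimplex ℝ (Fin (n + 1)), ∀ t ∈ Set.Icc (0 : ℝ) 1,
      G (σ.comp (faceMap i)) (x, t) = G σ (faceLinearMap i x, t))
    (hcont : ∀ σ ∈ T₀, ContinuousOn (G σ) (stdSimplex ℝ (Fin (n + 2)) ×ˢ Set.Icc (0 : ℝ) 1))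
    (hS : ∀ σ ∈ T₀, Set.MapsTo (G σ) (stdSimplex ℝ (Fin (n + 2)) ×ˢ Set.Icc (0 : ℝ) 1) S)
    {c : SingularChain (n + 1) X} (hc : c ∈ Finsupp.supported (ZMod 2) (ZMod 2) T₀)
    (hz : singularBoundary n X c = 0) :
    ∃ b ∈ singularChainsIn (n + 2) S, singularBoundary (n + 1) X b =
      familyOperator (n + 1) G (prismEnd (n + 1) 0) c +
        familyOperator (n + 1) G (prismEnd (n + 1) 1) c := by
  have hconv : ∀ k, Convex ℝ (stdSimplex ℝ (Fin (k + 1)) ×ˢ Set.Icc (0 : ℝ) 1) := fun k =>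
    (convex_stdSimplex ℝ _).prod (convex_Icc 0 1)
  have hP := fun k => prism_mem_listChainsIn (convex_stdSimplex ℝ _) (stdList_mem_listChainsIn k)
  refine ⟨familyOperator (n + 2) G (prism _ (stdList (n + 1))) c,
    familyOperator_mem (hconv _) hS (hP _) hc, ?_⟩
  have h1 := familyOperator_singularBoundary (m := n + 1) (hconv n) (G := G) (G' := G)
    (fun i => (faceLinearMap i).prodMap LinearMap.id)
    (fun σ hσ i x hx => hface σ hσ i x.1 hx.1 x.2 hx.2) (hP n) hc
  rw [hz, map_zero] at h1
  rw [singularBoundary_familyOperator (hconv _) hcont (hP _) hc]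
  simp only [← prism_natural] at h1
  rw [← map_sum, ← listBoundary_stdList] at h1
  rw [← add_zero (familyOperator _ _ _ c), h1, ← familyOperator_add, listBoundary_prism,
    familyOperator_add]
  rfl

end Prism

/-! ### Barycentric coordinates on a simplicial complex -/

section Barycentric

variable {E : Type} [NormedAddCommGroup E] [NormedSpace ℝ E]

/-- `w` is a system of barycentric coordinates, supported on `s`, for the point `x`. -/
structure IsBarycentric (s : Finset E) (w : E → ℝ) (x : E) : Prop where
  nonneg : ∀ v, 0 ≤ w v
  eq_zero : ∀ v, v ∉ s → w v = 0
  sum_eq_one : ∑ v ∈ s, w v = 1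
  sum_smul : ∑ v ∈ s, w v • v = x

lemma IsBarycentric.mem_convexHull {s : Finset E} {w : E → ℝ} {x : E}
    (h : IsBarycentric s w x) : x ∈ convexHull ℝ (s : Set E) := by
  rw [← h.sum_smul]
  exact (convex_convexHull ℝ _).sum_mem (fun v _ => h.nonneg v) h.sum_eq_one
    (fun v hv => subset_convexHull ℝ _ hv)

lemma exists_isBarycentric {s : Finset E} {x : E} (hx : x ∈ convexHull ℝ (s : Set E)) :
    ∃ w, IsBarycentric s w x := by
  classical
  rw [Finset.mem_convexHull'] at hx
  obtain ⟨w, hw0, hw1, hwx⟩ := hx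
  refine ⟨fun v => if v ∈ s then w v else 0, ⟨fun v => ?_, fun v hv => if_neg hv, ?_, ?_⟩⟩
  · split_ifs with h
    · exact hw0 v h
    · exact le_rfl
  · rw [← hw1]
    exact Finset.sum_congr rfl fun v hv => if_pos hv
  · rw [← hwx]
    exact Finset.sum_congr rfl fun v hv => by rw [if_pos hv]

lemma IsBarycentric.mono {s t : Finset E} {w : E → ℝ} {x : E} (h : IsBarycentric s w x)
    (hst : s ⊆ t) : IsBarycentric t w x where
  nonneg := h.nonneg
  eq_zero v hv := h.eq_zero v fun hs => hv (hst hs)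
  sum_eq_one := by
    rw [← h.sum_eq_one]
    exact (Finset.sum_subset hst fun v _ hv => h.eq_zero v hv).symm
  sum_smul := by
    rw [← h.sum_smul]
    exact (Finset.sum_subset hst fun v _ hv => by rw [h.eq_zero v hv, zero_smul]).symm

lemma IsBarycentric.eq_of_affineIndependent {s : Finset E} {w w' : E → ℝ} {x : E}
    (hs : AffineIndependent ℝ ((↑) : s → E)) (h : IsBarycentric s w x)
    (h' : IsBarycentric s w' x) : w = w' := by
  funext v
  by_cases hv : v ∈ s
  · rw [affineIndependent_iff] at hs
    have := hs Finset.univ (fun i => w i - w' i) (by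
      rw [Finset.sum_sub_distrib, Finset.sum_coe_sort s w, Finset.sum_coe_sort s w',
        h.sum_eq_one, h'.sum_eq_one, sub_self]) (by
      simp only [sub_smul]
      rw [Finset.sum_sub_distrib, Finset.sum_coe_sort s (fun v => w v • v),
        Finset.sum_coe_sort s (fun v => w' v • v), h.sum_smul, h'.sum_smul, sub_self])
      ⟨v, hv⟩ (Finset.mem_univ _)
    exact sub_eq_zero.1 this
  · rw [h.eq_zero v hv, h'.eq_zero v hv]

variable (K : Geometry.SimplicialComplex ℝ E)

lemma IsBarycentric.unique {K : Geometry.SimplicialComplex ℝ E} {s t : Finset E}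
    (hs : s ∈ K.faces) (ht : t ∈ K.faces) {w w' : E → ℝ} {x : E}
    (h : IsBarycentric s w x) (h' : IsBarycentric t w' x) : w = w' := by
  classical
  have hx := K.inter_subset_convexHull hs ht ⟨h.mem_convexHull, h'.mem_convexHull⟩
  rw [← Finset.coe_inter] at hx
  obtain ⟨u, hu⟩ := exists_isBarycentric hx
  rw [h.eq_of_affineIndependent (K.indep hs) (hu.mono Finset.inter_subset_left),
    h'.eq_of_affineIndependent (K.indep ht) (hu.mono Finset.inter_subset_right)]

open Classical in
/-- The barycentric coordinate of the point `x` of `|K|` at the vertex `v`; it is `0` unless `v`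
is a vertex of the carrier of `x`. -/
def baryCoord (v x : E) : ℝ :=
  if h : ∃ w : E → ℝ, ∃ s ∈ K.faces, IsBarycentric s w x then h.choose v else 0

variable {K}

lemma baryCoord_eq {s : Finset E} (hs : s ∈ K.faces) {w : E → ℝ} {x : E}
    (h : IsBarycentric s w x) (v : E) : baryCoord K v x = w v := by
  have hex : ∃ w : E → ℝ, ∃ s ∈ K.faces, IsBarycentric s w x := ⟨w, s, hs, h⟩
  rw [baryCoord, dif_pos hex]
  obtain ⟨t, ht, ht'⟩ := hex.choose_spec
  rw [ht'.unique ht hs h]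

lemma isBarycentric_baryCoord {s : Finset E} (hs : s ∈ K.faces) {x : E}
    (hx : x ∈ convexHull ℝ (s : Set E)) : IsBarycentric s (fun v => baryCoord K v x) x := by
  obtain ⟨w, hw⟩ := exists_isBarycentric hx
  rwa [show (fun v => baryCoord K v x) = w from funext (baryCoord_eq hs hw)]

/-- The carrier of a point: the simplex on the vertices with positive barycentric coordinate. -/
lemma exists_carrier {x : E} (hx : x ∈ K.space) :
    ∃ s ∈ K.faces, (∀ v, v ∈ s ↔ 0 < baryCoord K v x) ∧
      IsBarycentric s (fun v => baryCoord K v x) x := by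
  classical
  obtain ⟨t, ht, hxt⟩ := Geometry.SimplicialComplex.mem_space_iff.1 hx
  have h := isBarycentric_baryCoord ht hxt
  have hmem : ∀ v, v ∈ t.filter (fun v => 0 < baryCoord K v x) ↔ 0 < baryCoord K v x := by
    intro v
    rw [Finset.mem_filter, and_iff_right_iff_imp]
    intro hv
    by_contra hvt
    exact hv.ne' (h.eq_zero v hvt)
  have hz : ∀ v ∈ t, v ∉ t.filter (fun v => 0 < baryCoord K v x) → baryCoord K v x = 0 :=
    fun v _ hv => le_antisymm (not_lt.1 fun h' => hv ((hmem v).2 h')) (h.nonneg v)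
  have hb : IsBarycentric (t.filter (fun v => 0 < baryCoord K v x))
      (fun v => baryCoord K v x) x := by
    refine ⟨h.nonneg, fun v hv => ?_, ?_, ?_⟩
    · exact le_antisymm (not_lt.1 fun h' => hv ((hmem v).2 h')) (h.nonneg v)
    · rw [← h.sum_eq_one]
      exact Finset.sum_subset (Finset.filter_subset _ _) fun v hv hv' => hz v hv hv'
    · conv_rhs => rw [← h.sum_smul]
      exact Finset.sum_subset (Finset.filter_subset _ _)
        fun v hv hv' => by rw [hz v hv hv', zero_smul]
  refine ⟨_, K.down_closed ht (Finset.filter_subset _ _) ?_, hmem, hb⟩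
  rw [Finset.nonempty_iff_ne_empty]
  intro h0
  have := hb.sum_eq_one
  rw [h0, Finset.sum_empty] at this
  exact zero_ne_one this

lemma baryCoord_nonneg {x : E} (hx : x ∈ K.space) (v : E) : 0 ≤ baryCoord K v x := by
  obtain ⟨s, _, _, h⟩ := exists_carrier hx
  exact h.nonneg v

lemma mem_vertices_of_mem_face {s : Finset E} (hs : s ∈ K.faces) {v : E} (hv : v ∈ s) :
    v ∈ K.vertices :=
  K.down_closed hs (Finset.singleton_subset_iff.2 hv) (Finset.singleton_nonempty v)

lemma baryCoord_eq_zero_of_notMem_vertices {x : E} (hx : x ∈ K.space) {v : E}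
    (hv : v ∉ K.vertices) : baryCoord K v x = 0 := by
  obtain ⟨s, hs, _, h⟩ := exists_carrier hx
  exact h.eq_zero v fun h' => hv (mem_vertices_of_mem_face hs h')

/-- A simplex is homeomorphic to a standard simplex, on which the coordinates are continuous,
because a continuous bijection from a compact space to a Hausdorff space is a homeomorphism. -/
lemma continuousOn_baryCoord_convexHull {s : Finset E} (hs : s ∈ K.faces) (v : E) :
    ContinuousOn (baryCoord K v) (convexHull ℝ (s : Set E)) := by
  classical
  let q : stdSimplex ℝ s → E := fun w => ∑ i, w i • (i : E)
  have hq : Continuous q := by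
    refine continuous_finsetSum _ fun i _ => ?_
    exact ((continuous_apply i).comp continuous_subtype_val).smul continuous_const
  have hbary : ∀ w : stdSimplex ℝ s, IsBarycentric s
      (fun v => if h : v ∈ s then w ⟨v, h⟩ else 0) (q w) := by
    intro w
    refine ⟨fun v => ?_, fun v hv => dif_neg hv, ?_, ?_⟩
    · split_ifs with h
      · exact w.2.1 _
      · exact le_rfl
    · rw [← Finset.sum_coe_sort]
      simpa using! w.2.2
    · rw [← Finset.sum_coe_sort s (fun v => (if h : v ∈ s then w ⟨v, h⟩ else 0) • v)]
      simp [q]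
  have hinj : Function.Injective q := by
    intro w w' hww
    have h2 := hbary w'
    rw [← hww] at h2
    have := (hbary w).eq_of_affineIndependent (K.indep hs) h2
    ext i
    have h3 := congrFun this i
    simpa using h3
  have hemb := hq.isClosedEmbedding hinj
  have hrange : convexHull ℝ (s : Set E) ⊆ Set.range q := by
    intro x hx
    obtain ⟨w, hw⟩ := exists_isBarycentric hx
    refine ⟨⟨fun i => w i, fun i => hw.nonneg _, ?_⟩, ?_⟩
    · rw [Finset.sum_coe_sort s w, hw.sum_eq_one]
    · change ∑ i : s, w i • (i : E) = x
      rw [Finset.sum_coe_sort s (fun v => w v • v), hw.sum_smul]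
  refine ContinuousOn.mono ?_ hrange
  rw [continuousOn_iff_continuous_domRestrict]
  let e := hemb.isEmbedding.toHomeomorph
  have he : (Set.range q).domRestrict (baryCoord K v) =
      (fun w : stdSimplex ℝ s => if h : v ∈ s then w ⟨v, h⟩ else 0) ∘ e.symm := by
    funext y
    obtain ⟨w, rfl⟩ := e.surjective y
    rw [Function.comp_apply, e.symm_apply_apply]
    exact baryCoord_eq hs (hbary w) v
  rw [he]
  refine Continuous.comp ?_ e.symm.continuous
  by_cases h : v ∈ s
  · simp only [h, dif_pos]
    exact (continuous_apply _).comp continuous_subtype_val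
  · simp only [h, dif_neg, not_false_eq_true]
    exact continuous_const

lemma continuousOn_baryCoord (hK : K.faces.Finite) (v : E) :
    ContinuousOn (baryCoord K v) K.space := by
  have : Finite K.faces := hK
  have h := (locallyFinite_of_finite fun s : K.faces => convexHull ℝ ((s : Finset E) : Set E))
  have h2 := h.continuousOn_iUnion (g := baryCoord K v)
    (fun s => (s.1.finite_toSet.isCompact_convexHull ℝ).isClosed)
    (fun s => continuousOn_baryCoord_convexHull s.2 v)
  rwa [Set.iUnion_coe_set (s := K.faces) (f := fun s => convexHull ℝ ((s : Finset E) : Set E))]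
    at h2

lemma finite_vertices (hK : K.faces.Finite) : K.vertices.Finite := by
  rw [Geometry.SimplicialComplex.vertices_eq]
  exact hK.biUnion fun s _ => s.finite_toSet

end Barycentric

/-! ### Unordered and ordered simplicial chains -/

section Ordering

variable {E : Type}

open Classical in
/-- The augmented boundary operator on formal sums of finite vertex sets. -/
def finsetBoundary (E : Type) : (Finset E →₀ ZMod 2) →ₗ[ZMod 2] (Finset E →₀ ZMod 2) :=
  Finsupp.linearCombination (ZMod 2) fun s => ∑ v ∈ s, Finsupp.single (s.erase v) 1

open Classical in
/-- Joining a finite vertex set with `v`; the result is degenerate if `v` is already present. -/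
def finsetCone (v : E) : (Finset E →₀ ZMod 2) →ₗ[ZMod 2] (Finset E →₀ ZMod 2) :=
  Finsupp.linearCombination (ZMod 2) fun s => if v ∈ s then 0 else Finsupp.single (insert v s) 1

open Classical in
lemma finsetBoundary_single (s : Finset E) :
    finsetBoundary E (Finsupp.single s 1) = ∑ v ∈ s, Finsupp.single (s.erase v) 1 := by
  simp [finsetBoundary]

open Classical in
lemma finsetCone_single (v : E) (s : Finset E) :
    finsetCone v (Finsupp.single s 1) = if v ∈ s then 0 else Finsupp.single (insert v s) 1 := by
  simp [finsetCone]

lemma finsetBoundary_finsetCone (v : E) (c : Finset E →₀ ZMod 2) :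
    finsetBoundary E (finsetCone v c) = c + finsetCone v (finsetBoundary E c) := by
  classical
  suffices h : finsetBoundary E ∘ₗ finsetCone v =
    LinearMap.id + finsetCone v ∘ₗ finsetBoundary E from congr($h c)
  ext1 s
  ext1
  simp only [LinearMap.comp_apply, LinearMap.add_apply, Finsupp.lsingle_apply, LinearMap.id_apply,
    finsetBoundary_single, map_sum, finsetCone_single]
  by_cases hv : v ∈ s
  · rw [if_pos hv, map_zero, ← Finset.add_sum_erase s _ hv, if_neg (Finset.notMem_erase v s),
      Finset.insert_erase hv, Finset.sum_eq_zero, add_zero, ListChain.add_self]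
    intro u hu
    rw [if_pos]
    exact Finset.mem_erase.2 ⟨(Finset.ne_of_mem_erase hu).symm, hv⟩
  · rw [if_neg hv, finsetBoundary_single, Finset.sum_insert hv, Finset.erase_insert hv]
    congr 1
    refine Finset.sum_congr rfl fun u hu => ?_
    have huv : v ≠ u := fun h => hv (h ▸ hu)
    rw [if_neg fun h => hv (Finset.mem_of_mem_erase h), Finset.erase_insert_of_ne huv]

open Classical in
/-- The vertex set of an ordered simplex; degenerate ordered simplices are sent to `0`. -/
def forgetOrder (E : Type) : ListChain E →ₗ[ZMod 2] (Finset E →₀ ZMod 2) :=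
  Finsupp.linearCombination (ZMod 2) fun l =>
    if l.Nodup then Finsupp.single l.toFinset 1 else 0

open Classical in
lemma forgetOrder_single (l : List E) :
    forgetOrder E (Finsupp.single l 1) = if l.Nodup then Finsupp.single l.toFinset 1 else 0 := by
  simp [forgetOrder]

lemma forgetOrder_cone (v : E) (c : ListChain E) :
    forgetOrder E (cone v c) = finsetCone v (forgetOrder E c) := by
  classical
  suffices h : forgetOrder E ∘ₗ cone v = finsetCone v ∘ₗ forgetOrder E from congr($h c)
  ext1 l
  ext1
  simp only [LinearMap.comp_apply, Finsupp.lsingle_apply, cone_single, forgetOrder_single,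
    List.nodup_cons]
  by_cases hl : l.Nodup <;> by_cases hv : v ∈ l <;> simp [hl, hv, finsetCone_single]

lemma forgetOrder_listBoundary (c : ListChain E) :
    forgetOrder E (listBoundary E c) = finsetBoundary E (forgetOrder E c) := by
  classical
  suffices h : forgetOrder E ∘ₗ listBoundary E = finsetBoundary E ∘ₗ forgetOrder E from
    congr($h c)
  ext1 l
  ext1
  simp only [LinearMap.comp_apply, Finsupp.lsingle_apply, listBoundary_single]
  induction l with
  | nil => simp [listFaces, forgetOrder_single, finsetBoundary_single]
  | cons v l ih =>
    rw [listFaces, map_add, forgetOrder_cone, ih, ← cone_single, forgetOrder_cone,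
      finsetBoundary_finsetCone]

lemma finsetBoundary_finsetBoundary (c : Finset E →₀ ZMod 2) :
    finsetBoundary E (finsetBoundary E c) = 0 := by
  classical
  suffices h : finsetBoundary E ∘ₗ finsetBoundary E = 0 from congr($h c)
  ext1 s
  ext1
  have e : Finsupp.single s 1 = forgetOrder E (Finsupp.single s.toList 1) := by
    rw [forgetOrder_single, if_pos s.nodup_toList, Finset.toList_toFinset]
  simp only [LinearMap.comp_apply, Finsupp.lsingle_apply, LinearMap.zero_apply]
  rw [e, ← forgetOrder_listBoundary, ← forgetOrder_listBoundary, listBoundary_listBoundary,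
    map_zero]

lemma finsetBoundary_mem_supported (s : Finset E) :
    finsetBoundary E (Finsupp.single s 1) ∈
      Finsupp.supported (ZMod 2) (ZMod 2) {t | t.card + 1 = s.card} := by
  classical
  rw [finsetBoundary_single]
  exact Submodule.sum_mem _ fun v hv => Finsupp.single_mem_supported _ _
    (Finset.card_erase_add_one hv)

lemma lowersRank_finsetBoundary : LowersRank (finsetBoundary E) Finset.card := fun s =>
  Finsupp.supported_mono (fun _ h => Nat.lt_of_succ_le (Eq.le h)) (finsetBoundary_mem_supported s)

variable [Nonempty E]

open Classical in
/-- A vertex of a nonempty finite set. -/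
def someVertex (s : Finset E) : E := if h : s.Nonempty then h.choose else Classical.arbitrary E

lemma someVertex_mem {s : Finset E} (h : s.Nonempty) : someVertex s ∈ s := by
  rw [someVertex, dif_pos h]
  exact h.choose_spec

/-- A chain map from unordered to ordered simplices that splits `forgetOrder`. -/
def chooseOrder (E : Type) [Nonempty E] : (Finset E →₀ ZMod 2) →ₗ[ZMod 2] ListChain E :=
  coneRec lowersRank_finsetBoundary someVertex 0 (Finsupp.single [] 1)

lemma listBoundary_chooseOrder (c : Finset E →₀ ZMod 2) :
    listBoundary E (chooseOrder E c) = chooseOrder E (finsetBoundary E c) :=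
  ListChain.eq_of_add_eq_zero <| listBoundary_coneRec lowersRank_finsetBoundary
    finsetBoundary_finsetBoundary (by simp) (by simp [listFaces]) c

lemma forgetOrder_chooseOrder (c : Finset E →₀ ZMod 2) :
    forgetOrder E (chooseOrder E c) = c := by
  classical
  suffices h : ∀ n, ∀ s : Finset E, s.card = n →
      forgetOrder E (chooseOrder E (Finsupp.single s 1)) = Finsupp.single s 1 by
    have : forgetOrder E ∘ₗ chooseOrder E = LinearMap.id := by
      ext1 s
      ext1
      exact h _ s rfl
    exact congr($this c)
  intro n
  induction n with
  | zero =>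
    intro s hs
    rw [chooseOrder, coneRec_of_rank_eq_zero _ _ _ _ hs, Finset.card_eq_zero.1 hs]
    simp [forgetOrder_single]
  | succ n ih =>
    intro s hs
    have hs0 : s.card ≠ 0 := by omega
    rw [chooseOrder, coneRec_of_rank_ne_zero _ _ _ _ hs0, LinearMap.zero_apply, zero_add,
      forgetOrder_cone]
    have key : forgetOrder E (chooseOrder E (finsetBoundary E (Finsupp.single s 1))) =
        finsetBoundary E (Finsupp.single s 1) :=
      map_eq_of_supported (forgetOrder E ∘ₗ chooseOrder E) LinearMap.id
        (fun t ht => ih t (by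
          have ht' : t.card + 1 = s.card := ht
          omega)) (finsetBoundary_mem_supported s)
    change finsetCone _ (forgetOrder E (chooseOrder E _)) = _
    rw [key]
    refine (ListChain.eq_of_add_eq_zero ?_).symm
    rw [← finsetBoundary_finsetCone, finsetCone_single,
      if_pos (someVertex_mem (Finset.card_ne_zero.1 hs0)), map_zero]

lemma chooseOrder_mem_listChainsIn {s : Finset E} :
    chooseOrder E (Finsupp.single s 1) ∈ listChainsIn (s : Set E) :=
  coneRec_mem_listChainsIn _ (s := {t | t ⊆ s})
    (fun t (ht : t ⊆ s) => by
      classical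
      rw [finsetBoundary_single]
      exact Submodule.sum_mem _ fun v _ => Finsupp.single_mem_supported _ _
        ((Finset.erase_subset v t).trans ht))
    (fun t ht h0 => ht (someVertex_mem (Finset.card_ne_zero.1 h0)))
    (fun _ _ _ => Submodule.zero_mem _) (single_mem_listChainsIn (by simp))
    (Finsupp.single_mem_supported _ _ (Finset.Subset.refl s))

lemma chooseOrder_mem_listChainsOfLength {n : ℕ} {c : Finset E →₀ ZMod 2}
    (hc : c ∈ Finsupp.supported (ZMod 2) (ZMod 2) {s | s.card = n}) :
    chooseOrder E c ∈ listChainsOfLength E n :=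
  coneRec_mem_listChainsOfLength (k := 0) _ finsetBoundary_mem_supported
    (fun _ _ _ _ => Submodule.zero_mem _) (single_mem_listChainsOfLength rfl) hc

end Ordering

section ListChainsOf

variable {E : Type}

open Classical in
/-- Chains of ordered simplices of an abstract simplicial complex, the empty simplex included. -/
def listChainsOf (F : Set (Finset E)) : Submodule (ZMod 2) (ListChain E) :=
  Finsupp.supported (ZMod 2) (ZMod 2) {l | l.toFinset ∈ F ∨ l = []}

variable {F : Set (Finset E)} (hF : ∀ s ∈ F, ∀ t ⊆ s, t.Nonempty → t ∈ F)

include hF in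
lemma listChainsIn_le_listChainsOf {s : Finset E} (hs : s ∈ F) :
    listChainsIn (s : Set E) ≤ listChainsOf F := by
  classical
  refine Finsupp.supported_mono fun l hl => ?_
  by_cases h : l = []
  · exact Or.inr h
  · refine Or.inl (hF s hs _ (fun v hv => hl v (List.mem_toFinset.1 hv)) ?_)
    obtain ⟨v, hv⟩ := List.exists_mem_of_ne_nil l h
    exact ⟨v, List.mem_toFinset.2 hv⟩

include hF in
/-- An operator that preserves each simplex preserves the chains of the complex. -/
lemma map_mem_listChainsOf {A : ListChain E →ₗ[ZMod 2] ListChain E}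
    (hA : ∀ s ∈ F, ∀ c ∈ listChainsIn (s : Set E), A c ∈ listChainsIn (s : Set E))
    (hA0 : A (Finsupp.single [] 1) ∈ listChainsOf F)
    {c : ListChain E} (hc : c ∈ listChainsOf F) : A c ∈ listChainsOf F := by
  classical
  refine map_mem_of_supported A (fun l hl => ?_) hc
  rcases hl with hl | rfl
  · refine listChainsIn_le_listChainsOf hF hl (hA _ hl _ (single_mem_listChainsIn ?_))
    simp
  · exact hA0

include hF in
lemma chooseOrder_mem_listChainsOf [Nonempty E] {p : ℕ} {c : Finset E →₀ ZMod 2}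
    (hc : c ∈ chains p F) : chooseOrder E c ∈ listChainsOf F :=
  map_mem_of_supported _ (fun _ hs =>
    listChainsIn_le_listChainsOf hF hs.1 chooseOrder_mem_listChainsIn) hc

lemma forgetOrder_mem_chains {p : ℕ} {c : ListChain E} (hc : c ∈ listChainsOf F)
    (hc' : c ∈ listChainsOfLength E (p + 1)) : forgetOrder E c ∈ chains p F := by
  classical
  have h : c ∈ Finsupp.supported (ZMod 2) (ZMod 2)
      ({l : List E | l.toFinset ∈ F ∨ l = []} ∩ {l | l.length = p + 1}) := by
    rw [Finsupp.supported_inter]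
    exact ⟨hc, hc'⟩
  refine map_mem_of_supported _ ?_ h
  rintro l ⟨hl, hlen : l.length = p + 1⟩
  rw [forgetOrder_single]
  split_ifs with hn
  · refine Finsupp.single_mem_supported _ _ ⟨?_, ?_⟩
    · rcases hl with hl | rfl
      · exact hl
      · simp at hlen
    · rw [List.toFinset_card_of_nodup hn, hlen]
  · exact Submodule.zero_mem _

/-- In positive degrees the boundary operator agrees with the augmented one. -/
lemma boundary_eq_finsetBoundary {p : ℕ} {c : Finset E →₀ ZMod 2} (hc : c ∈ chains (p + 1) F) :
    boundary E c = finsetBoundary E c := by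
  classical
  refine map_eq_of_supported _ _ (fun s hs => ?_) hc
  rw [finsetBoundary_single, boundary, Finsupp.linearCombination_single, one_smul, if_neg]
  have := hs.2
  omega

lemma chooseOrder_mem_listChainsOfLength_of_mem_chains [Nonempty E] {n : ℕ}
    {c : Finset E →₀ ZMod 2} (hc : c ∈ chains n F) :
    chooseOrder E c ∈ listChainsOfLength E (n + 1) :=
  chooseOrder_mem_listChainsOfLength (Finsupp.supported_mono (fun _ hs => hs.2) hc)

lemma finsetBoundary_eq_zero_of_mem_cycles {n : ℕ} {y : Finset E →₀ ZMod 2}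
    (hy : y ∈ cycles (n + 1) F) : finsetBoundary E y = 0 := by
  rw [← boundary_eq_finsetBoundary hy.1]
  exact hy.2

include hF in
/-- A chain map of ordered simplices that carries each simplex of `F` into itself moves cycles
within their homology class. -/
lemma exists_listBoundary_eq_add_of_carried [Nonempty E] {A : ListChain E →ₗ[ZMod 2] ListChain E}
    (hA : ∀ c, listBoundary E (A c) = A (listBoundary E c))
    (hnil : A (Finsupp.single [] 1) = Finsupp.single [] 1)
    (hlen : ∀ l : List E, A (Finsupp.single l 1) ∈ listChainsOfLength E l.length)
    (hin : ∀ s ∈ F, ∀ l : List E, (∀ v ∈ l, v ∈ s) →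
      A (Finsupp.single l 1) ∈ listChainsIn (s : Set E))
    {n : ℕ} {c : ListChain E} (hc : c ∈ listChainsOf F) (hc' : c ∈ listChainsOfLength E n)
    (hz : listBoundary E c = 0) :
    ∃ b ∈ listChainsOf F, b ∈ listChainsOfLength E (n + 1) ∧ listBoundary E b = c + A c := by
  have key := listBoundary_listHomotopy (fun l : List E => l.headD (Classical.arbitrary E))
    (θ := LinearMap.id + A) (by simp [hA]) (by simp [hnil, ListChain.add_self]) c
  rw [hz, map_zero, add_zero] at key
  refine ⟨_, map_mem_listChainsOf hF (fun s hs c hc => ?_) ?_ hc,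
    listHomotopy_mem_listChainsOfLength
      (fun l => Submodule.add_mem _ (single_mem_listChainsOfLength rfl) (hlen l)) hc', key⟩
  · refine listHomotopy_mem_listChainsIn (fun l hl0 hl => ?_)
      (fun l hl => Submodule.add_mem _ (single_mem_listChainsIn hl) (hin s hs l hl)) hc
    cases l with
    | nil => exact absurd rfl hl0
    | cons v l => exact hl v (by simp)
  · rw [listHomotopy_nil]
    exact Submodule.zero_mem _

include hF in
lemma exists_listBoundary_eq_add_chooseOrder_forgetOrder [Nonempty E] {n : ℕ} {c : ListChain E}
    (hc : c ∈ listChainsOf F) (hc' : c ∈ listChainsOfLength E n) (hz : listBoundary E c = 0) :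
    ∃ b ∈ listChainsOf F, b ∈ listChainsOfLength E (n + 1) ∧
      listBoundary E b = c + chooseOrder E (forgetOrder E c) := by
  classical
  refine exists_listBoundary_eq_add_of_carried hF (A := chooseOrder E ∘ₗ forgetOrder E)
    (by simp [listBoundary_chooseOrder, forgetOrder_listBoundary]) ?_ (fun l => ?_)
    (fun s _ l hl => ?_) hc hc' hz
  · have h1 : chooseOrder E (Finsupp.single ∅ 1) = Finsupp.single [] 1 :=
      coneRec_of_rank_eq_zero _ _ _ _ rfl
    simp [forgetOrder_single, h1]
  · rw [LinearMap.comp_apply, forgetOrder_single]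
    split_ifs with hn
    · exact chooseOrder_mem_listChainsOfLength
        (Finsupp.single_mem_supported _ _ (List.toFinset_card_of_nodup hn))
    · rw [map_zero]
      exact Submodule.zero_mem _
  · rw [LinearMap.comp_apply, forgetOrder_single]
    split_ifs with hn
    · refine Finsupp.supported_mono (fun l' hl' v hv => ?_) (chooseOrder_mem_listChainsIn (E := E))
      have := hl' v hv
      exact hl v (by simpa using this)
    · rw [map_zero]
      exact Submodule.zero_mem _

end ListChainsOf

/-! ### Comparison of simplicial and singular homology -/

section VertexList

variable {E : Type} [TopologicalSpace E]

/-- The operator that replaces a singular simplex by the list of the images of its vertices under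
the map `q`. -/
def vertexList (q : E → E) (n : ℕ) : SingularChain n E →ₗ[ZMod 2] ListChain E :=
  Finsupp.linearCombination (ZMod 2) fun σ =>
    Finsupp.single (List.ofFn fun i => q (σ (stdSimplex.vertex i))) 1

lemma vertexList_single (q : E → E) {n : ℕ} (σ : C(stdSimplex ℝ (Fin (n + 1)), E)) :
    vertexList q n (Finsupp.single σ 1) =
      Finsupp.single (List.ofFn fun i => q (σ (stdSimplex.vertex i))) 1 := by
  simp [vertexList]

lemma faceMap_vertex {n : ℕ} (i : Fin (n + 2)) (j : Fin (n + 1)) :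
    faceMap i (stdSimplex.vertex j) = stdSimplex.vertex (i.succAbove j) :=
  stdSimplex.map_vertex _ _

lemma listBoundary_vertexList (q : E → E) {n : ℕ} (c : SingularChain (n + 1) E) :
    listBoundary E (vertexList q (n + 1) c) = vertexList q n (singularBoundary n E c) := by
  suffices h : listBoundary E ∘ₗ vertexList q (n + 1) = vertexList q n ∘ₗ singularBoundary n E from
    congr($h c)
  ext1 σ
  ext1
  simp only [LinearMap.comp_apply, Finsupp.lsingle_apply, vertexList_single,
    singularBoundary_single, map_sum, listBoundary_single, listFaces_ofFn]
  refine Finset.sum_congr rfl fun i _ => ?_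
  congr 2
  funext j
  simp [← faceMap_vertex]

lemma vertexList_mem_listChainsOfLength (q : E → E) {n : ℕ} (c : SingularChain n E) :
    vertexList q n c ∈ listChainsOfLength E (n + 1) :=
  map_mem_of_supported _ (s := Set.univ) (fun σ _ => by
    rw [vertexList_single]
    exact single_mem_listChainsOfLength (by simp)) (by simp)

end VertexList

section Comparison

variable {E : Type} [NormedAddCommGroup E] [NormedSpace ℝ E]

/-- The affine singular simplices spanned by ordered simplices. -/
abbrev realize (n : ℕ) : ListChain E →ₗ[ZMod 2] SingularChain n E := push n id

lemma singularBoundary_realize (n : ℕ) (c : ListChain E) :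
    singularBoundary n E (realize (n + 1) c) = realize n (listBoundary E c) :=
  singularBoundary_push convex_univ continuousOn_id (D := Set.univ) (by simp [listChainsIn])

lemma realize_ofFn {n : ℕ} (u : Fin (n + 1) → E) :
    realize n (Finsupp.single (List.ofFn u) 1) =
      Finsupp.single ⟨affineSimplex u, continuous_affineSimplex u⟩ 1 :=
  (push_ofFn _ _).trans (chainOfFun_of_continuous (continuous_affineSimplex u))

lemma realize_mem_singularChainsIn (K : Geometry.SimplicialComplex ℝ E) {n : ℕ} {c : ListChain E}
    (hc : c ∈ listChainsOf K.faces) : realize n c ∈ singularChainsIn n K.space := by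
  classical
  refine push_mem (fun u hu hl => ?_) hc
  refine Finsupp.single_mem_supported _ _ fun x => ?_
  rcases hl with hl | hl
  · exact Geometry.SimplicialComplex.convexHull_subset_space hl
      (affineSimplex_mem (convex_convexHull ℝ _) (fun i => subset_convexHull ℝ _
        (by rw [Finset.mem_coe, List.mem_toFinset]; exact List.mem_ofFn.2 ⟨i, rfl⟩)) x)
  · simp at hl

lemma singularSubdivision_realize {n N : ℕ} {c : ListChain E}
    (hc : c ∈ listChainsOfLength E (n + 1)) :
    singularSubdivision n N (realize n c) = realize n (iterSubdivision E N c) := by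
  refine map_eq_of_supported (singularSubdivision n N ∘ₗ realize n)
    (realize n ∘ₗ iterSubdivision E N) (fun l hl => ?_) hc
  obtain ⟨u, rfl⟩ := exists_ofFn_eq hl
  rw [LinearMap.comp_apply, LinearMap.comp_apply, realize_ofFn, singularSubdivision,
    familyOperator_single]
  have h1 : listMap (Fintype.linearCombination ℝ u) (stdList n) =
      Finsupp.single (List.ofFn u) 1 := by
    rw [stdList, listMap_single, List.map_ofFn]
    congr 2
    funext i
    simp [Fintype.linearCombination_apply_single]
  rw [← h1, iterSubdivision_natural, push_listMap]
  exact push_congr (convex_stdSimplex ℝ _) (fun x hx => extendSimplex_of_mem _ hx)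
    (iterSubdivision_mem_listChainsIn (convex_stdSimplex ℝ _) N (stdList_mem_listChainsIn n))

lemma affineSimplex_vertex {n : ℕ} (u : Fin (n + 1) → E) (i : Fin (n + 1)) :
    affineSimplex u (stdSimplex.vertex i) = u i := by
  simp [affineSimplex, Pi.single_apply]

lemma vertexList_realize (q : E → E) {n : ℕ} {c : ListChain E}
    (hc : c ∈ listChainsOfLength E (n + 1)) : vertexList q n (realize n c) = listMap q c := by
  refine map_eq_of_supported (vertexList q n ∘ₗ realize n) (listMap q) (fun l hl => ?_) hc
  obtain ⟨u, rfl⟩ := exists_ofFn_eq hl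
  rw [LinearMap.comp_apply, realize_ofFn, vertexList_single, listMap_single, List.map_ofFn]
  congr 2
  funext i
  exact congrArg q (affineSimplex_vertex u i)

variable (K : Geometry.SimplicialComplex ℝ E)

/-- A lower bound for the largest barycentric coordinate of a point of `|K|`, which is at least the
reciprocal of the number of vertices; the summand `1` keeps it positive when there are none. -/
def coordBound : ℝ := ((K.vertices.ncard : ℝ) + 1)⁻¹

lemma coordBound_pos : 0 < coordBound K := by
  unfold coordBound
  positivity

variable {K}

lemma exists_coordBound_le (hK : K.faces.Finite) {x : E} (hx : x ∈ K.space) :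
    ∃ v, coordBound K ≤ baryCoord K v x := by
  obtain ⟨s, hs, hsx, hb⟩ := exists_carrier hx
  have hcard : s.card ≤ K.vertices.ncard := by
    rw [← Set.ncard_coe_finset]
    exact Set.ncard_le_ncard (fun v hv => mem_vertices_of_mem_face hs hv) (finite_vertices hK)
  have hle : ∑ _v ∈ s, coordBound K ≤ ∑ v ∈ s, baryCoord K v x := by
    rw [hb.sum_eq_one, Finset.sum_const, nsmul_eq_mul, coordBound, ← div_eq_mul_inv,
      div_le_one (by positivity)]
    have : (s.card : ℝ) ≤ K.vertices.ncard := by exact_mod_cast hcard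
    linarith
  obtain ⟨v, _, hv⟩ := Finset.exists_le_of_sum_le (K.nonempty_of_mem_faces hs) hle
  exact ⟨v, hv⟩

variable (K) in
open Classical in
/-- A vertex at which the barycentric coordinate of `x` is large. -/
def nearVertex (x : E) : E :=
  if h : ∃ v, coordBound K ≤ baryCoord K v x then h.choose else 0

lemma coordBound_le_nearVertex (hK : K.faces.Finite) {x : E} (hx : x ∈ K.space) :
    coordBound K ≤ baryCoord K (nearVertex K x) x := by
  rw [nearVertex, dif_pos (exists_coordBound_le hK hx)]
  exact (exists_coordBound_le hK hx).choose_spec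

variable (K) in
/-- Singular simplices in `|K|` on which all barycentric coordinates vary so little that, for any
two of their points, the near vertex of one is a vertex of the carrier of the other. -/
def smallSimplices (n : ℕ) : Set C(stdSimplex ℝ (Fin (n + 1)), E) :=
  {σ | (∀ x, σ x ∈ K.space) ∧
    ∀ v x y, |baryCoord K v (σ x) - baryCoord K v (σ y)| < coordBound K}

lemma nearVertex_mem_carrier (hK : K.faces.Finite) {n : ℕ}
    {σ : C(stdSimplex ℝ (Fin (n + 1)), E)} (hσ : σ ∈ smallSimplices K n)
    (x y : stdSimplex ℝ (Fin (n + 1))) : 0 < baryCoord K (nearVertex K (σ y)) (σ x) := by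
  have h1 := coordBound_le_nearVertex hK (hσ.1 y)
  have h2 := (abs_lt.1 (hσ.2 (nearVertex K (σ y)) x y)).1
  linarith

lemma vertexList_mem_listChainsOf (hK : K.faces.Finite) {n : ℕ} {c : SingularChain n E}
    (hc : c ∈ Finsupp.supported (ZMod 2) (ZMod 2) (smallSimplices K n)) :
    vertexList (nearVertex K) n c ∈ listChainsOf K.faces := by
  classical
  refine map_mem_of_supported _ (fun σ hσ => ?_) hc
  rw [vertexList_single]
  obtain ⟨s, hs, hsx, _⟩ := exists_carrier (hσ.1 (stdSimplex.vertex 0))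
  refine listChainsIn_le_listChainsOf (fun _ hs _ hts ht => K.down_closed hs hts ht) hs
    (single_mem_listChainsIn fun v hv => ?_)
  obtain ⟨i, rfl⟩ := List.mem_ofFn.1 hv
  exact (hsx _).2 (nearVertex_mem_carrier hK hσ _ _)

/-- Iterated subdivision makes a singular simplex of `|K|` small. -/
lemma eventually_push_mem_smallSimplices (hK : K.faces.Finite) {n : ℕ}
    {σ : C(stdSimplex ℝ (Fin (n + 1)), E)} (hσ : ∀ x, σ x ∈ K.space) :
    ∀ᶠ N in Filter.atTop, push n (extendSimplex σ) (iterSubdivision _ N (stdList n)) ∈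
      Finsupp.supported (ZMod 2) (ZMod 2) (smallSimplices K n) := by
  have hfin : Finite K.vertices := finite_vertices hK
  have : Fintype K.vertices := Fintype.ofFinite _
  have hcont : Continuous fun x => fun v : K.vertices => baryCoord K v (σ x) :=
    continuous_pi fun v => (continuousOn_baryCoord hK v).comp_continuous σ.continuous hσ
  have hunif := CompactSpace.uniformContinuous_of_continuous hcont
  obtain ⟨ε, hε, hδ⟩ := Metric.uniformContinuous_iff.1 hunif _ (coordBound_pos K)
  -- the standard simplex lies in the unit ball of the sup norm
  have hmesh : stdList n ∈ listChainsOfMesh (Fin (n + 1) → ℝ) 2 := by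
    refine Finsupp.supported_mono (fun l (hl : ∀ v ∈ l, v ∈ stdSimplex ℝ (Fin (n + 1))) v hv w hw =>
      ?_) (stdList_mem_listChainsIn n)
    have h1 := stdSimplex_subset_closedBall (hl v hv)
    have h2 := stdSimplex_subset_closedBall (hl w hw)
    rw [Metric.mem_closedBall] at h1 h2
    have := dist_triangle_right v w 0
    linarith
  filter_upwards [eventually_iterSubdivision_mem_listChainsOfMesh (by norm_num)
    (stdList_mem_listChainsOfLength n) hmesh (half_pos hε)] with N hN
  have hN' := iterSubdivision_mem_listChainsIn (convex_stdSimplex ℝ _) N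
    (stdList_mem_listChainsIn n)
  have h : iterSubdivision _ N (stdList n) ∈ Finsupp.supported (ZMod 2) (ZMod 2)
      ({l : List (Fin (n + 1) → ℝ) | ∀ v ∈ l, v ∈ stdSimplex ℝ (Fin (n + 1))} ∩
        {l | ∀ v ∈ l, ∀ w ∈ l, dist v w ≤ ε / 2}) := by
    rw [Finsupp.supported_inter]
    exact ⟨hN', hN⟩
  refine push_mem ?_ h
  rintro u hu ⟨hu1, hu2⟩
  refine Finsupp.single_mem_supported _ _ ?_
  have hmem : ∀ x, affineSimplex u x ∈ stdSimplex ℝ (Fin (n + 1)) :=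
    affineSimplex_mem (convex_stdSimplex ℝ _) (mem_of_ofFn_mem hu1)
  have hval : ∀ x, extendSimplex σ (affineSimplex u x) = σ ⟨_, hmem x⟩ := fun x =>
    extendSimplex_of_mem σ (hmem x)
  refine ⟨fun x => ?_, fun v x y => ?_⟩
  · change extendSimplex σ (affineSimplex u x) ∈ _
    rw [hval]
    exact hσ _
  · change |baryCoord K v (extendSimplex σ (affineSimplex u x)) -
      baryCoord K v (extendSimplex σ (affineSimplex u y))| < _
    rw [hval, hval]
    by_cases hv : v ∈ K.vertices
    · have hull : ∀ x, affineSimplex u x ∈ convexHull ℝ (Set.range u) :=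
        affineSimplex_mem (convex_convexHull ℝ _) (fun i => subset_convexHull ℝ _ ⟨i, rfl⟩)
      obtain ⟨_, ⟨i, rfl⟩, _, ⟨j, rfl⟩, hd⟩ := convexHull_exists_dist_ge2 (hull x) (hull y)
      have h3 : dist (u i) (u j) ≤ ε / 2 := hu2 _ (List.mem_ofFn.2 ⟨i, rfl⟩) _
        (List.mem_ofFn.2 ⟨j, rfl⟩)
      have h4 := hδ (a := ⟨_, hmem x⟩) (b := ⟨_, hmem y⟩)
        (lt_of_le_of_lt (hd.trans h3) (half_lt_self hε))
      have h5 := lt_of_le_of_lt (dist_le_pi_dist _ _ (⟨v, hv⟩ : K.vertices)) h4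
      rwa [Real.dist_eq] at h5
    · rw [baryCoord_eq_zero_of_notMem_vertices (hσ _) hv,
        baryCoord_eq_zero_of_notMem_vertices (hσ _) hv, sub_zero, abs_zero]
      exact coordBound_pos K

lemma exists_singularSubdivision_mem_smallSimplices (hK : K.faces.Finite) {n : ℕ}
    {c : SingularChain n E} (hc : c ∈ singularChainsIn n K.space) :
    ∃ N, singularSubdivision n N c ∈
      Finsupp.supported (ZMod 2) (ZMod 2) (smallSimplices K n) := by
  have h : ∀ᶠ N in Filter.atTop, ∀ σ ∈ c.support,
      push n (extendSimplex σ) (iterSubdivision _ N (stdList n)) ∈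
        Finsupp.supported (ZMod 2) (ZMod 2) (smallSimplices K n) := by
    rw [Filter.eventually_all_finset]
    exact fun σ hσ => eventually_push_mem_smallSimplices hK (hc hσ)
  obtain ⟨N, hN⟩ := h.exists
  refine ⟨N, map_mem_of_supported _ (s := c.support) (fun σ hσ => ?_)
    (Finsupp.mem_supported_support _ c)⟩
  rw [singularSubdivision, familyOperator_single]
  exact hN σ hσ

variable (K) in
/-- The straight-line homotopy from a singular simplex to the affine simplex spanned by the near
vertices of its vertices. -/
def straightLine {n : ℕ} (σ : C(stdSimplex ℝ (Fin (n + 1)), E)) (x : (Fin (n + 1) → ℝ) × ℝ) : E :=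
  (1 - x.2) • extendSimplex σ x.1 +
    x.2 • ∑ i, x.1 i • nearVertex K (σ (stdSimplex.vertex i))

/-- A small singular cycle is homologous in `|K|` to the realization of its vertex list. -/
lemma exists_singularBoundary_eq_add_realize (hK : K.faces.Finite) {n : ℕ}
    {c : SingularChain (n + 1) E}
    (hc : c ∈ Finsupp.supported (ZMod 2) (ZMod 2) (smallSimplices K (n + 1)))
    (hz : singularBoundary n E c = 0) :
    ∃ b ∈ singularChainsIn (n + 2) K.space, singularBoundary (n + 1) E b =
      c + realize (n + 1) (vertexList (nearVertex K) (n + 1) c) := by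
  have hcont : ∀ σ : C(stdSimplex ℝ (Fin (n + 2)), E), ContinuousOn (straightLine K σ)
      (stdSimplex ℝ (Fin (n + 2)) ×ˢ Set.Icc (0 : ℝ) 1) := by
    intro σ
    have h1 : ContinuousOn (fun x : (Fin (n + 2) → ℝ) × ℝ => extendSimplex σ x.1)
        (stdSimplex ℝ (Fin (n + 2)) ×ˢ Set.Icc (0 : ℝ) 1) :=
      (continuousOn_extendSimplex σ).comp continuousOn_fst fun x hx => hx.1
    unfold straightLine
    fun_prop
  obtain ⟨b, hb, hbc⟩ := exists_singularBoundary_eq_prismEnd (S := K.space)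
    (G := fun {k} σ => straightLine K σ) (T₀ := smallSimplices K (n + 1))
    (fun σ _ i x hx t _ => by
      have h1 := affineSimplex_faceMap (fun j => nearVertex K (σ (stdSimplex.vertex j))) i ⟨x, hx⟩
      simp only [straightLine, extendSimplex_faceMap σ i hx]
      congr 2
      refine Eq.trans ?_ h1.symm
      simp only [affineSimplex, ContinuousMap.comp_apply, faceMap_vertex]
      rfl)
    (fun σ _ => hcont σ)
    (fun σ hσ x hx => by
      obtain ⟨s, hs, hsx, hb⟩ := exists_carrier (hσ.1 ⟨x.1, hx.1⟩)
      refine Geometry.SimplicialComplex.convexHull_subset_space hs ?_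
      refine (convex_convexHull ℝ (s : Set E)) ?_ ?_ (sub_nonneg.2 hx.2.2) hx.2.1
        (sub_add_cancel _ _)
      · rw [extendSimplex_of_mem σ hx.1]
        exact hb.mem_convexHull
      · refine (convex_convexHull ℝ _).sum_mem (fun i _ => hx.1.1 i) hx.1.2 (fun i _ => ?_)
        exact subset_convexHull ℝ _ ((hsx _).2 (nearVertex_mem_carrier hK hσ _ _)))
    hc hz
  refine ⟨b, hb, hbc.trans ?_⟩
  congr 1
  · refine map_eq_of_supported (familyOperator (n + 1) (fun σ => straightLine K σ)
      (prismEnd (n + 1) 0)) LinearMap.id (fun σ _ => ?_) hc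
    rw [familyOperator_single, push_prismEnd (continuous_prismEnd (by simp) (hcont σ)),
      LinearMap.id_apply]
    congr 1
    ext x
    simp [straightLine, extendSimplex_coe]
  · refine map_eq_of_supported (familyOperator (n + 1) (fun σ => straightLine K σ)
      (prismEnd (n + 1) 1)) (realize (n + 1) ∘ₗ vertexList (nearVertex K) (n + 1))
      (fun σ _ => ?_) hc
    rw [familyOperator_single, push_prismEnd (continuous_prismEnd (by simp) (hcont σ)),
      LinearMap.comp_apply, vertexList_single, realize_ofFn]
    congr 1
    ext x
    simp [straightLine, affineSimplex]

/-- The affine singular chain of a simplicial chain. -/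
def simplicialToSingular (n : ℕ) : (Finset E →₀ ZMod 2) →ₗ[ZMod 2] SingularChain n E :=
  realize n ∘ₗ chooseOrder E

lemma singularBoundary_simplicialToSingular (n : ℕ) (c : Finset E →₀ ZMod 2) :
    singularBoundary n E (simplicialToSingular (n + 1) c) =
      simplicialToSingular n (finsetBoundary E c) := by
  rw [simplicialToSingular, LinearMap.comp_apply, singularBoundary_realize,
    listBoundary_chooseOrder]
  rfl

lemma simplicialToSingular_mem {n : ℕ} {c : Finset E →₀ ZMod 2} (hc : c ∈ chains n K.faces) :
    simplicialToSingular n c ∈ singularChainsIn n K.space :=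
  realize_mem_singularChainsIn K
    (chooseOrder_mem_listChainsOf (fun _ hs _ hts ht => K.down_closed hs hts ht) hc)

/-- Every singular cycle of `|K|` is homologous to a simplicial one. -/
theorem exists_simplicial_cycle (hK : K.faces.Finite) {n : ℕ} {z : SingularChain (n + 1) E}
    (hz : z ∈ singularCyclesIn n K.space) :
    ∃ y ∈ cycles (n + 1) K.faces, ∃ b ∈ singularChainsIn (n + 2) K.space,
      singularBoundary (n + 1) E b = z + simplicialToSingular (n + 1) y := by
  have hF : ∀ s ∈ K.faces, ∀ t ⊆ s, t.Nonempty → t ∈ K.faces :=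
    fun _ hs _ hts ht => K.down_closed hs hts ht
  have hz0 : singularBoundary n E z = 0 := hz.2
  -- subdivide, move along straight lines to near vertices, and normalize the order of the vertices
  obtain ⟨N, hN⟩ := exists_singularSubdivision_mem_smallSimplices hK hz.1
  obtain ⟨b₁, hb₁, h₁⟩ := exists_singularBoundary_eq_add_singularSubdivision N hz.1 hz0
  have hz' : singularBoundary n E (singularSubdivision (n + 1) N z) = 0 := by
    rw [singularBoundary_singularSubdivision, hz0, map_zero]
  obtain ⟨b₂, hb₂, h₂⟩ := exists_singularBoundary_eq_add_realize hK hN hz'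
  set u := vertexList (nearVertex K) (n + 1) (singularSubdivision (n + 1) N z) with hu
  have hu1 : u ∈ listChainsOf K.faces := vertexList_mem_listChainsOf hK hN
  have hu2 : u ∈ listChainsOfLength E (n + 2) := vertexList_mem_listChainsOfLength _ _
  have hu3 : listBoundary E u = 0 := by rw [hu, listBoundary_vertexList, hz', map_zero]
  obtain ⟨b₃, hb₃, _, h₃⟩ := exists_listBoundary_eq_add_chooseOrder_forgetOrder hF hu1 hu2 hu3
  have hy1 := forgetOrder_mem_chains hu1 hu2
  refine ⟨forgetOrder E u, ⟨hy1, ?_⟩, b₁ + b₂ + realize (n + 2) b₃,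
    Submodule.add_mem _ (Submodule.add_mem _ hb₁ hb₂) (realize_mem_singularChainsIn K hb₃), ?_⟩
  · change boundary E _ = 0
    rw [boundary_eq_finsetBoundary hy1, ← forgetOrder_listBoundary, hu3,
      map_zero]
  · rw [map_add, map_add, h₁, h₂, singularBoundary_realize, h₃, map_add]
    change _ = z + realize (n + 1) (chooseOrder E (forgetOrder E u))
    have e : ∀ a b c d : SingularChain (n + 1) E, a + b + (b + c) + (c + d) = a + d := by
      intro a b c d
      calc a + b + (b + c) + (c + d) = a + d + ((b + b) + (c + c)) := by abel
        _ = a + d := by rw [ListChain.add_self, ListChain.add_self, add_zero, add_zero]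
    exact e _ _ _ _

/-- A simplicial cycle that bounds a singular chain of `|K|` bounds a simplicial chain: the chain is
subdivided, and the vertices of the subdivision are sent to near vertices. On the boundary this is a
simplicial approximation of the identity, which carries each simplex into itself. -/
theorem mem_boundaries_of_singularBoundary_eq (hK : K.faces.Finite) {n : ℕ}
    {y : Finset E →₀ ZMod 2} (hy : y ∈ cycles (n + 1) K.faces) {c : SingularChain (n + 2) E}
    (hc : c ∈ singularChainsIn (n + 2) K.space)
    (hcy : singularBoundary (n + 1) E c = simplicialToSingular (n + 1) y) :
    y ∈ boundaries (n + 1) K.faces := by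
  classical
  have hF : ∀ s ∈ K.faces, ∀ t ⊆ s, t.Nonempty → t ∈ K.faces :=
    fun _ hs _ hts ht => K.down_closed hs hts ht
  obtain ⟨N, hN⟩ := exists_singularSubdivision_mem_smallSimplices hK hc
  have hlen := chooseOrder_mem_listChainsOfLength_of_mem_chains hy.1
  set u := chooseOrder E y with hu
  have hu0 : listBoundary E u = 0 := by
    rw [hu, listBoundary_chooseOrder, finsetBoundary_eq_zero_of_mem_cycles hy, map_zero]
  have hu1 : u ∈ listChainsOf K.faces := chooseOrder_mem_listChainsOf hF hy.1
  set e := vertexList (nearVertex K) (n + 2) (singularSubdivision (n + 2) N c) with he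
  have hbe : listBoundary E e = listMap (nearVertex K) (iterSubdivision E N u) := by
    rw [he, listBoundary_vertexList, singularBoundary_singularSubdivision, hcy]
    change vertexList _ _ (singularSubdivision _ _ (realize _ u)) = _
    rw [singularSubdivision_realize hlen,
      vertexList_realize _ (iterSubdivision_mem_listChainsOfLength N hlen)]
  -- a vertex where the coordinate of `x` is positive belongs to each simplex that contains `x`
  have hnear : ∀ s ∈ K.faces,
      Set.MapsTo (nearVertex K) (convexHull ℝ (s : Set E)) (s : Set E) := by
    intro s hs x hx
    have h1 := coordBound_le_nearVertex hK
      (Geometry.SimplicialComplex.convexHull_subset_space hs hx)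
    by_contra h2
    have h3 := (isBarycentric_baryCoord hs hx).eq_zero _ h2
    rw [h3] at h1
    exact absurd h1 (not_le.2 (coordBound_pos K))
  obtain ⟨b, hb1, hb2, hb3⟩ := exists_listBoundary_eq_add_of_carried hF
    (A := listMap (nearVertex K) ∘ₗ iterSubdivision E N)
    (by simp [listBoundary_listMap, listBoundary_iterSubdivision]) (by simp [iterSubdivision_nil])
    (fun l => listMap_mem_listChainsOfLength _
      (iterSubdivision_mem_listChainsOfLength N (single_mem_listChainsOfLength rfl)))
    (fun s hs l hl => listMap_mem_listChainsIn (hnear s hs)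
      (iterSubdivision_mem_listChainsIn (convex_convexHull ℝ _) N
        (single_mem_listChainsIn fun v hv => subset_convexHull ℝ _ (hl v hv)))) hu1 hlen hu0
  have hmem : forgetOrder E (b + e) ∈ chains (n + 2) K.faces :=
    forgetOrder_mem_chains (Submodule.add_mem _ hb1 (vertexList_mem_listChainsOf hK hN))
      (Submodule.add_mem _ hb2 (vertexList_mem_listChainsOfLength _ _))
  refine ⟨forgetOrder E (b + e), hmem, ?_⟩
  rw [boundary_eq_finsetBoundary hmem, ← forgetOrder_listBoundary, map_add, hb3, hbe,
    LinearMap.comp_apply, add_assoc, ListChain.add_self, add_zero, hu, forgetOrder_chooseOrder]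

end Comparison

/-! ### Deformation retracts and the comparison map -/

section Retraction

variable {E : Type} [NormedAddCommGroup E]

lemma singularChainsIn_mono {n : ℕ} {S T : Set E} (h : S ⊆ T) :
    singularChainsIn n S ≤ singularChainsIn n T :=
  Finsupp.supported_mono fun _ hσ x => h (hσ x)

/-- The action of the map `g` on singular chains in a set on which `g` is continuous; a simplex on
which `g` is not continuous is sent to `0`. -/
def pushForward (n : ℕ) (g : E → E) : SingularChain n E →ₗ[ZMod 2] SingularChain n E :=
  familyOperator n (fun σ => g ∘ extendSimplex σ) (stdList n)

variable {X A : Set E} {g : E → E}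

lemma singularBoundary_pushForward (hg : ContinuousOn g X) {n : ℕ} {c : SingularChain (n + 1) E}
    (hc : c ∈ singularChainsIn (n + 1) X) :
    singularBoundary n E (pushForward (n + 1) g c) = pushForward n g (singularBoundary n E c) := by
  rw [pushForward, singularBoundary_familyOperator (convex_stdSimplex ℝ _)
    (fun σ hσ => hg.comp (continuousOn_extendSimplex σ) fun x hx => by
      rw [extendSimplex_of_mem σ hx]
      exact hσ _) (stdList_mem_listChainsIn _) hc, pushForward,
    familyOperator_singularBoundary (G := fun σ => g ∘ extendSimplex σ)
      (G' := fun σ => g ∘ extendSimplex σ) (convex_stdSimplex ℝ _) faceLinearMap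
    (fun σ _ i x hx => congrArg g (extendSimplex_faceMap σ i hx)) (stdList_mem_listChainsIn _) hc,
    listBoundary_stdList]

lemma pushForward_mem (hg : Set.MapsTo g X A) {n : ℕ} {c : SingularChain n E}
    (hc : c ∈ singularChainsIn n X) : pushForward n g c ∈ singularChainsIn n A :=
  familyOperator_mem (convex_stdSimplex ℝ _) (fun σ hσ x hx => by
    rw [Function.comp_apply, extendSimplex_of_mem σ hx]
    exact hg (hσ _)) (stdList_mem_listChainsIn n) hc

lemma pushForward_eq_self (hg : ∀ x ∈ A, g x = x) {n : ℕ} {c : SingularChain n E}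
    (hc : c ∈ singularChainsIn n A) : pushForward n g c = c := by
  refine map_eq_of_supported (pushForward n g) LinearMap.id (fun σ hσ => ?_) hc
  rw [pushForward, familyOperator_single, LinearMap.id_apply, ← push_extendSimplex]
  refine push_congr (convex_stdSimplex ℝ _) (fun x hx => ?_) (stdList_mem_listChainsIn n)
  rw [Function.comp_apply, extendSimplex_of_mem σ hx]
  exact hg _ (hσ _)

/-- The homotopy of a singular simplex along a homotopy of the space it lies in. -/
def simplexHomotopy (R : ℝ × E → E) {k : ℕ} (σ : C(stdSimplex ℝ (Fin (k + 1)), E))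
    (q : (Fin (k + 1) → ℝ) × ℝ) : E :=
  R (q.2, extendSimplex σ q.1)

lemma continuousOn_simplexHomotopy {R : ℝ × E → E}
    (hR : ContinuousOn R (Set.Icc (0 : ℝ) 1 ×ˢ X)) {k : ℕ}
    {σ : C(stdSimplex ℝ (Fin (k + 1)), E)} (hσ : ∀ x, σ x ∈ X) :
    ContinuousOn (simplexHomotopy R σ)
      (stdSimplex ℝ (Fin (k + 1)) ×ˢ Set.Icc (0 : ℝ) 1) := by
  refine hR.comp (f := fun q : (Fin (k + 1) → ℝ) × ℝ => (q.2, extendSimplex σ q.1)) ?_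
    fun q hq => ⟨hq.2, ?_⟩
  · exact continuousOn_snd.prodMk
      ((continuousOn_extendSimplex σ).comp continuousOn_fst fun x hx => hx.1)
  · change extendSimplex σ q.1 ∈ X
    rw [extendSimplex_of_mem σ hq.1]
    exact hσ _

lemma familyOperator_prismEnd {R : ℝ × E → E}
    (hR : ContinuousOn R (Set.Icc (0 : ℝ) 1 ×ˢ X)) {s : ℝ} (hs : s ∈ Set.Icc (0 : ℝ) 1) {n : ℕ}
    {c : SingularChain n E} (hc : c ∈ singularChainsIn n X) :
    familyOperator n (simplexHomotopy R) (prismEnd n s) c =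
      pushForward n (fun x => R (s, x)) c := by
  refine map_eq_of_supported (familyOperator n (simplexHomotopy R) (prismEnd n s))
    (pushForward n fun x => R (s, x)) (fun σ hσ => ?_) hc
  have hc := continuous_prismEnd hs (continuousOn_simplexHomotopy hR hσ)
  rw [familyOperator_single, push_prismEnd hc, pushForward, familyOperator_single, stdList,
    push_ofFn, ← chainOfFun_of_continuous hc]
  congr 1
  funext x
  rw [affineSimplex_single]
  rfl

/-- A homotopy within `X` that starts at the identity moves each singular cycle within its homology
class. -/
lemma exists_singularBoundary_eq_add_pushForward {R : ℝ × E → E}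
    (hR : ContinuousOn R (Set.Icc (0 : ℝ) 1 ×ˢ X))
    (hX : Set.MapsTo R (Set.Icc (0 : ℝ) 1 ×ˢ X) X) (h0 : ∀ x ∈ X, R (0, x) = x) {n : ℕ}
    {z : SingularChain (n + 1) E} (hz : z ∈ singularChainsIn (n + 1) X)
    (hz0 : singularBoundary n E z = 0) :
    ∃ b ∈ singularChainsIn (n + 2) X,
      singularBoundary (n + 1) E b = z + pushForward (n + 1) (fun x => R (1, x)) z := by
  obtain ⟨b, hb, hbz⟩ := exists_singularBoundary_eq_prismEnd (S := X)
    (G := simplexHomotopy R) (T₀ := {σ | ∀ x, σ x ∈ X})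
    (fun σ _ i x hx t _ => congrArg (fun y => R (t, y)) (extendSimplex_faceMap σ i hx))
    (fun σ hσ => continuousOn_simplexHomotopy hR hσ)
    (fun σ hσ q hq => hX ⟨hq.2, by
      change extendSimplex σ q.1 ∈ X
      rw [extendSimplex_of_mem σ hq.1]
      exact hσ _⟩) hz hz0
  refine ⟨b, hb, hbz.trans ?_⟩
  rw [familyOperator_prismEnd hR (by simp) hz, familyOperator_prismEnd hR (by simp) hz,
    pushForward_eq_self h0 hz]

open Classical in
/-- A deformation retraction yields a retraction of sets that moves each singular cycle within its
homology class. -/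
lemma DeformationRetractsTo.exists_retraction [NormedSpace ℝ E] (h : DeformationRetractsTo X A) :
    ∃ r : E → E, ContinuousOn r X ∧ Set.MapsTo r X A ∧ (∀ x ∈ A, r x = x) ∧
      ∀ (n : ℕ) (z : SingularChain (n + 1) E), z ∈ singularChainsIn (n + 1) X →
        singularBoundary n E z = 0 → ∃ b ∈ singularChainsIn (n + 2) X,
          singularBoundary (n + 1) E b = z + pushForward (n + 1) r z := by
  obtain ⟨hAX, H, h0, h1, hA⟩ := h
  obtain ⟨R, hR⟩ : ∃ R : ℝ × E → E, ∀ t (ht : t ∈ Set.Icc (0 : ℝ) 1) x (hx : x ∈ X),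
      R (t, x) = H (⟨t, ht⟩, ⟨x, hx⟩) :=
    ⟨fun q => if h : q.1 ∈ Set.Icc (0 : ℝ) 1 ∧ q.2 ∈ X then H (⟨q.1, h.1⟩, ⟨q.2, h.2⟩) else q.2,
      fun t ht x hx => dif_pos ⟨ht, hx⟩⟩
  have hRc : ContinuousOn R (Set.Icc (0 : ℝ) 1 ×ˢ X) := by
    rw [continuousOn_iff_continuous_domRestrict]
    have : Continuous fun q : ↥(Set.Icc (0 : ℝ) 1 ×ˢ X) =>
        ((H (⟨q.1.1, q.2.1⟩, ⟨q.1.2, q.2.2⟩) : X) : E) := by fun_prop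
    exact this.congr fun q => (hR _ q.2.1 _ q.2.2).symm
  have h1mem : (1 : ℝ) ∈ Set.Icc (0 : ℝ) 1 := by simp
  have h0mem : (0 : ℝ) ∈ Set.Icc (0 : ℝ) 1 := by simp
  refine ⟨fun x => R (1, x), ?_, fun x hx => ?_, fun x hx => ?_, fun n z hz hz0 => ?_⟩
  · exact hRc.comp (f := fun x : E => ((1 : ℝ), x)) (by fun_prop) fun x hx => ⟨h1mem, hx⟩
  · change R (1, x) ∈ A
    rw [hR 1 h1mem x hx]
    exact h1 _
  · exact (hR 1 h1mem x (hAX hx)).trans (congrArg Subtype.val (hA _ ⟨x, hAX hx⟩ hx))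
  · refine exists_singularBoundary_eq_add_pushForward hRc ?_ (fun x hx => ?_) hz hz0
    · rintro ⟨t, x⟩ ⟨ht, hx⟩
      rw [hR t ht x hx]
      exact Subtype.property _
    · exact (hR 0 h0mem x hx).trans (congrArg Subtype.val (h0 _))

end Retraction

section ComparisonMap

variable {E : Type} [NormedAddCommGroup E] [NormedSpace ℝ E]
  (K : Geometry.SimplicialComplex ℝ E) {X : Set E}

/-- The affine singular cycle of a simplicial cycle of `K`, as a cycle in a set containing `|K|`. -/
def cycleComparison (n : ℕ) (hX : K.space ⊆ X) :
    cycles (n + 1) K.faces →ₗ[ZMod 2] singularCyclesIn n X :=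
  LinearMap.restrict (simplicialToSingular (n + 1)) fun y hy =>
    ⟨singularChainsIn_mono hX (simplicialToSingular_mem hy.1), by
      change singularBoundary n E _ = 0
      rw [singularBoundary_simplicialToSingular, finsetBoundary_eq_zero_of_mem_cycles hy,
        map_zero]⟩

/-- The map from the simplicial homology of `K` to the singular homology of a subspace that
contains `|K|`. -/
def homologyComparison (n : ℕ) (hX : K.space ⊆ X) :
    simplicialHomology (n + 1) K.faces →ₗ[ZMod 2] singularHomology (n + 1) X :=
  Submodule.liftQ (boundariesInCycles (n + 1) K.faces)
    (singularClass n X ∘ₗ cycleComparison K n hX) (by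
      rintro ⟨y, hy⟩ ⟨c, hc, hcy : boundary E c = y⟩
      rw [LinearMap.mem_ker, LinearMap.comp_apply, singularClass_eq_zero_iff]
      refine ⟨simplicialToSingular (n + 2) c,
        singularChainsIn_mono hX (simplicialToSingular_mem hc), ?_⟩
      rw [singularBoundary_simplicialToSingular, ← boundary_eq_finsetBoundary hc, hcy]
      rfl)

/-- The retraction pulls singular chains of `X` back to `|K|`, where singular and simplicial
homology agree. -/
lemma homologyComparison_bijective (hK : K.faces.Finite) (n : ℕ)
    (h : DeformationRetractsTo X K.space) :
    Function.Bijective (homologyComparison K n h.1) := by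
  obtain ⟨r, hrc, hrm, hrf, hr⟩ := h.exists_retraction
  constructor
  · refine (injective_iff_map_eq_zero (homologyComparison K n h.1)).2 fun ξ hξ => ?_
    obtain ⟨⟨y, hy⟩, rfl⟩ := Submodule.Quotient.mk_surjective _ ξ
    obtain ⟨c, hc, hcy⟩ := (singularClass_eq_zero_iff _ _ _).1 hξ
    refine (Submodule.Quotient.mk_eq_zero _).2 ?_
    refine mem_boundaries_of_singularBoundary_eq hK hy (pushForward_mem hrm hc) ?_
    rw [singularBoundary_pushForward hrc hc, hcy]
    exact pushForward_eq_self hrf (simplicialToSingular_mem hy.1)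
  · intro ξ
    obtain ⟨z, rfl⟩ := singularClass_surjective n X ξ
    obtain ⟨b, hb, hbz⟩ := hr n z z.2.1 z.2.2
    have hz0 : singularBoundary n E z = 0 := z.2.2
    have hrz : pushForward (n + 1) r z ∈ singularCyclesIn n K.space := by
      refine ⟨pushForward_mem hrm z.2.1, ?_⟩
      change singularBoundary n E _ = 0
      rw [singularBoundary_pushForward hrc z.2.1, hz0, map_zero]
    obtain ⟨y, hy, b', hb', hby⟩ := exists_simplicial_cycle hK hrz
    refine ⟨Submodule.Quotient.mk ⟨y, hy⟩, ?_⟩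
    change singularClass n X (cycleComparison K n h.1 ⟨y, hy⟩) = singularClass n X z
    rw [← sub_eq_zero, ← map_sub, singularClass_eq_zero_iff]
    refine ⟨b + b', Submodule.add_mem _ hb
      (singularChainsIn_mono h.1 hb'), ?_⟩
    rw [map_add, hbz, hby]
    change _ = simplicialToSingular (n + 1) y - (z : SingularChain (n + 1) E)
    have e : ∀ a b c : SingularChain (n + 1) E, a + b + (b + c) = c - a := by
      intro a b c
      rw [ZModModule.sub_eq_add]
      calc a + b + (b + c) = c + a + (b + b) := by abel
        _ = c + a := by rw [ListChain.add_self, add_zero]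
    exact e _ _ _

/-- Simplicial homology of `K` as the singular homology of a space that deformation retracts onto
`|K|`. -/
def homologyComparisonIso (hK : K.faces.Finite) (n : ℕ) (h : DeformationRetractsTo X K.space) :
    simplicialHomology (n + 1) K.faces ≅ singularHomology (n + 1) X :=
  LinearEquiv.toModuleIso
    (LinearEquiv.ofBijective _ (homologyComparison_bijective K hK n h))

lemma homologyComparisonIso_naturality {K L : Geometry.SimplicialComplex ℝ E} {X Y : Set E}
    (hK : K.faces.Finite) (hL : L.faces.Finite) (n : ℕ) (hX : DeformationRetractsTo X K.space)
    (hY : DeformationRetractsTo Y L.space) (hKL : K.faces ⊆ L.faces) (hXY : X ⊆ Y) :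
    simplicialHomologyMap (n + 1) hKL ≫ (homologyComparisonIso L hL n hY).hom =
      (homologyComparisonIso K hK n hX).hom ≫ singularHomologyMap (n + 1) hXY := by
  ext ξ
  obtain ⟨y, rfl⟩ := Submodule.Quotient.mk_surjective _ ξ
  exact (singularHomologyMap_singularClass n hXY _ _ rfl).symm

end ComparisonMap

/-! ### Projection to the full subcomplex on a set of vertices -/

section Projection

variable {E : Type} [NormedAddCommGroup E] [NormedSpace ℝ E]
  {K : Geometry.SimplicialComplex ℝ E} {f : E → ℝ}

lemma IsPL.apply_eq (hf : IsPL K f) {s : Finset E} (hs : s ∈ K.faces) {w : E → ℝ} {x : E}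
    (h : IsBarycentric s w x) : f x = ∑ v ∈ s, w v * f v := by
  have := hf s hs w (fun v _ => h.nonneg v) h.sum_eq_one
  rwa [h.sum_smul] at this

lemma IsBarycentric.lineMap {s : Finset E} {w w' : E → ℝ} {x y : E} (h : IsBarycentric s w x)
    (h' : IsBarycentric s w' y) {t : ℝ} (ht : t ∈ Set.Icc (0 : ℝ) 1) :
    IsBarycentric s (fun v => (1 - t) * w v + t * w' v) (AffineMap.lineMap x y t) where
  nonneg v := add_nonneg (mul_nonneg (sub_nonneg.2 ht.2) (h.nonneg v))
    (mul_nonneg ht.1 (h'.nonneg v))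
  eq_zero v hv := by rw [h.eq_zero v hv, h'.eq_zero v hv, mul_zero, mul_zero, add_zero]
  sum_eq_one := by
    rw [Finset.sum_add_distrib, ← Finset.mul_sum, ← Finset.mul_sum, h.sum_eq_one, h'.sum_eq_one]
    ring
  sum_smul := by
    simp only [add_smul, mul_smul]
    rw [Finset.sum_add_distrib, ← Finset.smul_sum, ← Finset.smul_sum, h.sum_smul, h'.sum_smul,
      AffineMap.lineMap_apply_module]

lemma IsPL.apply_lineMap (hf : IsPL K f) {s : Finset E} (hs : s ∈ K.faces) {x y : E}
    (hx : x ∈ convexHull ℝ (s : Set E)) (hy : y ∈ convexHull ℝ (s : Set E)) {t : ℝ}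
    (ht : t ∈ Set.Icc (0 : ℝ) 1) :
    f (AffineMap.lineMap x y t) = (1 - t) * f x + t * f y := by
  have hx := isBarycentric_baryCoord hs hx
  have hy := isBarycentric_baryCoord hs hy
  rw [hf.apply_eq hs (hx.lineMap hy ht), hf.apply_eq hs hx, hf.apply_eq hs hy, Finset.mul_sum,
    Finset.mul_sum, ← Finset.sum_add_distrib]
  exact Finset.sum_congr rfl fun v _ => by ring

lemma baryCoord_lineMap {s : Finset E} (hs : s ∈ K.faces) {x y : E}
    (hx : x ∈ convexHull ℝ (s : Set E)) (hy : y ∈ convexHull ℝ (s : Set E)) {t : ℝ}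
    (ht : t ∈ Set.Icc (0 : ℝ) 1) (v : E) :
    baryCoord K v (AffineMap.lineMap x y t) =
      (1 - t) * baryCoord K v x + t * baryCoord K v y :=
  baryCoord_eq hs ((isBarycentric_baryCoord hs hx).lineMap (isBarycentric_baryCoord hs hy) ht) v

lemma IsPL.continuousOn (hf : IsPL K f) (hK : K.faces.Finite) : ContinuousOn f K.space := by
  have h : ContinuousOn (fun x => ∑ v ∈ (finite_vertices hK).toFinset, baryCoord K v x * f v)
      K.space :=
    continuousOn_finsetSum _ fun v _ => (continuousOn_baryCoord hK v).mul continuousOn_const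
  refine h.congr fun x hx => ?_
  obtain ⟨s, hs, _, hb⟩ := exists_carrier hx
  rw [hf.apply_eq hs hb]
  exact Finset.sum_subset
    (fun v hv => (finite_vertices hK).mem_toFinset.2 (mem_vertices_of_mem_face hs hv))
    fun v _ hv => by rw [hb.eq_zero v hv, zero_mul]

lemma IsPL.exists_vertex_le (hf : IsPL K f) {x : E} (hx : x ∈ K.space) :
    ∃ v ∈ K.vertices, 0 < baryCoord K v x ∧ f v ≤ f x := by
  obtain ⟨s, hs, hcar, hb⟩ := exists_carrier hx
  have hsum : ∑ v ∈ s, baryCoord K v x * f v = ∑ v ∈ s, baryCoord K v x * f x := by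
    rw [← hf.apply_eq hs hb, ← Finset.sum_mul, hb.sum_eq_one, one_mul]
  obtain ⟨v, hv, hle⟩ := Finset.exists_le_of_sum_le (K.nonempty_of_mem_faces hs) hsum.le
  have hpos := (hcar v).1 hv
  exact ⟨v, mem_vertices_of_mem_face hs hv, hpos, le_of_mul_le_mul_left hle hpos⟩

lemma IsPL.exists_le_vertex (hf : IsPL K f) {x : E} (hx : x ∈ K.space) :
    ∃ v ∈ K.vertices, 0 < baryCoord K v x ∧ f x ≤ f v := by
  obtain ⟨s, hs, hcar, hb⟩ := exists_carrier hx
  have hsum : ∑ v ∈ s, baryCoord K v x * f v = ∑ v ∈ s, baryCoord K v x * f x := by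
    rw [← hf.apply_eq hs hb, ← Finset.sum_mul, hb.sum_eq_one, one_mul]
  obtain ⟨v, hv, hle⟩ := Finset.exists_le_of_sum_le (K.nonempty_of_mem_faces hs) hsum.ge
  have hpos := (hcar v).1 hv
  exact ⟨v, mem_vertices_of_mem_face hs hv, hpos, le_of_mul_le_mul_left hle hpos⟩

variable (K) in
/-- The part of the total weight `1` of the point `x` that its barycentric coordinates give to the
vertices in `V`. -/
def vertexWeight (V : Finset E) (x : E) : ℝ :=
  ∑ v ∈ V, baryCoord K v x

variable (K) in
/-- The projection to the full subcomplex on the vertices in `V`: the other barycentric coordinates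
are dropped, and the remaining ones are scaled so that their sum is `1` again. It is meaningful
where the weight of `V` is not `0`. -/
def vertexProjection (V : Finset E) (x : E) : E :=
  (vertexWeight K V x)⁻¹ • ∑ v ∈ V, baryCoord K v x • v

lemma continuousOn_vertexWeight (hK : K.faces.Finite) (V : Finset E) :
    ContinuousOn (vertexWeight K V) K.space :=
  continuousOn_finsetSum _ fun v _ => continuousOn_baryCoord hK v

lemma continuousOn_vertexProjection (hK : K.faces.Finite) (V : Finset E) {X : Set E}
    (hX : X ⊆ K.space) (h : ∀ x ∈ X, vertexWeight K V x ≠ 0) :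
    ContinuousOn (vertexProjection K V) X :=
  (((continuousOn_vertexWeight hK V).mono hX).inv₀ h).smul
    (continuousOn_finsetSum _ fun v _ =>
      ((continuousOn_baryCoord hK v).mono hX).smul continuousOn_const)

lemma vertexWeight_nonneg (V : Finset E) {x : E} (hx : x ∈ K.space) : 0 ≤ vertexWeight K V x :=
  Finset.sum_nonneg fun v _ => baryCoord_nonneg hx v

lemma vertexWeight_pos {V : Finset E} {x : E} (hx : x ∈ K.space) {v : E} (hv : v ∈ V)
    (h : 0 < baryCoord K v x) : 0 < vertexWeight K V x :=
  Finset.sum_pos' (fun v _ => baryCoord_nonneg hx v) ⟨v, hv, h⟩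

open Classical in
lemma isBarycentric_vertexProjection {V s : Finset E} (hs : s ∈ K.faces) {x : E}
    (hx : x ∈ convexHull ℝ (s : Set E)) (h : vertexWeight K V x ≠ 0) :
    IsBarycentric (s.filter (· ∈ V))
      (fun v => if v ∈ V then (vertexWeight K V x)⁻¹ * baryCoord K v x else 0)
      (vertexProjection K V x) := by
  have hb := isBarycentric_baryCoord hs hx
  have hxK : x ∈ K.space := Geometry.SimplicialComplex.mem_space_iff.2 ⟨s, hs, hx⟩
  have hsub : s.filter (· ∈ V) ⊆ V := fun v hv => (Finset.mem_filter.1 hv).2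
  have hzero : ∀ v ∈ V, v ∉ s.filter (· ∈ V) → baryCoord K v x = 0 := fun v hv hvs =>
    hb.eq_zero v fun h => hvs (Finset.mem_filter.2 ⟨h, hv⟩)
  refine ⟨fun v => ?_, fun v hv => ?_, ?_, ?_⟩
  · split_ifs
    · exact mul_nonneg (inv_nonneg.2 (vertexWeight_nonneg V hxK)) (hb.nonneg v)
    · exact le_rfl
  · by_cases hvV : v ∈ V
    · rw [if_pos hvV, hzero v hvV hv, mul_zero]
    · exact if_neg hvV
  · rw [Finset.sum_congr rfl fun v hv => if_pos (hsub hv),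
      Finset.sum_subset hsub fun v hv hvs => by rw [hzero v hv hvs, mul_zero], ← Finset.mul_sum]
    exact inv_mul_cancel₀ h
  · rw [Finset.sum_congr rfl fun v hv => by rw [if_pos (hsub hv)],
      Finset.sum_subset hsub fun v hv hvs => by rw [hzero v hv hvs, mul_zero, zero_smul],
      vertexProjection, Finset.smul_sum]
    exact Finset.sum_congr rfl fun v _ => mul_smul _ _ _

open Classical in
lemma baryCoord_vertexProjection {V : Finset E} {x : E} (hx : x ∈ K.space)
    (h : vertexWeight K V x ≠ 0) (v : E) :
    baryCoord K v (vertexProjection K V x) =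
      if v ∈ V then (vertexWeight K V x)⁻¹ * baryCoord K v x else 0 := by
  obtain ⟨s, hs, hxs⟩ := Geometry.SimplicialComplex.mem_space_iff.1 hx
  exact baryCoord_eq hs
    ((isBarycentric_vertexProjection hs hxs h).mono (Finset.filter_subset _ _)) v

lemma vertexProjection_mem_convexHull {V s : Finset E} (hs : s ∈ K.faces) {x : E}
    (hx : x ∈ convexHull ℝ (s : Set E)) (h : vertexWeight K V x ≠ 0) :
    vertexProjection K V x ∈ convexHull ℝ (s : Set E) := by
  classical
  exact ((isBarycentric_vertexProjection hs hx h).mono (Finset.filter_subset _ _)).mem_convexHull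

/-- The value of a PL function at a projected point is an average of its values on `V`. -/
lemma IsPL.apply_vertexProjection_mem (hf : IsPL K f) {V : Finset E} {I : Set ℝ}
    (hI : Convex ℝ I) (hV : ∀ v ∈ V, f v ∈ I) {x : E} (hx : x ∈ K.space)
    (h : vertexWeight K V x ≠ 0) : f (vertexProjection K V x) ∈ I := by
  classical
  obtain ⟨s, hs, hxs⟩ := Geometry.SimplicialComplex.mem_space_iff.1 hx
  have hb := isBarycentric_vertexProjection hs hxs h
  rw [hf.apply_eq hs (hb.mono (Finset.filter_subset _ _)), ← Finset.sum_subset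
    (Finset.filter_subset (· ∈ V) s) fun v _ hv => by rw [hb.eq_zero v hv, zero_mul]]
  exact hI.sum_mem (fun v _ => hb.nonneg v) hb.sum_eq_one
    fun v hv => hV v (Finset.mem_filter.1 hv).2

lemma vertexProjection_eq_self {V s : Finset E} (hs : s ∈ K.faces) (hsV : s ⊆ V) {x : E}
    (hx : x ∈ convexHull ℝ (s : Set E)) : vertexProjection K V x = x := by
  have hb := (isBarycentric_baryCoord hs hx).mono hsV
  rw [vertexProjection, hb.sum_smul, vertexWeight, hb.sum_eq_one, inv_one, one_smul]

end Projection

/-! ### The deformation retraction -/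

section Deformation

variable {E : Type} [NormedAddCommGroup E] [NormedSpace ℝ E]
  {K : Geometry.SimplicialComplex ℝ E} {f : E → ℝ}

lemma convex_openInterval (a b : EReal) : Convex ℝ (openInterval a b) := by
  refine Set.OrdConnected.convex ⟨fun x hx y hy z hz => ⟨hx.1.trans_le ?_, lt_of_le_of_lt ?_ hy.2⟩⟩
  · exact EReal.coe_le_coe_iff.2 hz.1
  · exact EReal.coe_le_coe_iff.2 hz.2

lemma IsPL.openSubcomplex_space_subset (hf : IsPL K f) (a b : EReal) :
    (openSubcomplex K f a b).space ⊆ openPreimage K f a b := by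
  intro x hx
  obtain ⟨s, hs, hxs⟩ := Geometry.SimplicialComplex.mem_space_iff.1 hx
  refine ⟨Geometry.SimplicialComplex.mem_space_iff.2 ⟨s, hs.1, hxs⟩, ?_⟩
  have hb := isBarycentric_baryCoord hs.1 hxs
  rw [hf.apply_eq hs.1 hb]
  exact (convex_openInterval a b).sum_mem (fun v _ => hb.nonneg v) hb.sum_eq_one hs.2

/-- If no simplex that meets `f⁻¹(a, b)` has both a vertex with value at most `a` and a vertex with
value at least `b`, then each point of `f⁻¹(a, b)` has a vertex of its carrier in `f⁻¹(a, b)`, and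
it is pushed along a straight line to the face spanned by these vertices. -/
lemma IsPL.deformationRetractsTo (hf : IsPL K f) (hK : K.faces.Finite) {a b : EReal}
    (h : ∀ s ∈ K.faces, (∃ x ∈ convexHull ℝ (s : Set E), f x ∈ openInterval a b) →
      (∀ v ∈ s, a < (f v : EReal)) ∨ ∀ v ∈ s, (f v : EReal) < b) :
    DeformationRetractsTo (openPreimage K f a b) (openSubcomplex K f a b).space := by
  classical
  set X := openPreimage K f a b with hX
  have hXK : X ⊆ K.space := fun x hx => hx.1
  let V : Finset E := (finite_vertices hK).toFinset.filter (fun v => f v ∈ openInterval a b)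
  have hV : ∀ v, v ∈ V ↔ v ∈ K.vertices ∧ f v ∈ openInterval a b := fun v => by simp [V]
  -- a vertex of the carrier with value at most, or at least, `f x` lies in the interval
  have hpos : ∀ x ∈ X, vertexWeight K V x ≠ 0 := by
    intro x hx
    obtain ⟨s, hs, hcar, hb⟩ := exists_carrier hx.1
    suffices ∃ v ∈ s, f v ∈ openInterval a b by
      obtain ⟨v, hv, hvI⟩ := this
      exact (vertexWeight_pos hx.1 ((hV v).2 ⟨mem_vertices_of_mem_face hs hv, hvI⟩)
        ((hcar v).1 hv)).ne'
    rcases h s hs ⟨x, hb.mem_convexHull, hx.2⟩ with hlow | hhigh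
    · obtain ⟨v, -, hv, hvx⟩ := hf.exists_vertex_le hx.1
      replace hv := (hcar v).2 hv
      exact ⟨v, hv, hlow v hv, (EReal.coe_le_coe_iff.2 hvx).trans_lt hx.2.2⟩
    · obtain ⟨v, -, hv, hvx⟩ := hf.exists_le_vertex hx.1
      replace hv := (hcar v).2 hv
      exact ⟨v, hv, hx.2.1.trans_le (EReal.coe_le_coe_iff.2 hvx), hhigh v hv⟩
  have hgc := continuousOn_vertexProjection hK V hXK hpos
  have hmem : ∀ t ∈ Set.Icc (0 : ℝ) 1, ∀ x ∈ X,
      AffineMap.lineMap x (vertexProjection K V x) t ∈ X := by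
    intro t ht x hx
    obtain ⟨s, hs, hxs⟩ := Geometry.SimplicialComplex.mem_space_iff.1 hx.1
    have hgs := vertexProjection_mem_convexHull hs hxs (hpos x hx)
    refine ⟨Geometry.SimplicialComplex.mem_space_iff.2
      ⟨s, hs, (convex_convexHull ℝ _).lineMap_mem hxs hgs ht⟩, ?_⟩
    rw [hf.apply_lineMap hs hxs hgs ht]
    exact convex_openInterval a b hx.2
      (hf.apply_vertexProjection_mem (convex_openInterval a b) (fun v hv => ((hV v).1 hv).2) hx.1
        (hpos x hx)) (sub_nonneg.2 ht.2) ht.1 (by ring)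
  have hcont : Continuous fun q : unitInterval × X =>
      AffineMap.lineMap (q.2 : E) (vertexProjection K V q.2) (q.1 : ℝ) := by
    simp only [AffineMap.lineMap_apply_module]
    have := continuousOn_iff_continuous_domRestrict.1 hgc
    have hg : Continuous fun q : unitInterval × X => vertexProjection K V q.2 :=
      this.comp continuous_snd
    fun_prop
  refine ⟨hf.openSubcomplex_space_subset a b,
    ⟨fun q => ⟨_, hmem q.1 q.1.2 q.2 q.2.2⟩, hcont.subtype_mk _⟩, fun x => ?_, fun x => ?_,
    fun t x hx => ?_⟩
  · exact Subtype.ext (AffineMap.lineMap_apply_zero _ _)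
  · change AffineMap.lineMap (x : E) (vertexProjection K V x) (1 : ℝ) ∈ _
    rw [AffineMap.lineMap_apply_one]
    obtain ⟨s, hs, hxs⟩ := Geometry.SimplicialComplex.mem_space_iff.1 x.2.1
    have hb := isBarycentric_vertexProjection hs hxs (hpos x x.2)
    refine Geometry.SimplicialComplex.mem_space_iff.2
      ⟨_, ⟨K.down_closed hs (Finset.filter_subset (· ∈ V) s) ?_,
        fun v hv => ((hV v).1 (Finset.mem_filter.1 hv).2).2⟩, hb.mem_convexHull⟩
    exact Finset.nonempty_of_sum_ne_zero (hb.sum_eq_one.trans_ne one_ne_zero)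
  · refine Subtype.ext ?_
    change AffineMap.lineMap (x : E) (vertexProjection K V x) (t : ℝ) = x
    obtain ⟨s, hs, hxs⟩ := Geometry.SimplicialComplex.mem_space_iff.1 hx
    rw [vertexProjection_eq_self hs.1
      (fun v hv => (hV v).2 ⟨mem_vertices_of_mem_face hs.1 hv, hs.2 v hv⟩) hxs,
      AffineMap.lineMap_same_apply]

/-- Since `f` takes at most one `p`-th critical value on each simplex, no simplex reaches across a
whole interval between two of them. -/
lemma IsCompatible.deformationRetractsTo {p : ℕ} (hcomp : IsCompatible p K f) (hf : IsPL K f)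
    (hK : K.faces.Finite) {m : ℕ} {α : Fin (m + 2) ↪o EReal}
    (hα : IsHomologicallyCriticalList p K f α) {i j : Fin (m + 2)} (hij : i < j) :
    DeformationRetractsTo (openPreimage K f (α i) (α j))
      (openSubcomplex K f (α i) (α j)).space := by
  have hcrit : ∀ k, α k ≠ ⊥ → α k ≠ ⊤ →
      ∃ c ∈ homologicallyCriticalValues p K f, (c : EReal) = α k := by
    intro k hbot htop
    have : α k ∈ Set.range α := ⟨k, rfl⟩
    rw [hα] at this
    exact (this.resolve_left hbot).resolve_left htop
  refine hf.deformationRetractsTo hK fun s hs ⟨x, hx, hxI⟩ => ?_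
  by_contra! hcon
  obtain ⟨⟨v, hv, hva⟩, u, hu, hub⟩ := hcon
  obtain ⟨a, ha, haα⟩ := hcrit i (fun h => by simp [h] at hva)
    (fun h => by simpa [h] using hxI.1)
  obtain ⟨b, hb, hbα⟩ := hcrit j (fun h => by simpa [h] using hxI.2)
    (fun h => by simp [h] at hub)
  have hab : a < b := EReal.coe_lt_coe_iff.1 (by rw [haα, hbα]; exact α.strictMono hij)
  rw [← haα, EReal.coe_le_coe_iff] at hva
  rw [← hbα, EReal.coe_le_coe_iff] at hub
  have hvs : v ∈ convexHull ℝ (s : Set E) := subset_convexHull ℝ _ hv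
  have hus : u ∈ convexHull ℝ (s : Set E) := subset_convexHull ℝ _ hu
  -- the segment from `v` to `u` attains both end points of the interval
  have hval : ∀ c ∈ Set.Icc (f v) (f u), c ∈ f '' convexHull ℝ (s : Set E) := by
    intro c hc
    have hpos : 0 < f u - f v := by linarith
    have ht : (c - f v) / (f u - f v) ∈ Set.Icc (0 : ℝ) 1 :=
      ⟨div_nonneg (sub_nonneg.2 hc.1) hpos.le,
        (div_le_one hpos).2 (sub_le_sub_right hc.2 _)⟩
    refine ⟨_, (convex_convexHull ℝ _).lineMap_mem hvs hus ht, ?_⟩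
    rw [hf.apply_lineMap hs hvs hus ht]
    field_simp
    ring
  exact hab.ne (hcomp s hs ⟨hval a ⟨hva, hab.le.trans hub⟩, ha⟩
    ⟨hval b ⟨hva.trans hab.le, hub⟩, hb⟩)

end Deformation

/-! ### Critical values are vertex values -/

section Finiteness

variable {E : Type} [NormedAddCommGroup E] [NormedSpace ℝ E]
  {K : Geometry.SimplicialComplex ℝ E} {f : E → ℝ}

lemma vertexProjection_congr {V : Finset E} {x y : E} {k : ℝ} (hk : k ≠ 0)
    (h : ∀ v ∈ V, baryCoord K v y = k * baryCoord K v x) :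
    vertexProjection K V y = vertexProjection K V x := by
  have h1 : vertexWeight K V y = k * vertexWeight K V x := by
    rw [vertexWeight, vertexWeight, Finset.mul_sum]
    exact Finset.sum_congr rfl h
  have h2 : ∑ v ∈ V, baryCoord K v y • v = k • ∑ v ∈ V, baryCoord K v x • v := by
    rw [Finset.smul_sum]
    exact Finset.sum_congr rfl fun v hv => by rw [h v hv, mul_smul]
  rw [vertexProjection, vertexProjection, h1, h2, smul_smul, mul_inv, mul_right_comm,
    inv_mul_cancel₀ hk, one_mul]

/-- Above an interval without vertex values, each point `x` lies on a segment from a point with a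
lower value to a point with a higher value, namely its projections to the lower and the upper
vertices. Sliding along these segments trivializes `f`: `S x t` is the point with value `t` on the
segment of `x`. -/
lemma IsPL.exists_slide (hf : IsPL K f) (hK : K.faces.Finite) {a b : ℝ}
    (hab : ∀ v ∈ K.vertices, f v ∉ Set.Icc a b) :
    ∃ S : E × ℝ → E,
      ContinuousOn S (levelPreimage K f (Set.Icc a b) ×ˢ Set.Icc a b) ∧
      ∀ x ∈ levelPreimage K f (Set.Icc a b), S (x, f x) = x ∧ ∀ t ∈ Set.Icc a b,
        S (x, t) ∈ K.space ∧ f (S (x, t)) = t ∧ ∀ u, S (S (x, t), u) = S (x, u) := by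
  classical
  set X := levelPreimage K f (Set.Icc a b) with hX
  have hXK : X ⊆ K.space := fun x hx => hx.1
  let L : Finset E := (finite_vertices hK).toFinset.filter (fun v => f v < a)
  let U : Finset E := (finite_vertices hK).toFinset.filter (fun v => b < f v)
  have hL : ∀ v, v ∈ L ↔ v ∈ K.vertices ∧ f v < a := fun v => by simp [L]
  have hU : ∀ v, v ∈ U ↔ v ∈ K.vertices ∧ b < f v := fun v => by simp [U]
  have hdisj : ∀ {x}, x ∈ X → ∀ v ∈ L, v ∉ U := fun {x} hx v hv hvU =>
    absurd (hx.2.1.trans hx.2.2) (((hU v).1 hvU).2.trans ((hL v).1 hv).2).not_ge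
  have hcover : ∀ v ∈ K.vertices, v ∈ L ∨ v ∈ U := fun v hv => by
    by_contra! hcon
    exact hab v hv ⟨not_lt.1 fun h => hcon.1 ((hL v).2 ⟨hv, h⟩),
      not_lt.1 fun h => hcon.2 ((hU v).2 ⟨hv, h⟩)⟩
  have hLpos : ∀ x ∈ X, vertexWeight K L x ≠ 0 := by
    intro x hx
    obtain ⟨v, hv, hpos, hvx⟩ := hf.exists_vertex_le hx.1
    exact (vertexWeight_pos hx.1 ((hcover v hv).resolve_right
      fun h => (((hU v).1 h).2.trans_le (hvx.trans hx.2.2)).false) hpos).ne'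
  have hUpos : ∀ x ∈ X, vertexWeight K U x ≠ 0 := by
    intro x hx
    obtain ⟨v, hv, hpos, hvx⟩ := hf.exists_le_vertex hx.1
    exact (vertexWeight_pos hx.1 ((hcover v hv).resolve_left
      fun h => (((hL v).1 h).2.trans_le (hx.2.1.trans hvx)).false) hpos).ne'
  let l := vertexProjection K L
  let u := vertexProjection K U
  have hfl : ∀ x ∈ X, f (l x) < a := fun x hx =>
    hf.apply_vertexProjection_mem (convex_Iio a) (fun v hv => ((hL v).1 hv).2) hx.1 (hLpos x hx)
  have hfu : ∀ x ∈ X, b < f (u x) := fun x hx =>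
    hf.apply_vertexProjection_mem (convex_Ioi b) (fun v hv => ((hU v).1 hv).2) hx.1 (hUpos x hx)
  have hlc : ContinuousOn l X := continuousOn_vertexProjection hK L hXK hLpos
  have huc : ContinuousOn u X := continuousOn_vertexProjection hK U hXK hUpos
  have hlK : Set.MapsTo l X K.space := fun x hx => by
    obtain ⟨s, hs, hxs⟩ := Geometry.SimplicialComplex.mem_space_iff.1 hx.1
    exact Geometry.SimplicialComplex.mem_space_iff.2
      ⟨s, hs, vertexProjection_mem_convexHull hs hxs (hLpos x hx)⟩
  have huK : Set.MapsTo u X K.space := fun x hx => by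
    obtain ⟨s, hs, hxs⟩ := Geometry.SimplicialComplex.mem_space_iff.1 hx.1
    exact Geometry.SimplicialComplex.mem_space_iff.2
      ⟨s, hs, vertexProjection_mem_convexHull hs hxs (hUpos x hx)⟩
  -- the parameter of the point with value `t` on the segment of `x`
  let τ : E → ℝ → ℝ := fun x t => (t - f (l x)) / (f (u x) - f (l x))
  have hden : ∀ x ∈ X, 0 < f (u x) - f (l x) := fun x hx => by
    have := hfl x hx
    have := hfu x hx
    have := hx.2.1.trans hx.2.2
    linarith
  have hτ : ∀ x ∈ X, ∀ t ∈ Set.Icc a b, τ x t ∈ Set.Ioo (0 : ℝ) 1 := fun x hx t ht =>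
    ⟨div_pos (by linarith [hfl x hx, ht.1]) (hden x hx),
      (div_lt_one (hden x hx)).2 (by linarith [hfu x hx, ht.2])⟩
  -- `x` divides its segment in the ratio of the weights, and points on one segment have the same
  -- projections
  refine ⟨fun q => AffineMap.lineMap (l q.1) (u q.1) (τ q.1 q.2), ?_, fun x hx =>
    ⟨?_, fun t ht => ?_⟩⟩
  · have h1 : ContinuousOn (fun q : E × ℝ => l q.1) (X ×ˢ Set.Icc a b) :=
      hlc.comp continuousOn_fst fun q hq => hq.1
    have h2 : ContinuousOn (fun q : E × ℝ => u q.1) (X ×ˢ Set.Icc a b) :=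
      huc.comp continuousOn_fst fun q hq => hq.1
    have h3 : ContinuousOn (fun q : E × ℝ => f (l q.1)) (X ×ˢ Set.Icc a b) :=
      (hf.continuousOn hK).comp h1 fun q hq => hlK hq.1
    have h4 : ContinuousOn (fun q : E × ℝ => f (u q.1)) (X ×ˢ Set.Icc a b) :=
      (hf.continuousOn hK).comp h2 fun q hq => huK hq.1
    have h5 : ContinuousOn (fun q : E × ℝ => τ q.1 q.2) (X ×ˢ Set.Icc a b) :=
      (continuousOn_snd.sub h3).div (h4.sub h3) fun q hq => (hden q.1 hq.1).ne'
    simp only [AffineMap.lineMap_apply_module]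
    exact ((continuousOn_const.sub h5).smul h1).add (h5.smul h2)
  · obtain ⟨s, hs, hcar, hb⟩ := exists_carrier hx.1
    have hsub : s ⊆ L ∪ U := fun v hv =>
      Finset.mem_union.2 (hcover v (mem_vertices_of_mem_face hs hv))
    have hd : Disjoint L U := Finset.disjoint_left.2 (hdisj hx)
    have hw : vertexWeight K L x + vertexWeight K U x = 1 := by
      rw [vertexWeight, vertexWeight, ← Finset.sum_union hd]
      exact (hb.mono hsub).sum_eq_one
    have hline : AffineMap.lineMap (l x) (u x) (vertexWeight K U x) = x := by
      rw [AffineMap.lineMap_apply_module, ← hw, add_sub_cancel_right]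
      change _ • ((vertexWeight K L x)⁻¹ • _) + _ • ((vertexWeight K U x)⁻¹ • _) = x
      rw [smul_inv_smul₀ (hLpos x hx), smul_inv_smul₀ (hUpos x hx), ← Finset.sum_union hd]
      exact (hb.mono hsub).sum_smul
    have hwI : vertexWeight K U x ∈ Set.Icc (0 : ℝ) 1 :=
      ⟨vertexWeight_nonneg U hx.1, by linarith [vertexWeight_nonneg (K := K) L hx.1]⟩
    have hfx := hf.apply_lineMap hs
      (vertexProjection_mem_convexHull hs hb.mem_convexHull (hLpos x hx))
      (vertexProjection_mem_convexHull hs hb.mem_convexHull (hUpos x hx)) hwI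
    have hτx : τ x (f x) = vertexWeight K U x := by
      rw [div_eq_iff (hden x hx).ne']
      change f (AffineMap.lineMap (l x) (u x) _) = _ * f (l x) + _ * f (u x) at hfx
      rw [hline] at hfx
      rw [hfx]
      ring
    change AffineMap.lineMap (l x) (u x) (τ x (f x)) = x
    rw [hτx, hline]
  · obtain ⟨s, hs, hxs⟩ := Geometry.SimplicialComplex.mem_space_iff.1 hx.1
    have hls := vertexProjection_mem_convexHull hs hxs (hLpos x hx)
    have hus := vertexProjection_mem_convexHull hs hxs (hUpos x hx)
    have hτx := hτ x hx t ht
    have hτI : τ x t ∈ Set.Icc (0 : ℝ) 1 := ⟨hτx.1.le, hτx.2.le⟩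
    have hl : l (AffineMap.lineMap (l x) (u x) (τ x t)) = l x := by
      refine vertexProjection_congr (k := (1 - τ x t) * (vertexWeight K L x)⁻¹)
        (mul_ne_zero (sub_pos.2 hτx.2).ne' (inv_ne_zero (hLpos x hx))) fun v hv => ?_
      rw [baryCoord_lineMap hs hls hus hτI, baryCoord_vertexProjection hx.1 (hLpos x hx),
        baryCoord_vertexProjection hx.1 (hUpos x hx), if_pos hv, if_neg (hdisj hx v hv)]
      ring
    have hu : u (AffineMap.lineMap (l x) (u x) (τ x t)) = u x := by
      refine vertexProjection_congr (k := τ x t * (vertexWeight K U x)⁻¹)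
        (mul_ne_zero hτx.1.ne' (inv_ne_zero (hUpos x hx))) fun v hv => ?_
      rw [baryCoord_lineMap hs hls hus hτI, baryCoord_vertexProjection hx.1 (hLpos x hx),
        baryCoord_vertexProjection hx.1 (hUpos x hx), if_pos hv,
        if_neg fun hvL => hdisj hx v hvL hv]
      ring
    refine ⟨Geometry.SimplicialComplex.mem_space_iff.2
      ⟨s, hs, (convex_convexHull ℝ _).lineMap_mem hls hus hτI⟩, ?_, fun t' => ?_⟩
    · refine (hf.apply_lineMap hs hls hus hτI).trans ?_
      have : τ x t * (f (u x) - f (l x)) = t - f (l x) := div_mul_cancel₀ _ (hden x hx).ne'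
      change (1 - τ x t) * f (l x) + τ x t * f (u x) = t
      linarith
    · simp only [τ, hl, hu]

/-- The space `Y` that exhibits the interval as regular is a level set. -/
lemma IsPL.isRegularInterval (hf : IsPL K f) (hK : K.faces.Finite) {a b : ℝ} (hle : a ≤ b)
    (hab : ∀ v ∈ K.vertices, f v ∉ Set.Icc a b) {I : Set ℝ} (hI : closure I ⊆ Set.Icc a b) :
    IsRegularInterval K f I := by
  obtain ⟨S, hSc, hS⟩ := hf.exists_slide hK hab
  have hI' : I ⊆ Set.Icc a b := subset_closure.trans hI
  let Y := levelPreimage K f {a}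
  have haI : a ∈ Set.Icc a b := ⟨le_rfl, hle⟩
  have hY : ∀ y ∈ Y, y ∈ levelPreimage K f (Set.Icc a b) := fun y hy =>
    ⟨hy.1, by rw [show f y = a from hy.2]; exact haI⟩
  have hfc : ContinuousOn f (levelPreimage K f (Set.Icc a b)) :=
    (hf.continuousOn hK).mono fun x hx => hx.1
  have hIX : levelPreimage K f I ⊆ levelPreimage K f (Set.Icc a b) :=
    fun x hx => ⟨hx.1, hI' hx.2⟩
  have hfI : Continuous fun x : levelPreimage K f I => f x :=
    (hfc.mono hIX).comp_continuous continuous_subtype_val fun x => x.2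
  let Φ : (Y × I) ≃ₜ levelPreimage K f I :=
    { toFun := fun q => ⟨S (q.1, q.2), ((hS _ (hY _ q.1.2)).2 _ (hI' q.2.2)).1, by
        rw [((hS _ (hY _ q.1.2)).2 _ (hI' q.2.2)).2.1]
        exact q.2.2⟩
      invFun := fun x => ⟨⟨S (x, a), ((hS _ (hIX x.2)).2 a haI).1,
        ((hS _ (hIX x.2)).2 a haI).2.1⟩, ⟨f x, x.2.2⟩⟩
      left_inv := by
        rintro ⟨y, t⟩
        obtain ⟨h1, h2⟩ := hS _ (hY _ y.2)
        obtain ⟨-, h3, h4⟩ := h2 _ (hI' t.2)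
        refine Prod.ext (Subtype.ext ?_) (Subtype.ext h3)
        change S (S (y, t), a) = y
        rw [h4]
        rwa [show f y = a from y.2.2] at h1
      right_inv := by
        intro x
        obtain ⟨h1, h2⟩ := hS _ (hIX x.2)
        refine Subtype.ext ?_
        change S (S (x, a), f x) = x
        rw [(h2 a haI).2.2, h1]
      continuous_toFun := Continuous.subtype_mk (hSc.comp_continuous (by fun_prop)
        fun q => ⟨hY _ q.1.2, hI' q.2.2⟩) _
      continuous_invFun := Continuous.prodMk (Continuous.subtype_mk (hSc.comp_continuous
        (f := fun x : levelPreimage K f I => ((x : E), a)) (by fun_prop)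
        fun x => ⟨hIX x.2, haI⟩) _) (hfI.subtype_mk _) }
  refine ⟨Y, inferInstance, Φ,
    ⟨fun q => ⟨S (q.1, q.2), ((hS _ (hY _ q.1.2)).2 _ (hI q.2.2)).1, ?_⟩,
      Continuous.subtype_mk (hSc.comp_continuous (by fun_prop)
        fun q => ⟨hY _ q.1.2, hI q.2.2⟩) _⟩, fun y t => ?_, fun y t => rfl⟩
  · rw [((hS _ (hY _ q.1.2)).2 _ (hI q.2.2)).2.1]
    exact q.2.2
  · exact ((hS _ (hY _ y.2)).2 _ (hI' t.2)).2.1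

lemma IsPL.criticalValues_subset (hf : IsPL K f) (hK : K.faces.Finite) :
    criticalValues K f ⊆ f '' K.vertices := by
  intro c hc
  by_contra hcV
  have hopen : IsOpen (f '' K.vertices)ᶜ := ((finite_vertices hK).image f).isClosed.isOpen_compl
  obtain ⟨ε, hε, hball⟩ := Metric.isOpen_iff.1 hopen c hcV
  refine hc ⟨((c - ε / 2 : ℝ) : EReal), ((c + ε / 2 : ℝ) : EReal), ⟨?_, ?_⟩,
    hf.isRegularInterval hK (a := c - ε / 2) (b := c + ε / 2) (by linarith) (fun v hv hvI => ?_)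
      (closure_minimal (fun t ht => ?_) isClosed_Icc)⟩
  · exact EReal.coe_lt_coe_iff.2 (by linarith)
  · exact EReal.coe_lt_coe_iff.2 (by linarith)
  · refine hball (?_ : f v ∈ Metric.ball c ε) ⟨v, hv, rfl⟩
    rw [Metric.mem_ball, Real.dist_eq, abs_lt]
    exact ⟨by linarith [hvI.1], by linarith [hvI.2]⟩
  · exact ⟨(EReal.coe_lt_coe_iff.1 ht.1).le, (EReal.coe_lt_coe_iff.1 ht.2).le⟩

lemma IsPL.finite_homologicallyCriticalValues (hf : IsPL K f) (hK : K.faces.Finite) (p : ℕ) :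
    (homologicallyCriticalValues p K f).Finite :=
  ((finite_vertices hK).image f).subset fun _ hc => hf.criticalValues_subset hK hc.1

lemma finite_openSubcomplex (hK : K.faces.Finite) (a b : EReal) :
    (openSubcomplex K f a b).faces.Finite :=
  hK.subset fun _ hs => hs.1

end Finiteness

end LevelsetZigzag

end

theorem mainTheorem6 {E : Type} [NormedAddCommGroup E] [NormedSpace ℝ E]
    (p : ℕ) (hp : 1 ≤ p)
    (K : Geometry.SimplicialComplex ℝ E) (hK : K.faces.Finite)
    (f : E → ℝ) (hf : LevelsetZigzag.IsPL K f) (hgen : LevelsetZigzag.IsGeneric K f)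
    (hcomp : LevelsetZigzag.IsCompatible p K f) :
    (LevelsetZigzag.homologicallyCriticalValues p K f).Finite ∧
    ∀ (m : ℕ) (α : Fin (m + 2) ↪o EReal),
      LevelsetZigzag.IsHomologicallyCriticalList p K f α →
      (∀ i j : Fin (m + 2), i < j →
        LevelsetZigzag.DeformationRetractsTo
          (LevelsetZigzag.openPreimage K f (α i) (α j))
          (LevelsetZigzag.openSubcomplex K f (α i) (α j)).space) ∧
      Nonempty (LevelsetZigzag.ZigzagModule.Iso
        (LevelsetZigzag.discreteModule p K f α)
        (LevelsetZigzag.continuousModule p K f α)) := by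
  refine ⟨hf.finite_homologicallyCriticalValues hK p, fun m α hα => ?_⟩
  have hdef : ∀ i j : Fin (m + 2), i < j → LevelsetZigzag.DeformationRetractsTo
      (LevelsetZigzag.openPreimage K f (α i) (α j))
      (LevelsetZigzag.openSubcomplex K f (α i) (α j)).space :=
    fun i j hij => hcomp.deformationRetractsTo hf hK hα hij
  have hfin := LevelsetZigzag.finite_openSubcomplex (f := f) hK
  obtain ⟨n, rfl⟩ := Nat.exists_eq_add_of_le' hp
  have hV : ∀ i : Fin (m + 1), i.castSucc < i.succ := fun i => Fin.castSucc_lt_succ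
  have hW : ∀ i : Fin m, i.castSucc.castSucc < i.succ.succ := fun i =>
    Fin.castSucc_lt_succ.trans' (Fin.castSucc_lt_castSucc_iff.2 Fin.castSucc_lt_succ)
  exact ⟨hdef,
    ⟨{isoV := fun i => LevelsetZigzag.homologyComparisonIso _ (hfin _ _) n (hdef _ _ (hV i))
      isoW := fun i => LevelsetZigzag.homologyComparisonIso _ (hfin _ _) n (hdef _ _ (hW i))
      forward_comm := fun i => LevelsetZigzag.homologyComparisonIso_naturality (hfin _ _)
        (hfin _ _) n (hdef _ _ (hV i.castSucc)) (hdef _ _ (hW i))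
        (LevelsetZigzag.openSubcomplex_mono K f le_rfl (α.monotone (hV i.succ).le))
        (LevelsetZigzag.openPreimage_mono K f le_rfl (α.monotone (hV i.succ).le))
      backward_comm := fun i => LevelsetZigzag.homologyComparisonIso_naturality (hfin _ _)
        (hfin _ _) n (hdef _ _ (hV i.succ)) (hdef _ _ (hW i))
        (LevelsetZigzag.openSubcomplex_mono K f (α.monotone (hV i.castSucc).le) le_rfl)
        (LevelsetZigzag.openPreimage_mono K f (α.monotone (hV i.castSucc).le) le_rfl)}⟩⟩
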